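/- **Theorem.** Let the *chair* be the graph with vertices $0,1,2,3,4$ and edges $01,12,23,14$ (the claw $K_{1,3}$ with one edge subdivided once). All graphs are finite, simple and undirected. In $\{\text{chair}\}$-M-Deletion (resp. $\{\text{chair}\}$-TM-Deletion) one is given a graph $G$ and $k\in\mathbb N$, and asks whether there is a set $S\subseteq V(G)$ with $|S|\le k$ such that $G\setminus S$ does not contain the chair as a minor (resp. topological minor). A *nice tree decomposition* of $G$ consists of a tree decomposition $(T,(X_t)_{t\in V(T)})$ of $G$, a root $r\in V(T)$ and subgraphs $(G_t)_{t\in V(T)}$ of $G$ such that $X_r=\emptyset$, $G_r=G$, and every node $t$ is of one of the following kinds: * $t$ has no child, $X_t=\emptyset$, and $G_t$ is the empty graph; * $t$ has exactly one child $t'$, and either $X_t=X_{t'}\cup\{v\}$ and $G_t=G[V(G_{t'})\cup\{v\}]$ for some $v\notin X_{t'}$, or $X_t=X_{t'}\setminus\{v\}$ and $G_t=G_{t'}$ for some $v\in X_{t'}$; * $t$ has exactly two children $t',t''$, $X_t=X_{t'}=X_{t''}$, $E(G_{t'})\cap E(G_{t''})=E(G[X_t])$ and $G_t=(V(G_{t'})\cup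 V(G_{t''}),\,E(G_{t'})\cup E(G_{t''}))$. Its width is $w=\max_t|X_t|-1$ (read as $0$ if $G$ has no vertices). Each of $\{\text{chair}\}$-M-Deletion and $\{\text{chair}\}$-TM-Deletion can be solved in time $2^{O(w)}\cdot n$ if a nice tree decomposition of $G$ of width $w$ with a linear number of nodes is given, where $n=|V(G)|$. Precisely, for each of the two problems there is one program for a word RAM (unit cost for addition, truncated subtraction, multiplication, integer division, constants, indirect reads and writes, and tests for zero) that, on input $(G,k)$ together with a nice tree decomposition of $G$ of width $w$ with $N$ nodes ($G$ is given by its list of edges; the decomposition by its root and, for each node, the lists of its children and of its bag), always halts with the correct answer, and for which the following holds. 1. There is a constant $C$ such that on every input it makes at most $C\,2^{Cw}\,N$ steps, with all words it computes with less than $C\,2^{Cw}\,(N+k)$. 2. For every $c$ there is a constant $C$ such that on every input with $N\le c\,(w+1)\,n$ it makes at most $C\,2^{Cw}\,n$ steps, with all words it computes with less than $C\,2^{Cw}\,(n+k)$. -/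

import Mathlib

/-! ### Minors, topological minors, and the two deletion problems -/

namespace SingleExp

/-- `H` is a minor of `G`: there are pairwise disjoint nonempty connected branch sets `φ x`,
with an edge of `G` between `φ x` and `φ y` for every edge `xy` of `H`. -/
def IsMinor {W V : Type*} (H : SimpleGraph W) (G : SimpleGraph V) : Prop :=
  ∃ φ : W → Set V,
    (∀ x, (G.induce (φ x)).Connected) ∧
    (∀ x y, x ≠ y → Disjoint (φ x) (φ y)) ∧
    ∀ x y, H.Adj x y → ∃ x' ∈ φ x, ∃ y' ∈ φ y, G.Adj x' y'

/-- `H` is a topological minor of `G`: there are an injection `φ` of the vertices of `H` into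
those of `G` and, for every edge `xy` of `H`, a path `σ` of `G` from `φ x` to `φ y` (the same path,
up to its direction, for `xy` and `yx`), such that an internal vertex of the path of an edge is
neither a branch vertex nor a vertex of the path of another edge. -/
def IsTopologicalMinor {W V : Type*} (H : SimpleGraph W) (G : SimpleGraph V) : Prop :=
  ∃ (φ : W ↪ V) (σ : ∀ x y, H.Adj x y → G.Walk (φ x) (φ y)),
    (∀ x y (h : H.Adj x y), (σ x y h).IsPath) ∧
    (∀ x y (h : H.Adj x y), σ y x h.symm = (σ x y h).reverse) ∧
    (∀ x y (h : H.Adj x y) (z : W), φ z ∈ (σ x y h).support → z = x ∨ z = y) ∧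
    ∀ x y (h : H.Adj x y) x' y' (h' : H.Adj x' y'), s(x, y) ≠ s(x', y') →
      ∀ v ∈ (σ x y h).support, v ≠ φ x → v ≠ φ y → v ∉ (σ x' y' h').support

/-- The chair: the path `0 - 1 - 2 - 3` and a further vertex `4` adjacent to `1` only, that is,
the claw `K_{1,3}` with one edge subdivided once. -/
def chair : SimpleGraph (Fin 5) :=
  SimpleGraph.fromEdgeSet {s(0, 1), s(1, 2), s(2, 3), s(1, 4)}

/-- The question of `{H}`-M-Deletion on the input `(G, k)`: can one delete at most `k` vertices
of `G` so that no minor `H` is left? -/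
def MDeletion {W V : Type*} (H : SimpleGraph W) (G : SimpleGraph V) (k : ℕ) : Prop :=
  ∃ S : Finset V, S.card ≤ k ∧ ¬ IsMinor H (G.induce ((S : Set V)ᶜ))

/-- The question of `{H}`-TM-Deletion on the input `(G, k)`: can one delete at most `k` vertices
of `G` so that no topological minor `H` is left? -/
def TMDeletion {W V : Type*} (H : SimpleGraph W) (G : SimpleGraph V) (k : ℕ) : Prop :=
  ∃ S : Finset V, S.card ≤ k ∧ ¬ IsTopologicalMinor H (G.induce ((S : Set V)ᶜ))

/-! ### Nice tree decompositions -/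

/-- A tree decomposition of `G` whose tree has the node set `T`. -/
structure TreeDecomposition {V : Type*} (G : SimpleGraph V) (T : Type*) where
  tree : SimpleGraph T
  isTree : tree.IsTree
  bag : T → Finset V
  exists_mem_bag : ∀ v, ∃ t, v ∈ bag t
  exists_edge_bag : ∀ u v, G.Adj u v → ∃ t, u ∈ bag t ∧ v ∈ bag t
  bag_of_mem_path : ∀ (x y z : T) (p : tree.Walk x y), p.IsPath → z ∈ p.support →
    ∀ v, v ∈ bag x → v ∈ bag y → v ∈ bag z

/-- The width, i.e. the largest size of a bag minus one. If all bags are empty, which happens only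
for the graph without vertices, this is `0` here instead of `-1`. -/
def TreeDecomposition.width {V T : Type*} [Fintype T] {G : SimpleGraph V}
    (D : TreeDecomposition G T) : ℕ :=
  Finset.univ.sup (fun t => (D.bag t).card) - 1

/-- The children of the node `t` of the tree `A` rooted at `r`: the neighbours of `t` that are
farther away from the root. -/
def children {T : Type*} (A : SimpleGraph T) (r t : T) : Set T :=
  {t' | A.Adj t t' ∧ A.dist r t' = A.dist r t + 1}

/-- The subgraph `G[X]`, as a subgraph of `G`. -/
def inducedOn {V : Type*} (G : SimpleGraph V) (X : Set V) : G.Subgraph :=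
  (⊤ : G.Subgraph).induce X

/-- A nice tree decomposition `((T, X), r, (G_t))` of `G`. -/
structure NiceTreeDecomposition {V : Type*} (G : SimpleGraph V) (T : Type*)
    extends TreeDecomposition G T where
  root : T
  sub : T → G.Subgraph
  bag_root : bag root = ∅
  sub_root : sub root = ⊤
  /-- Every node has at most two children, and it is a leaf node, an introduce vertex node or a
  forget vertex node, or a join node, according to their number. -/
  node : ∀ t,
    (children tree root t = ∅ ∧ bag t = ∅ ∧ sub t = ⊥) ∨
    (∃ t', children tree root t = {t'} ∧
      ((∃ v, v ∉ bag t' ∧ (bag t : Set V) = (bag t' : Set V) ∪ {v} ∧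
          sub t = inducedOn G ((sub t').verts ∪ {v})) ∨
        (∃ v, v ∈ bag t' ∧ (bag t : Set V) = (bag t' : Set V) \ {v} ∧ sub t = sub t'))) ∨
    (∃ t' t'', t' ≠ t'' ∧ children tree root t = {t', t''} ∧
      bag t = bag t' ∧ bag t = bag t'' ∧
      (sub t').edgeSet ∩ (sub t'').edgeSet = (inducedOn G (bag t : Set V)).edgeSet ∧
      sub t = sub t' ⊔ sub t'')

/-! ### The machine model: a word RAM programmed in structured code -/

/-- The arithmetic operations: addition, subtraction (`0` if the result would be negative),
multiplication, and integer division (`0` if the divisor is `0`). -/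
inductive ArithOp
  | add
  | sub
  | mul
  | div

/-- The value of an arithmetic operation. -/
def ArithOp.eval : ArithOp → ℕ → ℕ → ℕ
  | .add, a, b => a + b
  | .sub, a, b => a - b
  | .mul, a, b => a * b
  | .div, a, b => a / b

/-- Programs of the machine. A number `x`, `y` or `z` names a register; a program mentions only
finitely many of them.
* `const x c` is `R[x] := c`;
* `arith o x y z` is `R[x] := R[y] o R[z]`;
* `load x y` is `R[x] := M[R[y]]`;
* `store x y` is `M[R[x]] := R[y]`;
* `seq P Q` is `P; Q`;
* `branch x P Q` is `if R[x] ≠ 0 then P else Q`;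
* `loop x P` is `while R[x] ≠ 0 do P`. -/
inductive RamProgram
  | const (x c : ℕ)
  | arith (o : ArithOp) (x y z : ℕ)
  | load (x y : ℕ)
  | store (x y : ℕ)
  | seq (P Q : RamProgram)
  | branch (x : ℕ) (P Q : RamProgram)
  | loop (x : ℕ) (P : RamProgram)

/-- A state of the machine: the contents of the registers and of the memory cells. -/
structure RamState where
  reg : ℕ → ℕ
  mem : ℕ → ℕ

/-- The state after `R[x] := v`. -/
def RamState.setReg (s : RamState) (x v : ℕ) : RamState :=
  ⟨Function.update s.reg x v, s.mem⟩

/-- The state after `M[a] := v`. -/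
def RamState.setMem (s : RamState) (a v : ℕ) : RamState :=
  ⟨s.reg, Function.update s.mem a v⟩

/-- The initial state: the input stands in the first memory cells, all else is `0`. -/
def RamState.start (input : List ℕ) : RamState :=
  ⟨fun _ => 0, fun a => input.getD a 0⟩

/-- `Exec B P s s' t`: on a machine whose words hold the numbers below `B`, the program `P`,
started in the state `s`, halts in the state `s'` after exactly `t` steps. An elementary
instruction and a test of a register count as one step each. An instruction that would put a number
`≥ B` into a register has no rule: the machine fails there. As only registers are copied into the
memory and used as addresses, nothing outside the word range is ever written or addressed. -/
inductive Exec (B : ℕ) : RamProgram → RamState → RamState → ℕ → Prop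
  | const {s : RamState} {x c : ℕ} (hc : c < B) :
      Exec B (.const x c) s (s.setReg x c) 1
  | arith {s : RamState} {o : ArithOp} {x y z : ℕ} (ho : o.eval (s.reg y) (s.reg z) < B) :
      Exec B (.arith o x y z) s (s.setReg x (o.eval (s.reg y) (s.reg z))) 1
  | load {s : RamState} {x y : ℕ} (hm : s.mem (s.reg y) < B) :
      Exec B (.load x y) s (s.setReg x (s.mem (s.reg y))) 1
  | store {s : RamState} {x y : ℕ} :
      Exec B (.store x y) s (s.setMem (s.reg x) (s.reg y)) 1
  | seq {P Q : RamProgram} {s s' s'' : RamState} {t t' : ℕ}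
      (hP : Exec B P s s' t) (hQ : Exec B Q s' s'' t') :
      Exec B (.seq P Q) s s'' (t + t')
  | branch_true {x : ℕ} {P Q : RamProgram} {s s' : RamState} {t : ℕ}
      (hx : s.reg x ≠ 0) (hP : Exec B P s s' t) :
      Exec B (.branch x P Q) s s' (1 + t)
  | branch_false {x : ℕ} {P Q : RamProgram} {s s' : RamState} {t : ℕ}
      (hx : s.reg x = 0) (hQ : Exec B Q s s' t) :
      Exec B (.branch x P Q) s s' (1 + t)
  | loop_true {x : ℕ} {P : RamProgram} {s s' s'' : RamState} {t t' : ℕ}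
      (hx : s.reg x ≠ 0) (hP : Exec B P s s' t) (hL : Exec B (.loop x P) s' s'' t') :
      Exec B (.loop x P) s s'' (1 + t + t')
  | loop_false {x : ℕ} {P : RamProgram} {s : RamState} (hx : s.reg x = 0) :
      Exec B (.loop x P) s s 1

/-- With words for the numbers below `B`, the program `P` halts on `input` after at most `time`
steps, with `1` in register `0` if `answer` is true and with `0` there if it is false. -/
def RamProgram.DecidesIn (P : RamProgram) (B time : ℕ) (input : List ℕ) (answer : Prop) : Prop :=
  ∃ (s : RamState) (t : ℕ), Exec B P (RamState.start input) s t ∧ t ≤ time ∧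
    (answer → s.reg 0 = 1) ∧ (¬ answer → s.reg 0 = 0)

/-! ### Inputs and the running time -/

/-- `input` is an encoding of a graph `G` on the vertices `0, …, n - 1`, an integer `k` and a nice
tree decomposition of `G` with the nodes `0, …, N - 1`. It consists of the five numbers
`n`, `|E(G)|`, `k`, `N` and the root, then both ends of every edge of `G`, and then, for every node
in turn, the number of its children, its children, the size of its bag, and its bag. The edges, the
ends of an edge, the children of a node and the vertices of a bag may come in any order. (The
subgraphs `G_t` are determined by the rest.) -/
def IsEncoding {n N : ℕ} (G : SimpleGraph (Fin n)) (k : ℕ)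
    (D : NiceTreeDecomposition G (Fin N)) (input : List ℕ) : Prop :=
  ∃ (es : List (Fin n × Fin n)) (ch : Fin N → List (Fin N)) (bs : Fin N → List (Fin n)),
    (es.map (fun e => s(e.1, e.2))).Nodup ∧
    (∀ u v, G.Adj u v ↔ s(u, v) ∈ es.map (fun e => s(e.1, e.2))) ∧
    (∀ t, (ch t).Nodup ∧ ∀ t', t' ∈ ch t ↔ t' ∈ children D.tree D.root t) ∧
    (∀ t, (bs t).Nodup ∧ ∀ v, v ∈ bs t ↔ v ∈ D.bag t) ∧
    input = [n, es.length, k, N, (D.root : ℕ)] ++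
      es.flatMap (fun e => [(e.1 : ℕ), (e.2 : ℕ)]) ++
      (List.finRange N).flatMap (fun t =>
        (ch t).length :: (ch t).map (fun t' => (t' : ℕ)) ++
        (bs t).length :: (bs t).map (fun v => (v : ℕ)))

/-- The problem with the question `Q G k` can be solved in single-exponential linear time if a nice
tree decomposition is given with `G`: there is a program `P` that, on every graph `G` with `n`
vertices, every `k`, and every nice tree decomposition of `G`, of width `w` and with `N` nodes,
* decides `Q G k` in time `2^{O(w)} · N`, on words of `O(w + log (N + k))` bits, and
* decides `Q G k` in time `2^{O(w)} · n`, on words of `O(w + log (n + k))` bits, if the nice tree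
  decomposition has `O((w + 1) · n)` nodes. -/
def SolvableGivenNiceTreeDecomposition
    (Q : ∀ {n : ℕ}, SimpleGraph (Fin n) → ℕ → Prop) : Prop :=
  ∃ P : RamProgram,
    (∃ C : ℕ, ∀ (n N : ℕ) (G : SimpleGraph (Fin n)) (k : ℕ)
      (D : NiceTreeDecomposition G (Fin N)) (input : List ℕ), IsEncoding G k D input →
      P.DecidesIn (C * 2 ^ (C * D.width) * (N + k)) (C * 2 ^ (C * D.width) * N)
        input (Q G k)) ∧
    (∀ c : ℕ, ∃ C : ℕ, ∀ (n N : ℕ) (G : SimpleGraph (Fin n)) (k : ℕ)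
      (D : NiceTreeDecomposition G (Fin N)) (input : List ℕ), IsEncoding G k D input →
      N ≤ c * (D.width + 1) * n →
      P.DecidesIn (C * 2 ^ (C * D.width) * (n + k)) (C * 2 ^ (C * D.width) * n)
        input (Q G k))

end SingleExp

namespace SingleExp

/-! ### Monotonicity of the machine model -/

/-! For the chair, minors, topological minors and subgraphs exclude the same finite graphs. Any
model of the chair gives a vertex of degree at least three whose component has at least five
vertices and an edge avoiding this vertex, and `HasChair.of_five` finds a chair subgraph there. So
both problems ask for the same deletion sets (`isMinor_chair_iff`, `isTopologicalMinor_chair_iff`),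
and one program serves both.

A graph has no chair subgraph if and only if a vertex of degree at least four has only neighbours of
degree one, and a vertex `c` of degree three has no neighbour with a neighbour outside the closed
neighbourhood of `c`. Labels certify this: the degree clipped to `1, …, 4`, or `5` for a deleted
vertex. At a vertex labelled `3`, the condition compares two sums: the label minus one over the
neighbours, and the ordered pairs of adjacent neighbours. The first exceeds the second as soon as
some edge leaves the neighbourhood. Degree bounds and both sums are packed into one bounded number
per vertex, its charge, to which every edge and every triangle at the vertex contributes separately
(`exists_not_hasChair_iff`). No information on connectivity is needed.

Edges and triangles are cliques, so each lies in a bag and has exactly one topmost node; there it is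
charged, once. A state of a bag assigns to each of its vertices the label and the charge collected
so far, a digit below `8 * 2048 = 16384`. Hence a bag has at most `16384 ^ (w + 1)` states. The
table of a node holds the least number of deletions for every state, and the children are merged
into it one by one over all pairs of states: `Partial.split` and `Partial.glue` show that admissible
labels restrict and combine, `Table.combine` turns this into a statement on tables, and `Table.root`
reads off the answer. The argument uses the empty bag at the root and the bound of two children per
node, but does not distinguish the kinds of nodes.

The program is written in a small language with arrays and bounded loops, whose compiler is proved
correct in `Cmd.exec_compile`; its commands are verified by proof rules with invariants. A loop is
bounded either by `R`, the number of states, or by `L = N * R`. Loops of the second kind are never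
nested, so the time is polynomial in `R` and linear in `N`. Adjacency is tested without an adjacency
matrix: an edge is stored at the end whose topmost node comes later in a breadth-first search, and
then a vertex stores no more neighbours than one bag holds (`Enc.length_out_le`). -/

theorem Exec.mono {B B' : ℕ} (h : B ≤ B') {P : RamProgram} {s s' : RamState} {t : ℕ}
    (e : Exec B P s s' t) : Exec B' P s s' t := by
  induction e with
  | const hc => exact .const (hc.trans_le h)
  | arith ho => exact .arith (ho.trans_le h)
  | load hm => exact .load (hm.trans_le h)
  | store => exact .store
  | seq _ _ ih1 ih2 => exact .seq ih1 ih2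
  | branch_true hx _ ih => exact .branch_true hx ih
  | branch_false hx _ ih => exact .branch_false hx ih
  | loop_true hx _ _ ih1 ih2 => exact .loop_true hx ih1 ih2
  | loop_false hx => exact .loop_false hx

theorem RamProgram.DecidesIn.mono {P : RamProgram} {B B' T T' : ℕ} {input : List ℕ} {a a' : Prop}
    (hB : B ≤ B') (hT : T ≤ T') (ha : a ↔ a') (h : P.DecidesIn B T input a) :
    P.DecidesIn B' T' input a' := by
  obtain ⟨s, t, he, ht, h1, h2⟩ := h
  exact ⟨s, t, he.mono hB, ht.trans hT, fun x => h1 (ha.2 x), fun x => h2 (fun y => x (ha.1 y))⟩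

/-! ### A language with arrays and bounded loops, and its compiler -/

attribute [simp] ArithOp.eval

/-- Arithmetic expressions over registers and arrays. -/
inductive Expr
  | lit (c : ℕ)
  | reg (x : ℕ)
  | op (o : ArithOp) (a b : Expr)
  | arr (j : ℕ) (e : Expr)

/-- States: registers and infinitely long arrays. -/
structure VState where
  reg : ℕ → ℕ
  arr : ℕ → ℕ → ℕ

def VState.set (s : VState) (x v : ℕ) : VState := ⟨Function.update s.reg x v, s.arr⟩

def VState.put (s : VState) (j i v : ℕ) : VState :=
  ⟨s.reg, Function.update s.arr j (Function.update (s.arr j) i v)⟩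

@[simp] theorem VState.set_reg (s : VState) (x v y : ℕ) :
    (s.set x v).reg y = if y = x then v else s.reg y := by
  simp [VState.set, Function.update_apply]

@[simp] theorem VState.set_arr (s : VState) (x v : ℕ) : (s.set x v).arr = s.arr := rfl

@[simp] theorem VState.put_reg (s : VState) (j i v : ℕ) : (s.put j i v).reg = s.reg := rfl

@[simp] theorem VState.put_arr (s : VState) (j i v j' : ℕ) :
    (s.put j i v).arr j' = if j' = j then Function.update (s.arr j) i v else s.arr j' := by
  simp only [VState.put, Function.update_apply]

@[simp] def Expr.eval (s : VState) : Expr → ℕ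
  | .lit c => c
  | .reg x => s.reg x
  | .op o a b => o.eval (a.eval s) (b.eval s)
  | .arr j e => s.arr j (e.eval s)

/-- No intermediate result reaches `M`, provided that this holds for the state. -/
@[simp] def Expr.Safe (M : ℕ) (s : VState) : Expr → Prop
  | .lit c => c < M
  | .reg _ => True
  | .op .add a b => a.Safe M s ∧ b.Safe M s ∧ a.eval s + b.eval s < M
  | .op .mul a b => a.Safe M s ∧ b.Safe M s ∧ a.eval s * b.eval s < M
  | .op _ a b => a.Safe M s ∧ b.Safe M s
  | .arr _ e => e.Safe M s

/-- Commands; `forUp l x y c` is `for x from 0 to R[y] - 1 do c`, where the flag `l` tells which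
bound on the number of iterations is to be used. -/
inductive Cmd
  | skip
  | assign (x : ℕ) (e : Expr)
  | store (j : ℕ) (e e' : Expr)
  | seq (c c' : Cmd)
  | ite (e : Expr) (c c' : Cmd)
  | forUp (l : Bool) (x y : ℕ) (c : Cmd)

def VState.incr (x : ℕ) (s : VState) : VState := s.set x (s.reg x + 1)

/-- The number of iterations is read once, before the first of them. The compiled loop instead
compares bound and counter every time; the two agree because `Cmd.wf` forbids the body to change
either. -/
def Cmd.run : Cmd → VState → VState
  | .skip, s => s
  | .assign x e, s => s.set x (e.eval s)
  | .store j e e', s => s.put j (e.eval s) (e'.eval s)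
  | .seq c c', s => c'.run (c.run s)
  | .ite e c c', s => if e.eval s = 0 then c'.run s else c.run s
  | .forUp _ x y c, s => (fun s' => (c.run s').incr x)^[s.reg y] (s.set x 0)

/-- In the application, `M` bounds all numbers, `R` is the number of states of a largest bag and `L`
bounds the length of the input. Keeping two bounds for loops apart is what makes the final time
linear in the number of nodes. -/
def Cmd.Safe (M R L : ℕ) : Cmd → VState → Prop
  | .skip, _ => True
  | .assign _ e, s => e.Safe M s
  | .store _ e e', s => e.Safe M s ∧ e'.Safe M s
  | .seq c c', s => c.Safe M R L s ∧ c'.Safe M R L (c.run s)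
  | .ite e c c', s => e.Safe M s ∧ (e.eval s ≠ 0 → c.Safe M R L s) ∧
      (e.eval s = 0 → c'.Safe M R L s)
  | .forUp l x y c, s => s.reg y ≤ (if l then L else R) ∧
      ∀ i < s.reg y, c.Safe M R L ((fun s' => (c.run s').incr x)^[i] (s.set x 0))

/-- The registers that a command may change. -/
def Cmd.regs : Cmd → List ℕ
  | .skip => []
  | .assign x _ => [x]
  | .store _ _ _ => []
  | .seq c c' => c.regs ++ c'.regs
  | .ite _ c c' => c.regs ++ c'.regs
  | .forUp _ x _ c => x :: c.regs

/-- The arrays that a command may change. -/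
def Cmd.arrs : Cmd → List ℕ
  | .skip => []
  | .assign _ _ => []
  | .store j _ _ => [j]
  | .seq c c' => c.arrs ++ c'.arrs
  | .ite _ c c' => c.arrs ++ c'.arrs
  | .forUp _ _ _ c => c.arrs

def Expr.wf (st : ℕ) : Expr → Bool
  | .lit _ => true
  | .reg _ => true
  | .op _ a b => a.wf st && b.wf st
  | .arr j e => decide (j < st) && e.wf st

/-- All arrays have numbers below `st`, and the counter and the bound of a loop are not changed in
the loop. -/
def Cmd.wf (st : ℕ) : Cmd → Bool
  | .skip => true
  | .assign _ e => e.wf st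
  | .store j e e' => decide (j < st) && e.wf st && e'.wf st
  | .seq c c' => c.wf st && c'.wf st
  | .ite e c c' => e.wf st && c.wf st && c'.wf st
  | .forUp _ x y c => decide (x ≠ y) && !c.regs.contains x && !c.regs.contains y && c.wf st

/-- Register `x` of the language is register `2 * x` of the machine, the odd registers from `3` on
hold intermediate results, and register `1` the start of the arrays. -/
def Expr.compile (st : ℕ) : Expr → ℕ → RamProgram
  | .lit c, d => .const (2 * d + 3) c
  | .reg x, d => .seq (.const (2 * d + 3) 0) (.arith .add (2 * d + 3) (2 * x) (2 * d + 3))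
  | .op o a b, d => .seq (a.compile st d) (.seq (b.compile st (d + 1))
      (.arith o (2 * d + 3) (2 * d + 3) (2 * (d + 1) + 3)))
  | .arr j e, d => .seq (e.compile st d) (.seq (.const (2 * d + 5) st)
      (.seq (.arith .mul (2 * d + 3) (2 * d + 5) (2 * d + 3)) (.seq (.const (2 * d + 5) j)
        (.seq (.arith .add (2 * d + 3) (2 * d + 3) (2 * d + 5))
          (.seq (.arith .add (2 * d + 3) 1 (2 * d + 3)) (.load (2 * d + 3) (2 * d + 3)))))))

def Expr.cost : Expr → ℕ
  | .lit _ => 1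
  | .reg _ => 2
  | .op _ a b => a.cost + b.cost + 1
  | .arr _ e => e.cost + 6

/-- The address of a cell of array `j`, into the first register for intermediate results. -/
def compileAddr (st j : ℕ) (e : Expr) : RamProgram :=
  .seq (e.compile st 0) (.seq (.const 5 st) (.seq (.arith .mul 3 5 3) (.seq (.const 5 j)
    (.seq (.arith .add 3 3 5) (.arith .add 3 1 3)))))

/-- The machine has no instruction that copies a register, so a register holding zero is added. -/
def compileAssign (st x : ℕ) (e : Expr) : RamProgram :=
  .seq (e.compile st 0) (.seq (.const 5 0) (.arith .add (2 * x) 3 5))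

def Cmd.compile (st : ℕ) : Cmd → RamProgram
  | .skip => .const 3 0
  | .assign x e => compileAssign st x e
  | .store j e e' => .seq (compileAddr st j e) (.seq (e'.compile st 1) (.store 3 5))
  | .seq c c' => .seq (c.compile st) (c'.compile st)
  | .ite e c c' => .seq (e.compile st 0) (.branch 3 (c.compile st) (c'.compile st))
  | .forUp _ x y c => .seq (compileAssign st x (.lit 0))
      (.seq ((Expr.op .sub (.reg y) (.reg x)).compile st 0)
        (.loop 3 (.seq (c.compile st) (.seq (compileAssign st x (.op .add (.reg x) (.lit 1)))
          ((Expr.op .sub (.reg y) (.reg x)).compile st 0)))))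

/-- A bound on the running time, if the loops of the two kinds make at most `R` and `L`
iterations. -/
def Cmd.cost (R L : ℕ) : Cmd → ℕ
  | .skip => 1
  | .assign _ e => e.cost + 2
  | .store _ e e' => e.cost + e'.cost + 6
  | .seq c c' => c.cost R L + c'.cost R L
  | .ite e c c' => e.cost + 1 + c.cost R L + c'.cost R L
  | .forUp l _ _ c => 9 + (if l then L else R) * (c.cost R L + 12)

/-! ### Correctness of the compiler -/

theorem Cmd.run_reg {c : Cmd} {s : VState} {x : ℕ} (h : x ∉ c.regs) :
    (c.run s).reg x = s.reg x := by
  induction c generalizing s with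
  | skip => rfl
  | assign y e => simp_all [Cmd.run, Cmd.regs]
  | store j e e' => rfl
  | seq c c' ih ih' => simp_all [Cmd.run, Cmd.regs]
  | ite e c c' ih ih' => simp only [Cmd.run]; split <;> simp_all [Cmd.regs]
  | forUp l y z c ih =>
    simp only [Cmd.regs, List.mem_cons, not_or] at h
    simp only [Cmd.run]
    suffices ∀ k, ((fun s' => (c.run s').incr y)^[k] (s.set y 0)).reg x = s.reg x from this _
    intro k
    induction k with
    | zero => simp [h.1]
    | succ k ihk => rw [Function.iterate_succ_apply', VState.incr, VState.set_reg, if_neg h.1,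
        ih h.2, ihk]

theorem Cmd.run_arr {c : Cmd} {s : VState} {j : ℕ} (h : j ∉ c.arrs) :
    (c.run s).arr j = s.arr j := by
  induction c generalizing s with
  | skip => rfl
  | assign y e => rfl
  | store i e e' => simp_all [Cmd.run, Cmd.arrs]
  | seq c c' ih ih' => simp_all [Cmd.run, Cmd.arrs]
  | ite e c c' ih ih' => simp only [Cmd.run]; split <;> simp_all [Cmd.arrs]
  | forUp l y z c ih =>
    simp only [Cmd.arrs] at h
    simp only [Cmd.run]
    suffices ∀ k, ((fun s' => (c.run s').incr y)^[k] (s.set y 0)).arr j = s.arr j from this _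
    intro k
    induction k with
    | zero => simp
    | succ k ihk => rw [Function.iterate_succ_apply', VState.incr, VState.set_arr, ih h, ihk]

/-- The machine state `σ` represents the state `s`, with the arrays interleaved from the address
`b` on. -/
structure Sim (st b : ℕ) (s : VState) (σ : RamState) : Prop where
  reg : ∀ x, σ.reg (2 * x) = s.reg x
  base : σ.reg 1 = b
  arr : ∀ j < st, ∀ i, σ.mem (b + (st * i + j)) = s.arr j i

/-- All registers and array cells hold numbers below `M`. -/
structure VState.Below (M : ℕ) (s : VState) : Prop where
  reg : ∀ x, s.reg x < M
  arr : ∀ j i, s.arr j i < M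

theorem Expr.eval_lt {M : ℕ} {s : VState} (hb : s.Below M) {e : Expr} (he : e.Safe M s) :
    e.eval s < M := by
  induction e with
  | lit c => exact he
  | reg x => exact hb.reg x
  | op o a b iha ihb =>
    cases o with
    | add => exact he.2.2
    | mul => exact he.2.2
    | sub => exact (Nat.sub_le _ _).trans_lt (iha he.1)
    | div => exact (Nat.div_le_self _ _).trans_lt (iha he.1)
  | arr j e ih => exact hb.arr _ _

theorem Expr.Safe.left {M : ℕ} {s : VState} {o : ArithOp} {a b : Expr}
    (h : (Expr.op o a b).Safe M s) : a.Safe M s := by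
  cases o <;> exact h.1

theorem Expr.Safe.right {M : ℕ} {s : VState} {o : ArithOp} {a b : Expr}
    (h : (Expr.op o a b).Safe M s) : b.Safe M s := by
  cases o
  · exact h.2.1
  · exact h.2
  · exact h.2.1
  · exact h.2

theorem Exec.const' {B x c : ℕ} {s : RamState} (hc : c < B) :
    Exec B (.const x c) s ⟨Function.update s.reg x c, s.mem⟩ 1 := .const hc

theorem Exec.arith' {B x y z v : ℕ} {o : ArithOp} {s : RamState}
    (hv : o.eval (s.reg y) (s.reg z) = v) (hc : v < B) :
    Exec B (.arith o x y z) s ⟨Function.update s.reg x v, s.mem⟩ 1 := by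
  subst hv; exact .arith hc

/-- What the code of an expression leaves unchanged. -/
structure Keeps (d : ℕ) (σ σ' : RamState) : Prop where
  mem : σ'.mem = σ.mem
  reg : ∀ r, (r % 2 = 0 ∨ r < 2 * d + 3) → σ'.reg r = σ.reg r

theorem Keeps.sim {d st b : ℕ} {s : VState} {σ σ' : RamState} (h : Keeps d σ σ')
    (hs : Sim st b s σ) : Sim st b s σ' :=
  ⟨fun x => by rw [h.reg _ (.inl (by omega)), hs.reg], by rw [h.reg _ (.inr (by omega)), hs.base],
    fun j hj i => by rw [h.mem, hs.arr j hj]⟩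

/-- Six machine steps that compute the address of an array cell. -/
theorem exec_addr {B M st b j d v : ℕ} {σ : RamState} (hB : b + st * M + st < B) (hst : j < st)
    (hv : v < M) (h1 : σ.reg 1 = b) (h : σ.reg (2 * d + 3) = v) (P : RamProgram)
    {σ' : RamState} {t : ℕ} (hP : Exec B P ⟨Function.update (Function.update σ.reg (2 * d + 5) j)
      (2 * d + 3) (b + (st * v + j)), σ.mem⟩ σ' t) :
    Exec B (.seq (.const (2 * d + 5) st)
      (.seq (.arith .mul (2 * d + 3) (2 * d + 5) (2 * d + 3)) (.seq (.const (2 * d + 5) j)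
        (.seq (.arith .add (2 * d + 3) (2 * d + 3) (2 * d + 5))
          (.seq (.arith .add (2 * d + 3) 1 (2 * d + 3)) P))))) σ σ' (t + 5) := by
  have hm : st * v ≤ st * M := Nat.mul_le_mul_left _ hv.le
  have e1 : ∀ x, Function.update σ.reg (2 * d + 5) x (2 * d + 3) = σ.reg (2 * d + 3) := fun x => by
    rw [Function.update_of_ne (by omega)]
  rw [show t + 5 = 1 + (1 + (1 + (1 + (1 + t)))) by ring]
  refine .seq (.const' (by omega)) (.seq (.arith' (v := st * v) ?_ (by omega)) (.seq (.const' (by omega))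
    (.seq (.arith' (v := st * v + j) ?_ (by omega)) (.seq
      (.arith' (v := b + (st * v + j)) ?_ (by omega)) ?_))))
  · simp [ArithOp.eval, h]
  · simp [ArithOp.eval]
  · simp [ArithOp.eval, h1]
  · convert hP using 2
    funext r
    simp only [Function.update_apply]
    split_ifs <;> rfl

/-- The depth `d` acts as the height of a stack: code at depth `d` writes only to odd registers from
`2 * d + 3` on. The value of a left operand therefore survives the evaluation of the right one at
depth `d + 1`, and the registers of the language, being even, survive both. -/
theorem Expr.exec_compile {B M st b : ℕ} {s : VState} (hst : 0 < st) (hB : b + st * M + st < B)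
    (hb : s.Below M) (e : Expr) (he : e.Safe M s) (hw : e.wf st = true) (d : ℕ) (σ : RamState)
    (hs : Sim st b s σ) :
    ∃ σ', Exec B (e.compile st d) σ σ' e.cost ∧ σ'.reg (2 * d + 3) = e.eval s ∧ Keeps d σ σ' := by
  have hMB : M ≤ B := by nlinarith
  induction e generalizing d σ with
  | lit c =>
    refine ⟨_, .const' (lt_of_lt_of_le he hMB), by simp, rfl, fun r hr => ?_⟩
    exact Function.update_of_ne (by omega) _ _
  | reg x =>
    refine ⟨_, .seq (.const' (by omega)) (.arith' (v := s.reg x) ?_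
      ((hb.reg x).trans_le hMB)), by simp, rfl, fun r hr => ?_⟩
    · simp only [ArithOp.eval, Function.update_self]
      rw [Function.update_of_ne (by omega), hs.reg, add_zero]
    · exact (Function.update_of_ne (by omega) _ _).trans (Function.update_of_ne (by omega) _ _)
  | op o x y ihx ihy =>
    simp only [Expr.wf, Bool.and_eq_true] at hw
    obtain ⟨σ1, h1, h1v, h1k⟩ := ihx he.left hw.1 d σ hs
    obtain ⟨σ2, h2, h2v, h2k⟩ := ihy he.right hw.2 (d + 1) σ1 (h1k.sim hs)
    refine ⟨⟨Function.update σ2.reg (2 * d + 3) ((Expr.op o x y).eval s), σ2.mem⟩, ?_,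
      Function.update_self .., h2k.mem.trans h1k.mem, fun r hr => ?_⟩
    · rw [Expr.cost, add_assoc]
      refine .seq h1 (.seq h2 (.arith' (v := (Expr.op o x y).eval s) ?_
        ((Expr.eval_lt hb he).trans_le hMB)))
      rw [h2v, h2k.reg _ (.inr (by omega)), h1v]
      rfl
    · simp only
      rw [Function.update_of_ne (by omega), h2k.reg r (by omega), h1k.reg r hr]
  | arr j e ih =>
    simp only [Expr.wf, Bool.and_eq_true, decide_eq_true_eq] at hw
    obtain ⟨σ1, h1, h1v, h1k⟩ := ih he hw.2 d σ hs
    have h1s := h1k.sim hs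
    refine ⟨_, .seq h1 (exec_addr hB hw.1 (Expr.eval_lt hb (e := e) he) h1s.base h1v _
      (.load ?_)), ?_, ?_, fun r hr => ?_⟩
    · simpa [h1s.arr j hw.1] using (hb.arr j _).trans_le hMB
    · simp [RamState.setReg, h1s.arr j hw.1]
    · exact h1k.mem
    · simp only [RamState.setReg]
      rw [Function.update_of_ne (by omega), Function.update_of_ne (by omega),
        Function.update_of_ne (by omega), h1k.reg r hr]

theorem exec_compileAssign {B M st b x : ℕ} {s : VState} (hst : 0 < st) (hB : b + st * M + st < B)
    (hb : s.Below M) {e : Expr} (he : e.Safe M s) (hw : e.wf st = true) (σ : RamState)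
    (hs : Sim st b s σ) :
    ∃ σ', Exec B (compileAssign st x e) σ σ' (e.cost + 2) ∧ Sim st b (s.set x (e.eval s)) σ' := by
  have hMB : M ≤ B := by nlinarith
  obtain ⟨σ1, h1, h1v, h1k⟩ := e.exec_compile hst hB hb he hw 0 σ hs
  have h1s := h1k.sim hs
  refine ⟨_, .seq h1 (.seq (.const' (by omega)) (.arith' (v := e.eval s) ?_
    ((Expr.eval_lt hb he).trans_le hMB))), fun y => ?_, ?_, fun j hj i => ?_⟩
  · simpa [ArithOp.eval] using h1v
  · simp only [VState.set_reg, Function.update_apply]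
    rw [h1s.reg, if_neg (show 2 * y ≠ 5 by omega)]
    congr 1
    simp
  · simp only [Function.update_apply]
    rw [if_neg (by omega), if_neg (by omega), h1s.base]
  · simp [h1s.arr j hj]

theorem VState.Below.set {M x v : ℕ} {s : VState} (hb : s.Below M) (hv : v < M) :
    (s.set x v).Below M := by
  refine ⟨fun y => ?_, hb.arr⟩
  rw [VState.set_reg]
  split
  · exact hv
  · exact hb.reg y

theorem VState.Below.put {M j i v : ℕ} {s : VState} (hb : s.Below M) (hv : v < M) :
    (s.put j i v).Below M := by
  refine ⟨hb.reg, fun j' i' => ?_⟩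
  rw [VState.put_arr]
  split
  · rw [Function.update_apply]
    split
    · exact hv
    · exact hb.arr j i'
  · exact hb.arr j' i'

/-- The compiled code simulates a command. -/
theorem Cmd.exec_compile {B M R L st b : ℕ} (hst : 0 < st) (hB : b + st * M + st < B) (hM : 1 < M)
    (c : Cmd) (s : VState) (hb : s.Below M) (hc : c.Safe M R L s) (hw : c.wf st = true)
    (σ : RamState) (hs : Sim st b s σ) :
    ∃ σ' t, Exec B (c.compile st) σ σ' t ∧ t ≤ c.cost R L ∧ Sim st b (c.run s) σ' ∧
      (c.run s).Below M := by
  have hMB : M ≤ B := by nlinarith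
  induction c generalizing s σ with
  | skip =>
    refine ⟨_, _, .const' (by omega), le_rfl, ⟨fun x => ?_, ?_, hs.arr⟩, hb⟩
    · simp only [Function.update_apply]
      rw [if_neg (by omega), hs.reg]; rfl
    · simp only [Function.update_apply]
      rw [if_neg (by omega), hs.base]
  | assign x e =>
    obtain ⟨σ1, h1, h1s⟩ := exec_compileAssign (x := x) hst hB hb hc hw σ hs
    exact ⟨σ1, _, h1, le_rfl, h1s, hb.set (Expr.eval_lt hb hc)⟩
  | store j e e' =>
    simp only [Cmd.wf, Bool.and_eq_true, decide_eq_true_eq] at hw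
    obtain ⟨σ1, h1, h1v, h1k⟩ := e.exec_compile hst hB hb hc.1 hw.1.2 0 σ hs
    have h1s := h1k.sim hs
    have hv := Expr.eval_lt hb hc.1
    have hmul : st * e.eval s ≤ st * M := Nat.mul_le_mul_left _ hv.le
    have hA : Exec B (compileAddr st j e) σ ⟨Function.update (Function.update σ1.reg 5 j)
        3 (b + (st * e.eval s + j)), σ1.mem⟩ (e.cost + (1 + (1 + (1 + (1 + 1))))) := by
      have hu : Function.update (Function.update σ1.reg 5 j) 3 (b + (st * e.eval s + j)) =
          Function.update (Function.update (Function.update (Function.update (Function.update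
            σ1.reg 5 st) 3 (st * e.eval s)) 5 j) 3 (st * e.eval s + j)) 3
              (b + (st * e.eval s + j)) := by
        funext r
        simp only [Function.update_apply]
        split_ifs <;> rfl
      rw [hu]
      refine .seq h1 (.seq (.const' (by omega)) (.seq (.arith' ?_ (by omega))
        (.seq (.const' (by omega)) (.seq (.arith' ?_ (by omega)) (.arith' ?_ (by omega))))))
      · simp [ArithOp.eval]; left; simpa using h1v
      · simp [ArithOp.eval]
      · simp [ArithOp.eval, h1s.base]
    have hAs : Sim st b s ⟨Function.update (Function.update σ1.reg 5 j)
        3 (b + (st * e.eval s + j)), σ1.mem⟩ := by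
      refine ⟨fun x => ?_, ?_, h1s.arr⟩
      · simp only [Function.update_apply]
        rw [if_neg (by omega), if_neg (by omega), h1s.reg]
      · simp [h1s.base]
    obtain ⟨σ2, h2, h2v, h2k⟩ := e'.exec_compile hst hB hb hc.2 hw.2 1 _ hAs
    have h2s := h2k.sim hAs
    refine ⟨_, _, .seq hA (.seq h2 .store), ?_, ⟨h2s.reg, h2s.base, fun j' hj' i => ?_⟩,
      hb.put (Expr.eval_lt hb hc.2)⟩
    · simp only [Cmd.cost]; omega
    · have h3 : σ2.reg 3 = b + (st * e.eval s + j) := by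
        rw [h2k.reg 3 (.inr (by omega))]; simp
      simp only [RamState.setMem, h3, Cmd.run, VState.put_arr]
      rw [Function.update_apply, h2s.arr j' hj']
      by_cases hj : j' = j
      · subst hj
        rw [if_pos rfl, Function.update_apply, show σ2.reg 5 = _ from h2v]
        congr 1
        simp only [eq_iff_iff]
        constructor
        · intro h
          exact Nat.eq_of_mul_eq_mul_left hst (by omega)
        · rintro rfl; rfl
      · rw [if_neg hj, if_neg]
        intro h
        apply hj
        have h' : st * i + j' = st * e.eval s + j := by omega
        -- Cells of different arrays lie in different residue classes modulo `st`.
        have := congrArg (· % st) h'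
        simpa [Nat.mul_add_mod, Nat.mod_eq_of_lt hj', Nat.mod_eq_of_lt hw.1.1] using this
  | seq c c' ih ih' =>
    simp only [Cmd.wf, Bool.and_eq_true] at hw
    obtain ⟨σ1, t1, h1, h1t, h1s, h1b⟩ := ih s hb hc.1 hw.1 σ hs
    obtain ⟨σ2, t2, h2, h2t, h2s, h2b⟩ := ih' _ h1b hc.2 hw.2 σ1 h1s
    exact ⟨σ2, _, .seq h1 h2, by simp only [Cmd.cost]; omega, h2s, h2b⟩
  | ite e c c' ih ih' =>
    simp only [Cmd.wf, Bool.and_eq_true] at hw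
    obtain ⟨σ1, h1, h1v, h1k⟩ := e.exec_compile hst hB hb hc.1 hw.1.1 0 σ hs
    have h1s := h1k.sim hs
    simp only [Cmd.run]
    split
    · next h0 =>
      obtain ⟨σ2, t2, h2, h2t, h2s, h2b⟩ := ih' s hb (hc.2.2 h0) hw.2 σ1 h1s
      exact ⟨σ2, _, .seq h1 (.branch_false (h1v.trans h0) h2), by simp only [Cmd.cost]; omega,
        h2s, h2b⟩
    · next h0 =>
      obtain ⟨σ2, t2, h2, h2t, h2s, h2b⟩ := ih s hb (hc.2.1 h0) hw.1.2 σ1 h1s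
      exact ⟨σ2, _, .seq h1 (.branch_true (fun h => h0 (h1v.symm.trans h)) h2),
        by simp only [Cmd.cost]; omega, h2s, h2b⟩
  | forUp l x y c ih =>
    simp only [Cmd.wf, Bool.and_eq_true, decide_eq_true_eq, Bool.not_eq_true', List.contains_eq_mem,
      decide_eq_false_iff_not] at hw
    obtain ⟨⟨⟨hxy, hx⟩, hy⟩, hcw⟩ := hw
    obtain ⟨σ1, h1, h1s⟩ := exec_compileAssign (x := x) hst hB hb (e := .lit 0)
      (show 0 < M by omega) rfl σ hs
    have b1 : (s.set x 0).Below M := hb.set (by omega)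
    set n := s.reg y with hn
    set f : VState → VState := fun s' => (c.run s').incr x with hf
    have hfe : ∀ s', f s' = (c.run s').set x ((c.run s').reg x + 1) := fun _ => rfl
    have test : ∀ (s' : VState) (σ' : RamState), s'.Below M → Sim st b s' σ' →
        ∃ σ'', Exec B ((Expr.op .sub (.reg y) (.reg x)).compile st 0) σ' σ'' 5 ∧
          σ''.reg 3 = s'.reg y - s'.reg x ∧ Sim st b s' σ'' := by
      intro s' σ' hb' hs'
      obtain ⟨σ2, h2, h2v, h2k⟩ := (Expr.op .sub (.reg y) (.reg x)).exec_compile hst hB hb'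
        ⟨trivial, trivial⟩ rfl 0 σ' hs'
      exact ⟨σ2, h2, h2v, h2k.sim hs'⟩
    obtain ⟨σ2, h2, h2v, h2s⟩ := test _ _ b1 h1s
    have hfx : ∀ i, (f^[i] (s.set x 0)).reg x = i := by
      intro i
      induction i with
      | zero => simp
      | succ i ihi => rw [Function.iterate_succ_apply', hfe]; simp [Cmd.run_reg hx, ihi]
    have hfy : ∀ i, (f^[i] (s.set x 0)).reg y = n := by
      intro i
      induction i with
      | zero => simp [Ne.symm hxy, hn]
      | succ i ihi =>
        rw [Function.iterate_succ_apply', hfe]; simp [Cmd.run_reg hy, ihi, Ne.symm hxy]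
    -- Here `k` is the number of iterations still to come, which is what register `3` holds. The
    -- `12` extra steps of an iteration are `6` for increasing the counter, `5` for recomputing the
    -- difference and `1` for the test.
    have main : ∀ k ≤ n, ∀ σ', Sim st b (f^[n - k] (s.set x 0)) σ' →
        (f^[n - k] (s.set x 0)).Below M → σ'.reg 3 = k →
        ∃ σ'' t, Exec B (.loop 3 (.seq (c.compile st)
          (.seq (compileAssign st x (.op .add (.reg x) (.lit 1)))
            ((Expr.op .sub (.reg y) (.reg x)).compile st 0)))) σ' σ'' t ∧
          t ≤ 1 + k * (c.cost R L + 12) ∧ Sim st b (f^[n] (s.set x 0)) σ'' ∧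
          (f^[n] (s.set x 0)).Below M := by
      intro k
      induction k with
      | zero => exact fun _ σ' hs' hb' h3 => ⟨σ', 1, .loop_false h3, by omega, hs', hb'⟩
      | succ k ihk =>
        intro hk σ' hs' hb' h3
        obtain ⟨σ3, t3, h3e, h3t, h3s, h3b⟩ := ih _ hb' (hc.2 (n - (k + 1)) (by omega)) hcw σ' hs'
        have hxv : (c.run (f^[n - (k + 1)] (s.set x 0))).reg x = n - (k + 1) := by
          rw [Cmd.run_reg hx, hfx]
        have hnM : n < M := hb.reg y
        have hsafe : (Expr.op .add (.reg x) (.lit 1)).Safe M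
            (c.run (f^[n - (k + 1)] (s.set x 0))) := by
          refine ⟨trivial, hM, ?_⟩
          simp only [Expr.eval, hxv]
          omega
        obtain ⟨σ4, h4, h4s⟩ := exec_compileAssign (x := x) hst hB h3b hsafe rfl σ3 h3s
        have hstep : (c.run (f^[n - (k + 1)] (s.set x 0))).set x
            ((Expr.op .add (.reg x) (.lit 1)).eval (c.run (f^[n - (k + 1)] (s.set x 0)))) =
            f^[n - k] (s.set x 0) := by
          rw [show n - k = n - (k + 1) + 1 by omega, Function.iterate_succ_apply']
          rfl
        have h4b : (f^[n - k] (s.set x 0)).Below M := hstep ▸ h3b.set (Expr.eval_lt h3b hsafe)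
        rw [hstep] at h4s
        obtain ⟨σ5, h5, h5v, h5s⟩ := test _ _ h4b h4s
        obtain ⟨σ6, t6, h6, h6t, h6s, h6b⟩ := ihk (by omega) σ5 h5s h4b
          (by rw [h5v, hfx, hfy]; omega)
        refine ⟨σ6, _, .loop_true (by omega) (.seq h3e (.seq h4 h5)) h6, ?_, h6s, h6b⟩
        simp only [Expr.cost]
        rw [add_mul]
        omega
    obtain ⟨σ3, t3, h3, h3t, h3s, h3b⟩ := main n le_rfl σ2 (by simpa using h2s) (by simpa using b1)
      (by rw [h2v]; simp [Ne.symm hxy, hn])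
    refine ⟨σ3, _, .seq h1 (.seq h2 h3), ?_, h3s, h3b⟩
    have := Nat.mul_le_mul_right (c.cost R L + 12) (show n ≤ _ from hc.1)
    simp only [Cmd.cost, Expr.cost]
    omega

/-! ### Proof rules -/

section wp

/-- `c` runs safely from `s` and establishes `Q`. -/
def Cmd.wp (M R L : ℕ) (c : Cmd) (Q : VState → Prop) (s : VState) : Prop :=
  c.Safe M R L s ∧ Q (c.run s)

variable {M R L : ℕ} {Q : VState → Prop} {s : VState}

theorem Cmd.wp.mono {c : Cmd} {Q' : VState → Prop} (h : c.wp M R L Q s) (hQ : ∀ s', Q s' → Q' s') :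
    c.wp M R L Q' s := ⟨h.1, hQ _ h.2⟩

@[simp] theorem Cmd.wp_skip : Cmd.skip.wp M R L Q s ↔ Q s := by simp [wp, Safe, run]

@[simp] theorem Cmd.wp_assign {x : ℕ} {e : Expr} :
    (Cmd.assign x e).wp M R L Q s ↔ e.Safe M s ∧ Q (s.set x (e.eval s)) := Iff.rfl

@[simp] theorem Cmd.wp_store {j : ℕ} {e e' : Expr} : (Cmd.store j e e').wp M R L Q s ↔
    (e.Safe M s ∧ e'.Safe M s) ∧ Q (s.put j (e.eval s) (e'.eval s)) := Iff.rfl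

@[simp] theorem Cmd.wp_seq {c c' : Cmd} :
    (Cmd.seq c c').wp M R L Q s ↔ c.wp M R L (fun s' => c'.wp M R L Q s') s := by
  simp only [wp, Safe, run]; tauto

@[simp] theorem Cmd.wp_ite {e : Expr} {c c' : Cmd} : (Cmd.ite e c c').wp M R L Q s ↔
    e.Safe M s ∧ (e.eval s ≠ 0 → c.wp M R L Q s) ∧ (e.eval s = 0 → c'.wp M R L Q s) := by
  simp only [wp, Safe, run]
  by_cases h : e.eval s = 0 <;> simp [h] <;> tauto

/-- `s'` differs from `s` only in the given registers and arrays. -/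
structure Frame (rs as : List ℕ) (s s' : VState) : Prop where
  reg : ∀ x, x ∉ rs → s'.reg x = s.reg x
  arr : ∀ j, j ∉ as → s'.arr j = s.arr j

/-- What a command leaves alone is read off from its text, so a specification never has to mention
it; the side conditions are finite lists and are settled by `decide`. -/
theorem Cmd.wp.frame {c : Cmd} (h : c.wp M R L Q s) :
    c.wp M R L (fun s' => Frame c.regs c.arrs s s' ∧ Q s') s :=
  ⟨h.1, ⟨fun _ => Cmd.run_reg, fun _ => Cmd.run_arr⟩, h.2⟩

/-- The invariant only has to speak about what changes: the frame relative to the state before the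
loop is supplied along with it. It is required again after the counter has been raised. -/
theorem Cmd.wp_forUp {l : Bool} {x y : ℕ} {c : Cmd} (I : ℕ → VState → Prop)
    (hy : s.reg y ≤ (if l then L else R)) (hx : x ∉ c.regs)
    (h0 : I 0 (s.set x 0))
    (hI : ∀ i < s.reg y, ∀ s', Frame (x :: c.regs) c.arrs s s' → s'.reg x = i → I i s' →
      c.wp M R L (fun s'' => I (i + 1) (s''.set x (i + 1))) s')
    (hQ : ∀ s', Frame (x :: c.regs) c.arrs s s' → s'.reg x = s.reg y → I (s.reg y) s' → Q s') :
    (Cmd.forUp l x y c).wp M R L Q s := by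
  set f : VState → VState := fun s' => (c.run s').incr x with hf
  have key : ∀ i ≤ s.reg y, Frame (x :: c.regs) c.arrs s (f^[i] (s.set x 0)) ∧
      (f^[i] (s.set x 0)).reg x = i ∧ I i (f^[i] (s.set x 0)) := by
    intro i
    induction i with
    | zero =>
      refine fun _ => ⟨⟨fun r hr => ?_, fun _ _ => rfl⟩, by simp, h0⟩
      simp only [List.mem_cons, not_or] at hr
      simp [hr.1]
    | succ i ih =>
      intro hi
      obtain ⟨hF, hxi, hi'⟩ := ih (by omega)
      rw [Function.iterate_succ_apply']
      have h := (hI i (by omega) _ hF hxi hi').2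
      have e : f (f^[i] (s.set x 0)) = (c.run (f^[i] (s.set x 0))).set x (i + 1) := by
        change (c.run (f^[i] (s.set x 0))).set x ((c.run (f^[i] (s.set x 0))).reg x + 1) = _
        rw [Cmd.run_reg hx, hxi]
      rw [e]
      refine ⟨⟨fun r hr => ?_, fun j hj => ?_⟩, by simp, h⟩
      · have hr' := hr
        simp only [List.mem_cons, not_or] at hr'
        rw [VState.set_reg, if_neg hr'.1, Cmd.run_reg hr'.2, hF.reg r hr]
      · rw [VState.set_arr, Cmd.run_arr hj, hF.arr j hj]
  refine ⟨⟨hy, fun i hi => ?_⟩, ?_⟩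
  · obtain ⟨hF, hxi, hi'⟩ := key i hi.le
    exact (hI i hi _ hF hxi hi').1
  · obtain ⟨hF, hxi, hi'⟩ := key _ le_rfl
    exact hQ _ hF hxi hi'

end wp

/-! ### Excluding the chair -/

/-- The chair is a subgraph of `G`. -/
def HasChair {V : Type*} (G : SimpleGraph V) : Prop :=
  ∃ c a b d e, G.Adj c a ∧ G.Adj c b ∧ G.Adj c d ∧ G.Adj d e ∧ a ≠ b ∧ a ≠ d ∧ b ≠ d ∧
    e ≠ c ∧ e ≠ a ∧ e ≠ b

theorem HasChair.exists_hom {V : Type*} {G : SimpleGraph V} (h : HasChair G) :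
    ∃ f : Fin 5 ↪ V, ∀ x y, chair.Adj x y → G.Adj (f x) (f y) := by
  obtain ⟨c, a, b, d, e, hca, hcb, hcd, hde, hab, had, hbd, hec, hea, heb⟩ := h
  refine ⟨⟨![a, c, d, e, b], fun x y hxy => ?_⟩, fun x y hxy => ?_⟩
  · have h1 := hca.ne
    have h2 := hcb.ne
    have h3 := hcd.ne
    have h4 := hde.ne
    fin_cases x <;> fin_cases y <;> simp_all
  · simp only [chair, SimpleGraph.fromEdgeSet_adj] at hxy
    obtain ⟨hm, -⟩ := hxy
    fin_cases x <;> fin_cases y <;> simp at hm <;>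
      first | exact hca | exact hca.symm | exact hcb | exact hcb.symm | exact hcd
            | exact hcd.symm | exact hde | exact hde.symm

theorem HasChair.isMinor {V : Type*} {G : SimpleGraph V} (h : HasChair G) : IsMinor chair G := by
  obtain ⟨f, hf⟩ := h.exists_hom
  refine ⟨fun x => {f x}, fun x => ?_, fun x y hxy => ?_, fun x y hxy => ?_⟩
  · exact { preconnected := fun u v => by rw [Subsingleton.elim u v], nonempty := ⟨⟨f x, rfl⟩⟩ }
  · simpa using hxy
  · exact ⟨f x, rfl, f y, rfl, hf x y hxy⟩

theorem HasChair.isTopologicalMinor {V : Type*} {G : SimpleGraph V} (h : HasChair G) :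
    IsTopologicalMinor chair G := by
  obtain ⟨f, hf⟩ := h.exists_hom
  refine ⟨f, fun x y hxy => (hf x y hxy).toWalk, fun x y hxy => ?_, fun x y hxy => ?_,
    fun x y hxy z hz => ?_, fun x y hxy x' y' _ _ v hv h1 h2 => ?_⟩
  · simp [SimpleGraph.Walk.isPath_def, (hf x y hxy).ne]
  · rfl
  · simpa using hz
  · simp at hv
    tauto

/-! ### From minors and topological minors to subgraphs -/

variable {V : Type*} {G : SimpleGraph V}

/-- A walk from `c` that leaves the closed neighbourhood does so by an edge `u v` with `u` adjacent
to `c`. Two of `a`, `b`, `d` differ from `u`, and with `c`, `u` and `v` they form a chair. -/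
theorem HasChair.adj_of_reachable (h : ¬ HasChair G) {c a b d x : V} (ha : G.Adj c a)
    (hb : G.Adj c b) (hd : G.Adj c d) (hab : a ≠ b) (had : a ≠ d) (hbd : b ≠ d)
    (hx : G.Reachable c x) : x = c ∨ G.Adj c x := by
  obtain ⟨p⟩ := hx
  suffices ∀ u v, G.Walk u v → (u = c ∨ G.Adj c u) → (v = c ∨ G.Adj c v) from
    this c x p (.inl rfl)
  intro u v p
  induction p with
  | nil => exact id
  | @cons u v w huv p ih =>
    intro hu
    apply ih
    rcases hu with rfl | hu
    · exact .inr huv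
    by_contra! hv
    apply h
    have ne : ∀ z, G.Adj c z → v ≠ z := fun z hz e => hv.2 (e ▸ hz)
    by_cases h1 : u = a
    · subst h1
      exact ⟨c, b, d, u, v, hb, hd, ha, huv, hbd, hab.symm, had.symm, hv.1, ne _ hb, ne _ hd⟩
    by_cases h2 : u = b
    · subst h2
      exact ⟨c, a, d, u, v, ha, hd, hb, huv, had, hab, hbd.symm, hv.1, ne _ ha, ne _ hd⟩
    exact ⟨c, a, b, u, v, ha, hb, hu, huv, hab, Ne.symm h1, Ne.symm h2, hv.1, ne _ ha, ne _ hb⟩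

/-- Without a chair, all vertices of `T` except possibly `c` are neighbours of `c`. At least two of
them, `p` and `q`, differ from `c`, `x` and `y`; and then `c` with the neighbours `p`, `q`, `x` and
the edge `x y` is a chair after all. -/
theorem HasChair.of_five {c a b d x y : V} (ha : G.Adj c a)
    (hb : G.Adj c b) (hd : G.Adj c d) (hab : a ≠ b) (had : a ≠ d) (hbd : b ≠ d) (T : Finset V)
    (hT : 5 ≤ T.card) (hr : ∀ z ∈ T, G.Reachable c z) (hxy : G.Adj x y) (hxc : x ≠ c) (hyc : y ≠ c)
    (hx : G.Reachable c x) : HasChair G := by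
  classical
  by_contra h
  have key := fun z (hz : G.Reachable c z) => adj_of_reachable h ha hb hd hab had hbd hz
  have hcard : 1 < (T \ {c, x, y}).card := by
    have h1 := Finset.le_card_sdiff {c, x, y} T
    have h2 := Finset.card_le_three (a := c) (b := x) (c := y)
    omega
  obtain ⟨p, hp, q, hq, hpq⟩ := Finset.one_lt_card.1 hcard
  simp only [Finset.mem_sdiff, Finset.mem_insert, Finset.mem_singleton, not_or] at hp hq
  exact h ⟨c, p, q, x, y, (key p (hr p hp.1)).resolve_left hp.2.1,
    (key q (hr q hq.1)).resolve_left hq.2.1, (key x hx).resolve_left hxc, hxy, hpq, hp.2.2.1,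
    hq.2.2.1, hyc, Ne.symm hp.2.2.2, Ne.symm hq.2.2.2⟩

theorem chair_adj_iff {x y : Fin 5} : chair.Adj x y ↔
    (s(x, y) ∈ ({s(0, 1), s(1, 2), s(2, 3), s(1, 4)} : Set (Sym2 (Fin 5))) ∧ x ≠ y) := by
  simp only [chair, SimpleGraph.fromEdgeSet_adj]

/-- The three paths that leave the branch vertex of `1` begin with distinct neighbours, the five
branch vertices are all reachable from it, and the first edge of the path from `2` to `3` avoids it.
These are the hypotheses of `HasChair.of_five`. -/
theorem isTopologicalMinor_chair_iff : IsTopologicalMinor chair G ↔ HasChair G := by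
  refine ⟨fun ⟨φ, σ, hp, hrev, hb, hi⟩ => ?_, HasChair.isTopologicalMinor⟩
  have a10 : chair.Adj 1 0 := by simp [chair_adj_iff]
  have a12 : chair.Adj 1 2 := by simp [chair_adj_iff]
  have a14 : chair.Adj 1 4 := by simp [chair_adj_iff]
  have a23 : chair.Adj 2 3 := by simp [chair_adj_iff]
  have nn : ∀ x y (h : chair.Adj x y), ¬ (σ x y h).Nil := fun x y h hn =>
    h.ne (φ.injective hn.eq)
  have snd_mem : ∀ x y (h : chair.Adj x y), (σ x y h).snd ∈ (σ x y h).support :=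
    fun x y h => (σ x y h).getVert_mem_support 1
  have adj := fun x y h => (σ x y h).adj_snd (nn x y h)
  have dist : ∀ y y' (h : chair.Adj 1 y) (h' : chair.Adj 1 y'), y ≠ y' →
      (σ 1 y h).snd ≠ (σ 1 y' h').snd := by
    intro y y' h h' hyy e
    by_cases hy : (σ 1 y h).snd = φ y
    · have : φ y ∈ (σ 1 y' h').support := by rw [← hy, e]; exact snd_mem _ _ _
      rcases hb _ _ _ _ this with h1 | h1
      · exact h.ne h1.symm
      · exact hyy h1
    · refine hi 1 y h 1 y' h' ?_ _ (snd_mem _ _ _) (adj 1 y h).ne' hy (e ▸ snd_mem _ _ _)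
      intro hs
      rw [Sym2.eq_iff] at hs
      rcases hs with hs | hs
      · exact hyy hs.2
      · exact h'.ne hs.1
  have r := fun x y (h : chair.Adj x y) => (σ x y h).reachable
  refine HasChair.of_five (adj 1 0 a10) (adj 1 4 a14) (adj 1 2 a12) (dist _ _ _ _ (by decide))
    (dist _ _ _ _ (by decide)) (dist _ _ _ _ (by decide)) (Finset.univ.map φ) (by simp) ?_
    (adj 2 3 a23) (fun e => absurd (φ.injective e) (by decide)) ?_ (r 1 2 a12)
  · intro z hz
    obtain ⟨x, -, rfl⟩ := Finset.mem_map.1 hz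
    fin_cases x
    · exact r 1 0 a10
    · rfl
    · exact r 1 2 a12
    · exact (r 1 2 a12).trans (r 2 3 a23)
    · exact r 1 4 a14
  · intro e
    have := hb 2 3 a23 1 (e ▸ snd_mem 2 3 a23)
    revert this
    decide

/-- A connected set with three outside neighbours has a vertex of degree at least three. -/
theorem exists_two_lt_degree [Fintype V] [DecidableRel G.Adj] (U : Set V)
    (hU : (G.induce U).Connected) (T : Finset V) (hT : 3 ≤ T.card)
    (hTU : ∀ y ∈ T, y ∉ U ∧ ∃ x ∈ U, G.Adj x y) : ∃ c ∈ U, 2 < G.degree c := by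
  classical
  by_contra! h
  -- A connected set has at least `|U| - 1` inner edges, so the inner degrees sum to at least `2 *
  -- |U| - 2`. If all degrees were at most two, at most two edges could lead out of `U`.
  have h1 := hU.card_vert_le_card_edgeSet_add_one
  have h2 := (G.induce U).sum_degrees_eq_twice_card_edges
  rw [Nat.card_eq_fintype_card, Nat.card_eq_fintype_card, ← SimpleGraph.edgeFinset_card] at h1
  have h3 : ∀ u : U, (G.induce U).degree u + (G.neighborFinset u \ U.toFinset).card ≤ 2 := by
    intro u
    refine le_trans (le_of_eq ?_) (h u u.2)
    have e : ((G.induce U).neighborFinset u).map (Function.Embedding.subtype _) =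
        G.neighborFinset u ∩ U.toFinset := by
      ext x
      simp
    rw [← SimpleGraph.card_neighborFinset_eq_degree, ← SimpleGraph.card_neighborFinset_eq_degree,
      ← Finset.card_map (Function.Embedding.subtype _), e, add_comm,
      Finset.card_sdiff_add_card_inter]
  have h4 : T.card ≤ ∑ u : U, (G.neighborFinset u \ U.toFinset).card := by
    refine (Finset.card_le_card ?_).trans Finset.card_biUnion_le
    intro y hy
    obtain ⟨hyU, x, hx, hxy⟩ := hTU y hy
    simp only [Finset.mem_biUnion, Finset.mem_univ, true_and]
    exact ⟨⟨x, hx⟩, by simp [hxy, hyU]⟩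
  have h5 := Finset.sum_le_sum fun u (_ : u ∈ (Finset.univ : Finset U)) => h3 u
  rw [Finset.sum_add_distrib, Finset.sum_const, Finset.card_univ, smul_eq_mul] at h5
  omega

/-- The branch set of the centre has neighbours in three other branch sets, so it contains a vertex
`c` of degree at least three. One vertex from each of the five branch sets, with `c` for the centre,
and the edge between the sets of `2` and `3` complete the hypotheses of `HasChair.of_five`.
Finiteness is needed for the count of degrees only. -/
theorem isMinor_chair_iff [Finite V] : IsMinor chair G ↔ HasChair G := by
  classical
  have := Fintype.ofFinite V
  refine ⟨fun ⟨φ, hc, hd, ha⟩ => ?_, HasChair.isMinor⟩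
  obtain ⟨x1, hx1, y0, hy0, e10⟩ := ha 1 0 (by simp [chair_adj_iff])
  obtain ⟨x1', hx1', y2, hy2, e12⟩ := ha 1 2 (by simp [chair_adj_iff])
  obtain ⟨x1'', hx1'', y4, hy4, e14⟩ := ha 1 4 (by simp [chair_adj_iff])
  obtain ⟨x2, hx2, y3, hy3, e23⟩ := ha 2 3 (by simp [chair_adj_iff])
  have ne : ∀ {i j : Fin 5} {x y : V}, i ≠ j → x ∈ φ i → y ∈ φ j → x ≠ y := by
    rintro i j x y hij hx hy rfl
    exact Set.disjoint_left.1 (hd i j hij) hx hy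
  have r : ∀ {i : Fin 5} {x y : V}, x ∈ φ i → y ∈ φ i → G.Reachable x y := by
    intro i x y hx hy
    exact ((hc i).preconnected ⟨x, hx⟩ ⟨y, hy⟩).map (SimpleGraph.Embedding.induce (φ i)).toHom
  obtain ⟨c, hcU, hdeg⟩ := exists_two_lt_degree (G := G) (φ 1) (hc 1) {y0, y2, y4} (by
    rw [Finset.card_eq_three.2 ⟨y0, y2, y4, ne (by decide) hy0 hy2, ne (by decide) hy0 hy4,
      ne (by decide) hy2 hy4, rfl⟩]) (by
    intro y hy
    simp only [Finset.mem_insert, Finset.mem_singleton] at hy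
    rcases hy with rfl | rfl | rfl
    · exact ⟨fun h => ne (i := 1) (j := 0) (by decide) h hy0 rfl, x1, hx1, e10⟩
    · exact ⟨fun h => ne (i := 1) (j := 2) (by decide) h hy2 rfl, x1', hx1', e12⟩
    · exact ⟨fun h => ne (i := 1) (j := 4) (by decide) h hy4 rfl, x1'', hx1'', e14⟩)
  rw [← SimpleGraph.card_neighborFinset_eq_degree, Finset.two_lt_card] at hdeg
  obtain ⟨a, ha, b, hb, d, hd', hab, had, hbd⟩ := hdeg
  rw [SimpleGraph.mem_neighborFinset] at ha hb hd'
  have r0 : G.Reachable c y0 := (r hcU hx1).trans e10.reachable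
  have r2 : G.Reachable c y2 := (r hcU hx1').trans e12.reachable
  have r4 : G.Reachable c y4 := (r hcU hx1'').trans e14.reachable
  have r2' : G.Reachable c x2 := r2.trans (r hy2 hx2)
  have r3 : G.Reachable c y3 := r2'.trans e23.reachable
  refine HasChair.of_five ha hb hd' hab had hbd {y0, c, x2, y3, y4} ?_ ?_ e23
    (ne (by decide) hx2 hcU) (ne (by decide) hy3 hcU) r2'
  · rw [Finset.card_insert_of_notMem, Finset.card_insert_of_notMem, Finset.card_insert_of_notMem,
      Finset.card_insert_of_notMem, Finset.card_singleton]
    all_goals simp only [Finset.mem_insert, Finset.mem_singleton, not_or]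
    · exact ne (by decide) hy3 hy4
    · exact ⟨ne (by decide) hx2 hy3, ne (by decide) hx2 hy4⟩
    · exact ⟨ne (by decide) hcU hx2, ne (by decide) hcU hy3, ne (by decide) hcU hy4⟩
    · exact ⟨ne (by decide) hy0 hcU, ne (by decide) hy0 hx2, ne (by decide) hy0 hy3,
        ne (by decide) hy0 hy4⟩
  · intro z hz
    simp only [Finset.mem_insert, Finset.mem_singleton] at hz
    rcases hz with rfl | rfl | rfl | rfl | rfl
    · exact r0
    · rfl
    · exact r2'
    · exact r3
    · exact r4

/-- The chair is a subgraph of `G` without the vertices of `S`. -/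
theorem hasChair_induce_iff (S : Finset V) : HasChair (G.induce ((S : Set V)ᶜ)) ↔
    ∃ c a b d e, G.Adj c a ∧ G.Adj c b ∧ G.Adj c d ∧ G.Adj d e ∧ a ≠ b ∧ a ≠ d ∧ b ≠ d ∧
      e ≠ c ∧ e ≠ a ∧ e ≠ b ∧ c ∉ S ∧ a ∉ S ∧ b ∉ S ∧ d ∉ S ∧ e ∉ S := by
  constructor
  · rintro ⟨c, a, b, d, e, hca, hcb, hcd, hde, hab, had, hbd, hec, hea, heb⟩
    have ne : ∀ {x y : ↑((S : Set V)ᶜ)}, x ≠ y → (x : V) ≠ y := fun h e => h (Subtype.ext e)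
    exact ⟨c, a, b, d, e, hca, hcb, hcd, hde, ne hab, ne had, ne hbd, ne hec, ne hea, ne heb,
      c.2, a.2, b.2, d.2, e.2⟩
  · rintro ⟨c, a, b, d, e, hca, hcb, hcd, hde, hab, had, hbd, hec, hea, heb, hc, ha, hb, hd, he⟩
    exact ⟨⟨c, hc⟩, ⟨a, ha⟩, ⟨b, hb⟩, ⟨d, hd⟩, ⟨e, he⟩, hca, hcb, hcd, hde, by simpa, by simpa,
      by simpa, by simpa, by simpa, by simpa⟩

/-! ### Local certificates for the absence of the chair -/

/-- What a vertex with the label `a` is charged for a neighbour with the label `b`. The labels are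
`1`, `2`, `3` (at most so many neighbours), `4` (the centre of a star) and `5` (deleted). -/
def edgeW (a b : ℕ) : ℕ :=
  if a = 5 ∨ b = 5 then 0
  else if a = 4 then (if b = 1 then 0 else 2048)
  else 256 * (5 - a) + (if a = 3 then 16 * (b - 1) else 0)

/-- What a vertex with the label `a` is charged for a triangle with vertices labelled `b`, `c`. -/
def triW (a b c : ℕ) : ℕ := if a = 3 ∧ b ≠ 5 ∧ c ≠ 5 then 1 else 0

/-- The condition on the total charge of a vertex. -/
def OkW (y : ℕ) : Prop := y < 2048 ∧ y / 16 % 16 ≤ y % 16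

instance : DecidablePred OkW := fun _ => inferInstanceAs (Decidable (_ ∧ _))

/-- `u v` is an edge and `v = w`, or `u v w` is a triangle. -/
def Cliq {V : Type*} (G : SimpleGraph V) (u v w : V) : Prop :=
  G.Adj u v ∧ G.Adj u w ∧ (v = w ∨ G.Adj v w)

open Classical in
/-- The charge of `u` for the edge or triangle `u v w`. -/
noncomputable def contr {V : Type*} (G : SimpleGraph V) (l : V → ℕ) (u v w : V) : ℕ :=
  if Cliq G u v w then (if v = w then edgeW (l u) (l v) else triW (l u) (l v) (l w)) else 0

/-- The total charge of `u`. -/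
noncomputable def tot {V : Type*} [Fintype V] (G : SimpleGraph V) (l : V → ℕ) (u : V) : ℕ :=
  ∑ v, ∑ w, contr G l u v w

section

variable {V : Type*} [Fintype V] (G : SimpleGraph V) (l : V → ℕ)

open Classical in
/-- The neighbours of `u` that are not deleted. -/
noncomputable def alive (u : V) : Finset V := {v | G.Adj u v ∧ l v ≠ 5}

variable {G l}

theorem mem_alive {u v : V} : v ∈ alive G l u ↔ G.Adj u v ∧ l v ≠ 5 := by
  classical simp [alive]

open Classical in
-- The diagonal terms `v = w` are the edges at `c`. The others are ordered pairs of adjacent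
-- neighbours, so every triangle is counted twice.
theorem tot_eq {c : V} : tot G l c =
    ∑ v ∈ alive G l c, edgeW (l c) (l v) +
      if l c = 3 then ∑ v ∈ alive G l c, ((alive G l c).filter (G.Adj v)).card else 0 := by
  have h1 : ∀ v, ∑ w, contr G l c v w = (if v ∈ alive G l c then edgeW (l c) (l v) else 0) +
      if l c = 3 then (if v ∈ alive G l c then ((alive G l c).filter (G.Adj v)).card else 0)
        else 0 := by
    intro v
    rw [← Finset.add_sum_erase _ _ (Finset.mem_univ v)]
    congr 1
    · simp only [contr, Cliq, mem_alive, if_true, true_or, and_true, and_self]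
      by_cases hv : l v = 5
      · simp [hv, edgeW]
      · simp [hv]
    · have : ∀ w ∈ Finset.univ.erase v, contr G l c v w =
          if (l c = 3 ∧ v ∈ alive G l c) ∧ w ∈ (alive G l c).filter (G.Adj v) then 1 else 0 := by
        intro w hw
        have hvw : v ≠ w := (Finset.ne_of_mem_erase hw).symm
        simp only [contr, Cliq, hvw, triW, Finset.mem_filter, mem_alive, false_or, if_false]
        rw [← ite_and]
        congr 1
        simp only [eq_iff_iff]
        tauto
      rw [Finset.sum_congr rfl this, ← Finset.sum_filter, Finset.sum_const, smul_eq_mul, mul_one]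
      by_cases h : l c = 3 ∧ v ∈ alive G l c
      · simp only [h.1, h.2, true_and, and_self, if_true]
        congr 1
        ext w
        simp only [Finset.mem_filter, Finset.mem_erase, Finset.mem_univ, and_true, ne_eq]
        exact ⟨fun h => h.2, fun h => ⟨fun e => G.loopless.irrefl v (e ▸ h.2), h⟩⟩
      · simp only [h, false_and, Finset.filter_false, Finset.card_empty]
        by_cases h3 : l c = 3 <;> by_cases h4 : v ∈ alive G l c <;> simp_all
  rw [tot, Finset.sum_congr rfl fun v _ => h1 v, Finset.sum_add_distrib]
  congr 1
  · simp
  · split_ifs <;> simp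

theorem tot_five {c : V} (hc : l c = 5) : tot G l c = 0 := by
  simp [tot, contr, hc, edgeW, triW]

/-- A multiple of `256`, so the second half of `OkW` holds trivially and only the bound `2048`
matters: it admits one neighbour at a price of `1024` and two at `768`. -/
theorem tot_low {c : V} (hc : l c = 1 ∨ l c = 2) :
    tot G l c = 256 * (5 - l c) * (alive G l c).card := by
  rw [tot_eq, if_neg (by omega), add_zero, Finset.sum_congr rfl
    (g := fun _ => 256 * (5 - l c)), Finset.sum_const, smul_eq_mul, mul_comm]
  intro v hv
  have h5 := (mem_alive.1 hv).2
  rw [edgeW]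
  split_ifs <;> omega

open Classical in
-- Three fields in one number: the degree in units of `512`, the sum of labels minus one in units of
-- `16`, and the ordered adjacent pairs in units. Since `512` is a multiple of `256`, the degree
-- does not disturb the two lower fields, which `OkW` compares.
theorem tot_three {c : V} (hc : l c = 3) :
    tot G l c = 512 * (alive G l c).card + 16 * ∑ v ∈ alive G l c, (l v - 1) +
      ∑ v ∈ alive G l c, ((alive G l c).filter (G.Adj v)).card := by
  rw [tot_eq, if_pos hc, Finset.sum_congr rfl
    (g := fun v => 512 + 16 * (l v - 1)), Finset.sum_add_distrib, Finset.sum_const, smul_eq_mul,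
    mul_comm, Finset.mul_sum]
  intro v hv
  simp [edgeW, (mem_alive.1 hv).2, hc]

theorem tot_four_le {c v : V} (hc : l c = 4) (hv : v ∈ alive G l c) (h1 : l v ≠ 1) :
    2048 ≤ tot G l c := by
  rw [tot_eq, if_neg (by omega), add_zero]
  refine le_trans (le_of_eq ?_) (Finset.single_le_sum (fun _ _ => Nat.zero_le _) hv)
  simp [edgeW, hc, h1, (mem_alive.1 hv).2]

theorem tot_four {c : V} (hc : l c = 4) (h : ∀ v ∈ alive G l c, l v = 1) : tot G l c = 0 := by
  rw [tot_eq, if_neg (by omega), add_zero]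
  exact Finset.sum_eq_zero fun v hv => by simp [edgeW, hc, h v hv]

/-- One neighbour too many costs `2 * 1024`, `3 * 768` or `4 * 512`, none of which is below `2048`.
-/
theorem card_alive_le {v : V} (hv : l v = 1 ∨ l v = 2 ∨ l v = 3) (h : OkW (tot G l v)) :
    (alive G l v).card ≤ l v := by
  classical
  have h1 := h.1
  rcases hv with hv | hv | hv
  · rw [tot_low (.inl hv), hv] at h1; omega
  · rw [tot_low (.inr hv), hv] at h1; omega
  · rw [tot_three hv] at h1; omega

variable (G l) in
/-- Every label is one of `1, …, 5`, and every vertex satisfies its local condition. -/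
def ValidLabels : Prop := ∀ u, (1 ≤ l u ∧ l u ≤ 5) ∧ OkW (tot G l u)

open Classical in
-- The centre `c` of a chair has three living neighbours, so its label is `3` or `4`. Label `4`
-- forces the label `1` on the neighbour `d`, which then cannot have the further neighbour `e`. If
-- the label is `3`, every neighbour `v` of `c` has at most `l v - 1` neighbours among the other
-- neighbours of `c`, and `d` has strictly fewer, because `e` lies outside. So the triangle sum is
-- smaller than the label sum, contrary to `OkW`.
theorem ValidLabels.not_hasChair (h : ValidLabels G l) :
    ¬ HasChair (G.induce (((Finset.univ.filter fun v => l v = 5 : Finset V) : Set V)ᶜ)) := by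
  rw [hasChair_induce_iff]
  rintro ⟨c, a, b, d, e, hca, hcb, hcd, hde, hab, had, hbd, hec, hea, heb, hc, ha, hb, hd, he⟩
  simp only [Finset.mem_filter, Finset.mem_univ, true_and] at hc ha hb hd he
  have ma : a ∈ alive G l c := mem_alive.2 ⟨hca, ha⟩
  have mb : b ∈ alive G l c := mem_alive.2 ⟨hcb, hb⟩
  have md : d ∈ alive G l c := mem_alive.2 ⟨hcd, hd⟩
  have h3 : 2 < (alive G l c).card := Finset.two_lt_card.2 ⟨a, ma, b, mb, d, md, hab, had, hbd⟩
  have hl := (h c).1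
  have hle := fun v hv => card_alive_le (G := G) (l := l) (v := v) hv (h v).2
  by_cases h4 : l c = 4
  · have d1 : l d = 1 := by
      by_contra h1
      have := tot_four_le h4 md h1
      have := (h c).2.1
      omega
    have h5 : 1 < (alive G l d).card := Finset.one_lt_card.2
      ⟨c, mem_alive.2 ⟨hcd.symm, hc⟩, e, mem_alive.2 ⟨hde, he⟩, hec.symm⟩
    have := hle d (by omega)
    omega
  have hc3 : l c = 3 := by
    have := hle c (by omega)
    omega
  have hcard : (alive G l c).card = 3 := by
    have := hle c (by omega)
    omega
  have hA : alive G l c = {a, b, d} := by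
    symm
    apply Finset.eq_of_subset_of_card_le
    · intro x hx
      simp only [Finset.mem_insert, Finset.mem_singleton] at hx
      rcases hx with rfl | rfl | rfl <;> assumption
    · rw [hcard, Finset.card_eq_three.2 ⟨a, b, d, hab, had, hbd, rfl⟩]
  have hsub : ∀ v ∈ alive G l c, (alive G l c).filter (G.Adj v) ⊆ (alive G l v).erase c := by
    intro v hv w hw
    rw [Finset.mem_filter, mem_alive] at hw
    rw [Finset.mem_erase, mem_alive]
    exact ⟨hw.1.1.ne', hw.2, hw.1.2⟩
  have ht : ∀ v ∈ alive G l c, ((alive G l c).filter (G.Adj v)).card ≤ l v - 1 := by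
    intro v hv
    have h1 := Finset.card_le_card (hsub v hv)
    -- Needed for `l v = 4`, the only case in which the label does not bound the degree.
    have h2 : ((alive G l c).filter (G.Adj v)).card ≤ 2 := by
      have : (alive G l c).filter (G.Adj v) ⊆ (alive G l c).erase v := by
        intro w hw
        rw [Finset.mem_filter] at hw
        exact Finset.mem_erase.2 ⟨hw.2.ne', hw.1⟩
      have := Finset.card_le_card this
      rw [Finset.card_erase_of_mem hv] at this
      omega
    have h5 := (mem_alive.1 hv).2
    have h6 := (h v).1
    rw [Finset.card_erase_of_mem (mem_alive.2 ⟨(mem_alive.1 hv).1.symm, hc⟩)] at h1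
    by_cases h7 : l v = 4
    · omega
    · have := hle v (by omega)
      omega
  have htd : ((alive G l c).filter (G.Adj d)).card < l d - 1 := by
    have h6 := (h d).1
    have h1 : (alive G l c).filter (G.Adj d) ⊆ ((alive G l d).erase c).erase e := by
      intro w hw
      refine Finset.mem_erase.2 ⟨?_, hsub d md hw⟩
      rw [hA] at hw
      rintro rfl
      simp only [Finset.mem_filter, Finset.mem_insert, Finset.mem_singleton] at hw
      rcases hw.1 with h | h | h
      · exact hea h
      · exact heb h
      · exact hde.ne' h
    have h2 := Finset.card_le_card h1
    rw [Finset.card_erase_of_mem (Finset.mem_erase.2 ⟨hec, mem_alive.2 ⟨hde, he⟩⟩),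
      Finset.card_erase_of_mem (mem_alive.2 ⟨hcd.symm, hc⟩)] at h2
    have h8 : ((alive G l c).filter (G.Adj d)).card ≤ 2 := by
      have : (alive G l c).filter (G.Adj d) ⊆ (alive G l c).erase d := by
        intro w hw
        rw [Finset.mem_filter] at hw
        exact Finset.mem_erase.2 ⟨hw.2.ne', hw.1⟩
      have := Finset.card_le_card this
      rw [Finset.card_erase_of_mem md] at this
      omega
    have h9 : 1 < (alive G l d).card := Finset.one_lt_card.2
      ⟨c, mem_alive.2 ⟨hcd.symm, hc⟩, e, mem_alive.2 ⟨hde, he⟩, hec.symm⟩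
    by_cases h7 : l d = 4
    · omega
    · have := hle d (by omega)
      omega
  have hlt : ∑ v ∈ alive G l c, ((alive G l c).filter (G.Adj v)).card <
      ∑ v ∈ alive G l c, (l v - 1) := Finset.sum_lt_sum ht ⟨d, md, htd⟩
  -- Both lower fields of the charge stay below `16`, so there is no carry and they can be read off
  -- from the total.
  have hs : ∑ v ∈ alive G l c, (l v - 1) ≤ 3 * 4 := by
    rw [← hcard, ← smul_eq_mul]
    exact Finset.sum_le_card_nsmul _ _ _ fun v _ => by have := (h v).1; omega
  have := (h c).2.2
  rw [tot_three hc3, hcard] at this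
  omega

open Classical in
/-- The labels that belong to a set of deleted vertices. -/
noncomputable def labelsOf (G : SimpleGraph V) (S : Finset V) (v : V) : ℕ :=
  if v ∈ S then 5 else max 1 (min 4 (Finset.univ.filter fun u => G.Adj v u ∧ u ∉ S).card)

theorem labelsOf_eq_five {S : Finset V} {v : V} : labelsOf G S v = 5 ↔ v ∈ S := by
  rw [labelsOf]
  split <;> simp_all
  omega

theorem labelsOf_of_notMem {S : Finset V} {v : V} (hv : v ∉ S) :
    labelsOf G S v = max 1 (min 4 (alive G (labelsOf G S) v).card) := by
  classical
  rw [labelsOf, if_neg hv]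
  congr 3
  ext u
  simp [mem_alive, labelsOf_eq_five]

/-- Let `d` be a living neighbour of `c`, and `e ≠ c` one of `d`. Without a chair, at most one
neighbour of `c` is different from `d` and `e`. This is impossible if `c` has degree at least four,
and puts `e` among the neighbours of `c` if the degree is three. In the latter case both sums in the
charge of `c` are equal. Isolated vertices get the label `1` by the clipping, which does no harm. -/
theorem validLabels_labelsOf {S : Finset V} (h : ¬ HasChair (G.induce ((S : Set V)ᶜ))) :
    ValidLabels G (labelsOf G S) := by
  classical
  set l := labelsOf G S with hl
  have h5 : ∀ {v}, l v = 5 ↔ v ∈ S := labelsOf_eq_five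
  have hn : ∀ {v}, l v ≠ 5 → l v = max 1 (min 4 (alive G l v).card) := fun hv =>
    labelsOf_of_notMem (fun h' => hv (h5.2 h'))
  rw [hasChair_induce_iff] at h
  have nochair : ∀ c d e, l c ≠ 5 → d ∈ alive G l c → e ∈ alive G l d → e ≠ c →
      ((alive G l c) \ {d, e}).card ≤ 1 := by
    intro c d e hc hd he hec
    by_contra! hlt
    obtain ⟨a, ha, b, hb, hab⟩ := Finset.one_lt_card.1 hlt
    simp only [Finset.mem_sdiff, Finset.mem_insert, Finset.mem_singleton, not_or, mem_alive]
      at ha hb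
    rw [mem_alive] at hd he
    refine h ⟨c, a, b, d, e, ha.1.1, hb.1.1, hd.1, he.1, hab, ha.2.1, hb.2.1, hec,
      Ne.symm ha.2.2, Ne.symm hb.2.2, ?_, ?_, ?_, ?_, ?_⟩ <;> rw [← h5]
    exacts [hc, ha.1.2, hb.1.2, hd.2, he.2]
  intro c
  by_cases hc5 : l c = 5
  · refine ⟨by omega, ?_⟩
    rw [tot_five hc5]; decide
  have hc := hn hc5
  refine ⟨by omega, ?_⟩
  have hcases : l c = 1 ∨ l c = 2 ∨ l c = 3 ∨ l c = 4 := by omega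
  rcases hcases with h1 | h1 | h1 | h1
  · rw [tot_low (.inl h1), h1]
    have : (alive G l c).card ≤ 1 := by omega
    interval_cases (alive G l c).card <;> decide
  · rw [tot_low (.inr h1), h1]
    have : (alive G l c).card = 2 := by omega
    rw [this]; decide
  · have hcard : (alive G l c).card = 3 := by omega
    have key : ∀ v ∈ alive G l c, ((alive G l c).filter (G.Adj v)).card = l v - 1 ∧ l v ≤ 3 := by
      intro v hv
      have hcv : c ∈ alive G l v := mem_alive.2 ⟨(mem_alive.1 hv).1.symm, hc5⟩
      have e1 : (alive G l c).filter (G.Adj v) = (alive G l v).erase c := by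
        ext e
        rw [Finset.mem_filter, Finset.mem_erase, mem_alive, mem_alive]
        constructor
        · rintro ⟨⟨h1, h2⟩, h3⟩
          exact ⟨h1.ne', h3, h2⟩
        · rintro ⟨hec, hve, he⟩
          refine ⟨⟨?_, he⟩, hve⟩
          by_contra hce
          have := nochair c v e hc5 hv (mem_alive.2 ⟨hve, he⟩) hec
          -- If `e` were no neighbour of `c`, then removing it would change nothing and two of the
          -- three neighbours would remain.
          have e2 : alive G l c \ {v, e} = (alive G l c).erase v := by
            ext x
            simp only [Finset.mem_sdiff, Finset.mem_insert, Finset.mem_singleton, not_or,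
              Finset.mem_erase, mem_alive]
            constructor
            · tauto
            · rintro ⟨h1, h2⟩
              exact ⟨h2, h1, fun e => hce (e ▸ h2.1)⟩
          rw [e2, Finset.card_erase_of_mem hv] at this
          omega
      have h2 : ((alive G l c).filter (G.Adj v)).card ≤ 2 := by
        have : (alive G l c).filter (G.Adj v) ⊆ (alive G l c).erase v := by
          intro w hw
          rw [Finset.mem_filter] at hw
          exact Finset.mem_erase.2 ⟨hw.2.ne', hw.1⟩
        have := Finset.card_le_card this
        rw [Finset.card_erase_of_mem hv] at this
        omega
      have h3 := hn (mem_alive.1 hv).2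
      have h4 := Finset.card_pos.2 ⟨c, hcv⟩
      rw [e1, Finset.card_erase_of_mem hcv] at h2 ⊢
      omega
    rw [tot_three h1, hcard, Finset.sum_congr rfl fun v hv => (key v hv).1]
    have hs : ∑ v ∈ alive G l c, (l v - 1) ≤ 3 * 2 := by
      rw [← hcard, ← smul_eq_mul]
      exact Finset.sum_le_card_nsmul _ _ _ fun v hv => by have := (key v hv).2; omega
    generalize ∑ v ∈ alive G l c, (l v - 1) = x at hs ⊢
    interval_cases x <;> decide
  · rw [tot_four h1]
    · decide
    intro d hd
    by_contra hd1
    have hd' := hn (mem_alive.1 hd).2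
    have : 1 < (alive G l d).card := by omega
    obtain ⟨e, he, hec⟩ := Finset.exists_mem_ne this c
    have h2 := nochair c d e hc5 hd he hec
    have h3 := Finset.le_card_sdiff {d, e} (alive G l c)
    have h4 := Finset.card_le_two (a := d) (b := e)
    omega

theorem exists_not_hasChair_iff (k : ℕ) :
    (∃ S : Finset V, S.card ≤ k ∧ ¬ HasChair (G.induce ((S : Set V)ᶜ))) ↔
      ∃ l : V → ℕ, ValidLabels G l ∧ (Finset.univ.filter fun v => l v = 5).card ≤ k := by
  classical
  constructor
  · rintro ⟨S, hS, h⟩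
    refine ⟨_, validLabels_labelsOf h, ?_⟩
    convert hS
    ext v
    simp [labelsOf_eq_five]
  · rintro ⟨l, hl, hk⟩
    exact ⟨_, hk, by convert hl.not_hasChair⟩

end

/-! ### Rooted tree decompositions -/

/-- A rooted tree decomposition with an empty bag at the root, in terms of parents. -/
structure RTree {V : Type*} (G : SimpleGraph V) (T : Type*) where
  root : T
  par : T → T
  bag : T → List V
  depth : T → ℕ
  depth_par : ∀ t, t ≠ root → depth (par t) < depth t
  bag_nodup : ∀ t, (bag t).Nodup
  bag_root : bag root = []
  top_unique : ∀ v s s', v ∈ bag s → v ∉ bag (par s) → v ∈ bag s' → v ∉ bag (par s') → s = s'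
  cover : ∀ v, ∃ t, v ∈ bag t
  cover_edge : ∀ u v, G.Adj u v → ∃ t, u ∈ bag t ∧ v ∈ bag t

namespace RTree

variable {V T : Type*} {G : SimpleGraph V} (D : RTree G T)

/-- `s` is a descendant of `t`. -/
inductive Desc (t : T) : T → Prop
  | refl : Desc t t
  | step {s : T} : s ≠ D.root → Desc t (D.par s) → Desc t s

/-- `t` is the topmost node whose bag contains `v`. -/
def TopV (v : V) (t : T) : Prop := v ∈ D.bag t ∧ v ∉ D.bag (D.par t)

/-- `t` is the topmost node whose bag contains `u`, `v` and `w`. -/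
def Top (u v w : V) (t : T) : Prop :=
  (u ∈ D.bag t ∧ v ∈ D.bag t ∧ w ∈ D.bag t) ∧
    ¬ (u ∈ D.bag (D.par t) ∧ v ∈ D.bag (D.par t) ∧ w ∈ D.bag (D.par t))

/-- The topmost bag that contains `v` is at a node of `Z`. -/
def Done (Z : Set T) (v : V) : Prop := ∃ s ∈ Z, D.TopV v s

/-- The descendants of the nodes in a list. -/
def below (cs : List T) : Set T := {s | ∃ t ∈ cs, D.Desc t s}

variable {D}

/-- The bag of the root is empty, so the arbitrary value of `par` at the root is irrelevant to
topmost nodes. -/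
theorem ne_root {v : V} {s : T} (h : v ∈ D.bag s) : s ≠ D.root := by
  rintro rfl
  simp [D.bag_root] at h

theorem Desc.depth_le {t s : T} (h : D.Desc t s) : D.depth t ≤ D.depth s := by
  induction h with
  | refl => exact le_rfl
  | step hs _ ih => exact ih.trans (D.depth_par _ hs).le

theorem Desc.trans {r t s : T} (h : D.Desc r t) (h' : D.Desc t s) : D.Desc r s := by
  induction h' with
  | refl => exact h
  | step hs _ ih => exact .step hs ih

theorem desc_root (s : T) : D.Desc D.root s := by
  induction h : D.depth s using Nat.strong_induction_on generalizing s with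
  | _ n ih =>
    by_cases hs : s = D.root
    · rw [hs]; exact .refl
    · exact .step hs (ih _ (h ▸ D.depth_par s hs) _ rfl)

theorem Desc.eq_or {t s : T} (h : D.Desc t s) : s = t ∨ s ≠ D.root ∧ D.Desc t (D.par s) := by
  cases h with
  | refl => exact .inl rfl
  | step hs h => exact .inr ⟨hs, h⟩

theorem Desc.total {t t' s : T} (h : D.Desc t s) (h' : D.Desc t' s) :
    D.Desc t t' ∨ D.Desc t' t := by
  induction h with
  | refl => exact .inr h'
  | step hs h ih =>
    rcases h'.eq_or with rfl | h'
    · exact .inl (.step hs h)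
    · exact ih h'.2

theorem exists_topV {v : V} {s : T} (h : v ∈ D.bag s) : ∃ t, D.TopV v t ∧ D.Desc t s := by
  induction hd : D.depth s using Nat.strong_induction_on generalizing s with
  | _ n ih =>
    by_cases hp : v ∈ D.bag (D.par s)
    · obtain ⟨t, ht, hts⟩ := ih _ (hd ▸ D.depth_par s (ne_root h)) hp rfl
      exact ⟨t, ht, .step (ne_root h) hts⟩
    · exact ⟨s, ⟨h, hp⟩, .refl⟩

theorem TopV.unique {v : V} {s s' : T} (h : D.TopV v s) (h' : D.TopV v s') : s = s' :=
  D.top_unique v s s' h.1 h.2 h'.1 h'.2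

theorem TopV.desc {v : V} {t s : T} (h : D.TopV v t) (hs : v ∈ D.bag s) : D.Desc t s := by
  obtain ⟨t', ht', hd⟩ := exists_topV hs
  rwa [h.unique ht']

theorem Desc.top_or {v : V} {t s : T} (h : D.Desc t s) (hv : v ∈ D.bag s) :
    (∃ t', D.TopV v t' ∧ D.Desc t t') ∨ v ∈ D.bag t ∧ v ∈ D.bag (D.par t) := by
  induction h with
  | refl =>
    by_cases hp : v ∈ D.bag (D.par t)
    · exact .inr ⟨hv, hp⟩
    · exact .inl ⟨t, ⟨hv, hp⟩, .refl⟩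
  | @step s hs h ih =>
    by_cases hp : v ∈ D.bag (D.par s)
    · exact ih hp
    · exact .inl ⟨s, ⟨hv, hp⟩, .step hs h⟩

/-- Climbing from a common bag of `u` and `v` to the top of `u` does not lose `v`, if the top of
`v` is not below that of `u`. -/
theorem mem_bag_top {ι : T → ℕ} (hι : ∀ t, t ≠ D.root → ι (D.par t) < ι t) {u v : V} {s tu tv : T}
    (hu : u ∈ D.bag s) (hv : v ∈ D.bag s) (htu : D.TopV u tu) (htv : D.TopV v tv)
    (hle : ι tv ≤ ι tu) : v ∈ D.bag tu := by
  have mono : ∀ {t s}, D.Desc t s → ι t ≤ ι s := by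
    intro t s h
    induction h with
    | refl => exact le_rfl
    | step hs _ ih => exact ih.trans (hι _ hs).le
  have h := htu.desc hu
  induction h with
  | refl => exact hv
  | @step s hs h ih =>
    by_cases hpu : u ∈ D.bag (D.par s)
    · by_cases hpv : v ∈ D.bag (D.par s)
      · exact ih hpu hpv
      -- Otherwise `s`, a proper descendant of `tu`, would be the topmost node of `v`, against the
      -- comparison of `tv` and `tu`.
      · have e : tv = s := htv.unique ⟨hv, hpv⟩
        subst e
        have := mono h
        have := hι _ hs
        omega
    · have : tu = s := htu.unique ⟨hu, hpu⟩
      rwa [this]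

/-- One of the three vertices is lost right above `s`, so `s` is its topmost node and every common
bag of the three lies below. By symmetry `s` and `s'` are descendants of each other. -/
theorem Top.unique {u v w : V} {s s' : T} (h : D.Top u v w s) (h' : D.Top u v w s') : s = s' := by
  have key : ∀ {s s'}, D.Top u v w s → D.Top u v w s' → D.Desc s s' := by
    intro s s' h h'
    have hn := h.2
    by_cases h1 : u ∈ D.bag (D.par s)
    · by_cases h2 : v ∈ D.bag (D.par s)
      · by_cases h3 : w ∈ D.bag (D.par s)
        · exact absurd ⟨h1, h2, h3⟩ hn
        · exact TopV.desc ⟨h.1.2.2, h3⟩ h'.1.2.2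
      · exact TopV.desc ⟨h.1.2.1, h2⟩ h'.1.2.1
    · exact TopV.desc ⟨h.1.1, h1⟩ h'.1.1
  rcases (key h h').eq_or with e | ⟨hs, hd⟩
  · exact e.symm
  · have := (key h' h).depth_le
    have := hd.depth_le
    have := D.depth_par s' hs
    omega

/-- Take the vertex of the clique whose topmost node is deepest. Each of the others shares some bag
with it and, by `mem_bag_top`, is still present at that node. -/
theorem exists_top_of_cliq {u v w : V} (h : Cliq G u v w) : ∃ s, D.Top u v w s := by
  have pair : ∀ x ∈ ({u, v, w} : Set V), ∀ y ∈ ({u, v, w} : Set V),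
      ∃ s, x ∈ D.bag s ∧ y ∈ D.bag s := by
    intro x hx y hy
    obtain ⟨h1, h2, h3⟩ := h
    by_cases hxy : x = y
    · subst hxy
      obtain ⟨s, hs⟩ := D.cover x
      exact ⟨s, hs, hs⟩
    · apply D.cover_edge
      simp only [Set.mem_insert_iff, Set.mem_singleton_iff] at hx hy
      have h4 := h1.symm
      have h5 := h2.symm
      rcases h3 with rfl | h3
      · rcases hx with rfl | rfl | rfl <;> rcases hy with rfl | rfl | rfl <;> tauto
      · have h6 := h3.symm
        rcases hx with rfl | rfl | rfl <;> rcases hy with rfl | rfl | rfl <;> tauto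
  have ht : ∀ x, ∃ t, D.TopV x t := fun x => by
    obtain ⟨s, hs⟩ := D.cover x
    obtain ⟨t, ht, -⟩ := exists_topV hs
    exact ⟨t, ht⟩
  choose tp htp using ht
  have key : ∀ x ∈ ({u, v, w} : Set V), (∀ y ∈ ({u, v, w} : Set V),
      D.depth (tp y) ≤ D.depth (tp x)) → D.Top u v w (tp x) := by
    intro x hx hmax
    have hin : ∀ y ∈ ({u, v, w} : Set V), y ∈ D.bag (tp x) := by
      intro y hy
      obtain ⟨s, hxs, hys⟩ := pair x hx y hy
      exact mem_bag_top D.depth_par hxs hys (htp x) (htp y) (hmax y hy)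
    refine ⟨⟨hin u (by simp), hin v (by simp), hin w (by simp)⟩, fun hn => ?_⟩
    have h2 := (htp x).2
    simp only [Set.mem_insert_iff, Set.mem_singleton_iff] at hx
    rcases hx with rfl | rfl | rfl <;> tauto
  obtain ⟨x, hx, hmax⟩ := Set.exists_max_image ({u, v, w} : Set V) (fun y => D.depth (tp y))
    (by simp) ⟨u, by simp⟩
  exact ⟨_, key x hx hmax⟩

variable (D) in
/-- `Z` is a union of branches at the node `t`. -/
structure Branches (t : T) (Z : Set T) : Prop where
  done_or : ∀ v, ∀ s ∈ Z, v ∈ D.bag s → D.Done Z v ∨ v ∈ D.bag t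
  closed : ∀ v s, D.Done Z v → v ∈ D.bag s → s ∈ Z
  notMem : t ∉ Z

/-- A vertex that occurs below a child of `t` either has its topmost node there or persists up to
`t`. -/
theorem branches_below {t : T} {cs : List T} (h : ∀ c ∈ cs, c ≠ D.root ∧ D.par c = t) :
    D.Branches t (D.below cs) where
  done_or := by
    rintro v s ⟨c, hc, hcs⟩ hv
    rcases hcs.top_or hv with ⟨t', h1, h2⟩ | ⟨-, h2⟩
    · exact .inl ⟨t', ⟨c, hc, h2⟩, h1⟩
    · exact .inr ((h c hc).2 ▸ h2)
  closed := by
    rintro v s ⟨t0, ⟨c, hc, hct⟩, h0⟩ hv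
    exact ⟨c, hc, hct.trans (h0.desc hv)⟩
  notMem := by
    rintro ⟨c, hc, hct⟩
    have := hct.depth_le
    have := D.depth_par c (h c hc).1
    rw [(h c hc).2] at this
    omega

theorem done_union {Z Z' : Set T} {v : V} : D.Done (Z ∪ Z') v ↔ D.Done Z v ∨ D.Done Z' v := by
  simp only [Done, Set.mem_union, or_and_right, exists_or]

theorem contr_congr {l l' : V → ℕ} {u v w : V} (hu : l u = l' u) (hv : l v = l' v)
    (hw : l w = l' w) : contr G l u v w = contr G l' u v w := by
  simp only [contr, hu, hv, hw]

theorem below_append_singleton (cs : List T) (c : T) :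
    D.below (cs ++ [c]) = D.below cs ∪ D.below [c] := by
  ext s
  simp only [below, List.mem_append, List.mem_singleton, Set.mem_ofPred_eq, Set.mem_union]
  constructor
  · rintro ⟨t, h | h, hd⟩
    · exact .inl ⟨t, h, hd⟩
    · exact .inr ⟨t, h, hd⟩
  · rintro (⟨t, h, hd⟩ | ⟨t, h, hd⟩)
    · exact ⟨t, .inl h, hd⟩
    · exact ⟨t, .inr h, hd⟩

theorem below_singleton {c : T} {cs : List T} (h : ∀ s, s ∈ cs ↔ s ≠ D.root ∧ D.par s = c) :
    D.below [c] = D.below cs ∪ {c} := by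
  ext s
  simp only [below, List.mem_singleton, Set.mem_ofPred_eq, Set.mem_union, exists_eq_left,
    Set.mem_singleton_iff]
  constructor
  · intro hd
    induction hd with
    | refl => exact .inr rfl
    | @step s hs hd ih =>
      rcases ih with ⟨t, ht, htd⟩ | e
      · exact .inl ⟨t, ht, .step hs htd⟩
      · exact .inl ⟨s, (h s).2 ⟨hs, e⟩, .refl⟩
  · rintro (⟨t, ht, hd⟩ | rfl)
    · obtain ⟨h1, rfl⟩ := (h t).1 ht
      exact (Desc.step h1 .refl).trans hd
    · exact .refl

theorem disjoint_below {t c : T} {cs : List T} (h : ∀ s ∈ cs, s ≠ D.root ∧ D.par s = t)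
    (hc : c ≠ D.root ∧ D.par c = t) (hn : c ∉ cs) : Disjoint (D.below cs) (D.below [c]) := by
  rw [Set.disjoint_left]
  rintro s ⟨a, ha, has⟩ ⟨b, hb, hbs⟩
  rw [List.mem_singleton] at hb
  subst hb
  have key : ∀ {x y}, x ≠ D.root → D.par x = t → D.par y = t → x ≠ y → D.Desc x y → False := by
    intro x y hx hxt hyt hxy hd
    rcases hd.eq_or with e | ⟨-, hd⟩
    · exact hxy e.symm
    · have := hd.depth_le
      have := D.depth_par x hx
      rw [hyt] at *
      rw [hxt] at this
      omega
  have hab : a ≠ b := fun e => hn (e ▸ ha)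
  rcases has.total hbs with hd | hd
  · exact key (h a ha).1 (h a ha).2 hc.2 hab hd
  · exact key hc.1 hc.2 (h a ha).2 hab.symm hd

theorem Branches.disjoint_singleton {c : T} {Z' : Set T} (hZ' : D.Branches c Z') : Disjoint Z' {c} :=
  Set.disjoint_singleton_right.2 hZ'.notMem

theorem done_of_top {t c : T} {Z' : Set T} (hc : D.par c = t) {u : V} (h1 : u ∈ D.bag c) (h2 : u ∉ D.bag t) :
    D.Done (Z' ∪ {c}) u := ⟨c, .inr rfl, h1, hc ▸ h2⟩

/-! ### Partial charges -/

variable [Fintype V] (D)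

open Classical in
/-- The charge of `u` for the edges and triangles whose topmost node is in `Z`. -/
noncomputable def cnt (Z : Set T) (l : V → ℕ) (u : V) : ℕ :=
  ∑ v, ∑ w, if ∃ s ∈ Z, D.Top u v w s then contr G l u v w else 0

open Classical in
/-- The number of deleted vertices whose topmost node is in `Z`. -/
noncomputable def cost (Z : Set T) (l : V → ℕ) : ℕ := ∑ v, if D.Done Z v ∧ l v = 5 then 1 else 0

/-- The label and the charge of a vertex, in one number. -/
noncomputable def dig (Z : Set T) (l : V → ℕ) (u : V) : ℕ := l u + 8 * D.cnt Z l u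

/-- The labels `l` are admissible for the part `Z` below the node `t`. -/
structure Partial (k : ℕ) (t : T) (Z : Set T) (l : V → ℕ) : Prop where
  label : ∀ u, 1 ≤ l u ∧ l u ≤ 5
  lt : ∀ u ∈ D.bag t, D.cnt Z l u < 2048
  ok : ∀ u, D.Done Z u → OkW (D.cnt Z l u)
  cost : D.cost Z l ≤ k

variable {D}

/-- Charges add up without double counting because a clique has only one topmost node. -/
theorem cnt_union {Z Z' : Set T} (h : Disjoint Z Z') (l : V → ℕ) (u : V) :
    D.cnt (Z ∪ Z') l u = D.cnt Z l u + D.cnt Z' l u := by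
  classical
  simp only [cnt, ← Finset.sum_add_distrib]
  refine Finset.sum_congr rfl fun v _ => Finset.sum_congr rfl fun w _ => ?_
  by_cases h1 : ∃ s ∈ Z, D.Top u v w s
  · have h2 : ¬ ∃ s ∈ Z', D.Top u v w s := by
      rintro ⟨s', hs', ht'⟩
      obtain ⟨s, hs, ht⟩ := h1
      exact Set.disjoint_left.1 h hs (ht.unique ht' ▸ hs')
    obtain ⟨s, hs, ht⟩ := h1
    rw [if_pos ⟨s, .inl hs, ht⟩, if_pos ⟨s, hs, ht⟩, if_neg h2, add_zero]
  · rw [if_neg h1, zero_add]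
    congr 1
    simp only [Set.mem_union, eq_iff_iff]
    exact ⟨fun ⟨s, hs, ht⟩ => ⟨s, hs.resolve_left fun h => h1 ⟨s, h, ht⟩, ht⟩,
      fun ⟨s, hs, ht⟩ => ⟨s, .inr hs, ht⟩⟩

theorem cost_union {Z Z' : Set T} (h : Disjoint Z Z') (l : V → ℕ) :
    D.cost (Z ∪ Z') l = D.cost Z l + D.cost Z' l := by
  classical
  simp only [cost, ← Finset.sum_add_distrib, done_union]
  refine Finset.sum_congr rfl fun v _ => ?_
  by_cases h1 : D.Done Z v
  · have h2 : ¬ D.Done Z' v := by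
      rintro ⟨s', hs', ht'⟩
      obtain ⟨s, hs, ht⟩ := h1
      exact Set.disjoint_left.1 h hs (ht.unique ht' ▸ hs')
    simp [h1, h2]
  · simp [h1]

theorem cnt_congr {Z : Set T} {l l' : V → ℕ} (h : ∀ s ∈ Z, ∀ v ∈ D.bag s, l v = l' v) (u : V) :
    D.cnt Z l u = D.cnt Z l' u := by
  classical
  simp only [cnt]
  refine Finset.sum_congr rfl fun v _ => Finset.sum_congr rfl fun w _ => ?_
  split_ifs with h1
  · obtain ⟨s, hs, ht⟩ := h1
    exact contr_congr (h s hs _ ht.1.1) (h s hs _ ht.1.2.1) (h s hs _ ht.1.2.2)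
  · rfl

theorem cost_congr {Z : Set T} {l l' : V → ℕ} (h : ∀ s ∈ Z, ∀ v ∈ D.bag s, l v = l' v) :
    D.cost Z l = D.cost Z l' := by
  classical
  simp only [cost]
  refine Finset.sum_congr rfl fun v _ => ?_
  by_cases h1 : D.Done Z v
  · have h2 := h1
    obtain ⟨s, hs, ht⟩ := h2
    rw [h s hs v ht.1]
  · simp [h1]

theorem cnt_eq_zero {Z : Set T} {l : V → ℕ} {u : V} (h : ∀ s ∈ Z, u ∉ D.bag s) :
    D.cnt Z l u = 0 := by
  classical
  simp only [cnt]
  refine Finset.sum_eq_zero fun v _ => Finset.sum_eq_zero fun w _ => if_neg ?_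
  rintro ⟨s, hs, ht⟩
  exact h s hs ht.1.1

/-! ### Combining two parts -/

section combine

variable {k : ℕ} {t c : T} {Z Z' : Set T} {l l' : V → ℕ}

/-- A vertex that is finished inside one of the two parts does not occur in the other, so its charge
in the union is the charge in its own part and `OkW` carries over. The remaining conditions are
inequalities that only become weaker. -/
theorem Partial.split (hZ : D.Branches t Z) (hZ' : D.Branches c Z') (hc : D.par c = t)
    (hd : Disjoint Z (Z' ∪ {c})) (h : D.Partial k t (Z ∪ (Z' ∪ {c})) l) :
    D.Partial k t Z l ∧ D.Partial k c Z' l ∧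
      (∀ u ∈ D.bag c, u ∉ D.bag t → OkW (D.cnt (Z' ∪ {c}) l u)) ∧
      (∀ u ∈ D.bag t, D.cnt Z l u + D.cnt (Z' ∪ {c}) l u < 2048) ∧
      D.cost Z l + D.cost (Z' ∪ {c}) l ≤ k := by
  have hcost := h.cost
  rw [cost_union hd] at hcost
  have hcnt := cnt_union (D := D) hd l
  have hcnt' := cnt_union (D := D) hZ'.disjoint_singleton l
  have hcost' := cost_union (D := D) hZ'.disjoint_singleton l
  have hok : ∀ u ∈ D.bag c, u ∉ D.bag t → OkW (D.cnt (Z' ∪ {c}) l u) := by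
    intro u hu hut
    have h1 := h.ok u (done_union.2 (.inr (done_of_top hc hu hut)))
    rwa [hcnt, cnt_eq_zero, zero_add] at h1
    intro s hs hus
    rcases hZ.done_or u s hs hus with h2 | h2
    · exact Set.disjoint_left.1 hd (hZ.closed u c h2 hu) (.inr rfl)
    · exact hut h2
  refine ⟨⟨h.label, fun u hu => ?_, fun u hu => ?_, by omega⟩,
    ⟨h.label, fun u hu => ?_, fun u hu => ?_, by omega⟩, hok, fun u hu => ?_, hcost⟩
  · have := h.lt u hu
    rw [hcnt] at this
    omega
  · have h1 := h.ok u (done_union.2 (.inl hu))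
    rwa [hcnt, cnt_eq_zero (Z := Z' ∪ {c}), add_zero] at h1
    exact fun s hs hus => Set.disjoint_left.1 hd (hZ.closed u s hu hus) hs
  · by_cases hut : u ∈ D.bag t
    · have := h.lt u hut
      rw [hcnt, hcnt'] at this
      omega
    · have := (hok u hu hut).1
      rw [hcnt'] at this
      omega
  · have h1 := h.ok u (done_union.2 (.inr (done_union.2 (.inl hu))))
    rwa [hcnt, hcnt', cnt_eq_zero (Z := Z), zero_add, cnt_eq_zero (Z := {c}), add_zero] at h1
    · rintro s rfl hus
      exact hZ'.notMem (hZ'.closed u s hu hus)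
    · exact fun s hs hus => Set.disjoint_left.1 hd hs (.inl (hZ'.closed u s hu hus))
  · have := h.lt u hu
    rwa [hcnt] at this

theorem Partial.glue (hZ : D.Branches t Z) (hZ' : D.Branches c Z') (hc : D.par c = t)
    (hd : Disjoint Z (Z' ∪ {c})) (h : D.Partial k t Z l) (h' : D.Partial k c Z' l')
    (hl : ∀ u ∈ D.bag c, u ∈ D.bag t → l u = l' u)
    (hok : ∀ u ∈ D.bag c, u ∉ D.bag t → OkW (D.cnt (Z' ∪ {c}) l' u))
    (hlt : ∀ u ∈ D.bag t, D.cnt Z l u + D.cnt (Z' ∪ {c}) l' u < 2048)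
    (hk : D.cost Z l + D.cost (Z' ∪ {c}) l' ≤ k) (hW : D.Branches t (Z' ∪ {c})) :
    ∃ m, D.Partial k t (Z ∪ (Z' ∪ {c})) m ∧ (∀ u ∈ D.bag t, m u = l u) ∧
      (∀ u, D.cnt (Z ∪ (Z' ∪ {c})) m u = D.cnt Z l u + D.cnt (Z' ∪ {c}) l' u) ∧
      D.cost (Z ∪ (Z' ∪ {c})) m = D.cost Z l + D.cost (Z' ∪ {c}) l' := by
  classical
  -- A vertex that occurs inside and outside the new branch lies in the bags of `c` and of `t`,
  -- where `l` and `l'` agree. So it does not matter which of the two defines `m` there.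
  have both : ∀ v s s', s ∈ Z' ∪ {c} → v ∈ D.bag s → s' ∉ Z' ∪ {c} → v ∈ D.bag s' →
      v ∈ D.bag c ∧ v ∈ D.bag t := by
    intro v s s' hs hv hs' hv'
    refine ⟨?_, (hW.done_or v s hs hv).resolve_left fun h => hs' (hW.closed v s' h hv')⟩
    rcases hs with hs | rfl
    · exact (hZ'.done_or v s hs hv).resolve_left fun h => hs' (.inl (hZ'.closed v s' h hv'))
    · exact hv
  let m : V → ℕ := fun v => if ∃ s ∈ Z' ∪ {c}, v ∈ D.bag s then l' v else l v
  have m' : ∀ s ∈ Z' ∪ {c}, ∀ v ∈ D.bag s, m v = l' v := fun s hs v hv => if_pos ⟨s, hs, hv⟩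
  have mo : ∀ s ∉ Z' ∪ {c}, ∀ v ∈ D.bag s, m v = l v := by
    intro s hs v hv
    by_cases h1 : ∃ s ∈ Z' ∪ {c}, v ∈ D.bag s
    · obtain ⟨s1, hs1, hv1⟩ := h1
      obtain ⟨h2, h3⟩ := both v s1 s hs1 hv1 hs hv
      rw [m' s1 hs1 v hv1, hl v h2 h3]
    · exact if_neg h1
  have hcZ := cnt_congr (D := D) fun s hs => mo s fun hs' => Set.disjoint_left.1 hd hs hs'
  have hcW := cnt_congr (D := D) m'
  have hcnt : ∀ u, D.cnt (Z ∪ (Z' ∪ {c})) m u = D.cnt Z l u + D.cnt (Z' ∪ {c}) l' u := fun u => by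
    rw [cnt_union hd, hcZ, hcW]
  have hcost : D.cost (Z ∪ (Z' ∪ {c})) m = D.cost Z l + D.cost (Z' ∪ {c}) l' := by
    rw [cost_union hd, cost_congr m',
      cost_congr fun s hs => mo s fun hs' => Set.disjoint_left.1 hd hs hs']
  refine ⟨m, ⟨fun u => ?_, fun u hu => ?_, fun u hu => ?_, hcost ▸ hk⟩, mo t hW.notMem, hcnt, hcost⟩
  · simp only [m]
    split
    · exact h'.label u
    · exact h.label u
  · rw [hcnt]
    exact hlt u hu
  · rw [hcnt]
    rcases done_union.1 hu with hu | hu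
    · rw [cnt_eq_zero (Z := Z' ∪ {c}), add_zero]
      · exact h.ok u hu
      · exact fun s hs hus => Set.disjoint_left.1 hd (hZ.closed u s hu hus) hs
    · rw [cnt_eq_zero (Z := Z), zero_add]
      · rcases done_union.1 hu with h1 | ⟨s, hs, h1⟩
        · rw [cnt_union hZ'.disjoint_singleton, cnt_eq_zero (Z := {c}), add_zero]
          · exact h'.ok u h1
          · rintro s rfl hus
            exact hZ'.notMem (hZ'.closed u s h1 hus)
        · obtain rfl := hs
          exact hok u h1.1 (hc ▸ h1.2)
      · exact fun s hs hus => Set.disjoint_left.1 hd hs (hW.closed u s hu hus)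

end combine

end RTree

/-! ### Numbering the states -/

/-- Every number in range encodes a state, so a loop over numbers is a loop over states. The digits
are bounded on all of `V`, so that no bag has to be mentioned along with the bound. -/
theorem exists_ofDigits {V : Type*} {q : ℕ} (hq : 0 < q) {b : List V} (hb : b.Nodup) {a : ℕ}
    (ha : a < q ^ b.length) :
    ∃ σ : V → ℕ, (∀ u, σ u < q) ∧ Nat.ofDigits q (b.map σ) = a := by
  classical
  induction b generalizing a with
  | nil => exact ⟨fun _ => 0, fun _ => hq, by simp at ha; simp [ha]⟩
  | cons u b ih =>
    obtain ⟨hu, hb⟩ := List.nodup_cons.1 hb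
    obtain ⟨σ, hσ, e⟩ := ih hb (a := a / q) (by
      rw [Nat.div_lt_iff_lt_mul hq]
      simpa [pow_succ] using ha)
    refine ⟨Function.update σ u (a % q), fun v => ?_, ?_⟩
    · rw [Function.update_apply]
      split
      · exact Nat.mod_lt _ hq
      · exact hσ v
    · rw [List.map_cons, Nat.ofDigits_cons, Function.update_self,
        List.map_congr_left (g := σ) fun v hv =>
          Function.update_of_ne (by rintro rfl; exact hu hv) _ _, e]
      exact Nat.mod_add_div a q

theorem ofDigits_map_inj {V : Type*} {q : ℕ} (hq : 1 < q) {b : List V} {σ τ : V → ℕ}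
    (hσ : ∀ u ∈ b, σ u < q) (hτ : ∀ u ∈ b, τ u < q)
    (h : Nat.ofDigits q (b.map σ) = Nat.ofDigits q (b.map τ)) : ∀ u ∈ b, σ u = τ u := by
  have := Nat.ofDigits_inj_of_len_eq hq (by simp) (by simpa using hσ) (by simpa using hτ) h
  exact fun u hu => List.map_inj_left.1 this u hu

theorem ofDigits_map_lt {V : Type*} {q : ℕ} (hq : 1 < q) {b : List V} {σ : V → ℕ}
    (hσ : ∀ u ∈ b, σ u < q) : Nat.ofDigits q (b.map σ) < q ^ b.length := by
  have := Nat.ofDigits_lt_base_pow_length hq (l := b.map σ) (by simpa using hσ)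
  simpa using this

theorem sum_map_eq {V : Type*} [Fintype V] {b : List V} (hb : b.Nodup) (p : V → Prop)
    [DecidablePred p] (hp : ∀ v, p v ↔ v ∈ b) (f : V → ℕ) :
    (b.map f).sum = ∑ v, if p v then f v else 0 := by
  classical
  rw [← List.sum_toFinset f hb, ← Finset.sum_filter]
  congr 1
  ext v
  simp [hp]

namespace RTree

variable {V T : Type*} {G : SimpleGraph V} (D : RTree G T)

/-- The number of the state in which the vertices of the bag of `t` have the digits `σ`. -/
def code (t : T) (σ : V → ℕ) : ℕ := Nat.ofDigits 16384 ((D.bag t).map σ)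

open Classical in
/-- The digit `σ u` after adding the charges of `u` for the edges and triangles in the bag of `c`
that are not in the bag of `t`. -/
noncomputable def bump (t c : T) (σ : V → ℕ) (u : V) : ℕ :=
  σ u + 8 * ((D.bag c).map fun v => ((D.bag c).map fun w =>
    if u ∈ D.bag t ∧ v ∈ D.bag t ∧ w ∈ D.bag t then 0 else contr G (fun x => σ x % 8) u v w).sum).sum

/-- The states `σ` of `t` and `τ` of its child `c` can be combined. -/
structure Compatible (t c : T) (σ τ : V → ℕ) : Prop where
  ok : ∀ u ∈ D.bag c, u ∉ D.bag t → OkW (D.bump t c τ u / 8)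
  eq : ∀ u ∈ D.bag c, u ∈ D.bag t → σ u % 8 = τ u % 8
  lt : ∀ u ∈ D.bag c, u ∈ D.bag t → σ u + 8 * (D.bump t c τ u / 8) < 16384

open Classical in
/-- The combination of the states `σ` and `τ`. -/
noncomputable def joined (t c : T) (σ τ : V → ℕ) (u : V) : ℕ :=
  σ u + if u ∈ D.bag c then 8 * (D.bump t c τ u / 8) else 0

open Classical in
/-- The number of deleted vertices of the bag of `c` that are not in the bag of `t`. -/
noncomputable def lost (t c : T) (τ : V → ℕ) : ℕ :=
  ((D.bag c).map fun u => if u ∉ D.bag t ∧ τ u % 8 = 5 then 1 else 0).sum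

variable {D}

theorem bump_congr {t c : T} {σ τ : V → ℕ} (h : ∀ u ∈ D.bag c, σ u = τ u) {u : V}
    (hu : u ∈ D.bag c) : D.bump t c σ u = D.bump t c τ u := by
  simp only [bump]
  rw [h u hu]
  congr 3
  refine List.map_congr_left fun v hv => ?_
  congr 1
  refine List.map_congr_left fun w hw => ?_
  split
  · rfl
  · exact contr_congr (by rw [h u hu]) (by rw [h v hv]) (by rw [h w hw])

theorem lost_congr {t c : T} {σ τ : V → ℕ} (h : ∀ u ∈ D.bag c, σ u = τ u) :
    D.lost t c σ = D.lost t c τ := by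
  simp only [lost]
  congr 1
  exact List.map_congr_left fun v hv => by rw [h v hv]

theorem code_congr {t : T} {σ τ : V → ℕ} (h : ∀ u ∈ D.bag t, σ u = τ u) :
    D.code t σ = D.code t τ := by
  rw [code, code, List.map_congr_left h]

variable [Fintype V]

theorem dig_mod {Z : Set T} {l : V → ℕ} {u : V} (h : l u ≤ 5) : D.dig Z l u % 8 = l u := by
  rw [dig]; omega

theorem dig_div {Z : Set T} {l : V → ℕ} {u : V} (h : l u ≤ 5) :
    D.dig Z l u / 8 = D.cnt Z l u := by
  rw [dig]; omega

/-- The cliques whose topmost node is `c` are those inside the bag of `c` but not inside the bag of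
its parent `t`, and these are the ones that `bump` adds. -/
theorem bump_dig {t c : T} (hc : D.par c = t) {Z : Set T} (hZ : D.Branches c Z) {l : V → ℕ}
    (hl : ∀ u, l u ≤ 5) {u : V} (hu : u ∈ D.bag c) :
    D.bump t c (D.dig Z l) u = D.dig (Z ∪ {c}) l u := by
  classical
  rw [bump, dig, dig, cnt_union hZ.disjoint_singleton, mul_add, ← add_assoc]
  congr 2
  rw [sum_map_eq (D.bag_nodup c) (· ∈ D.bag c) fun _ => Iff.rfl, cnt]
  refine Finset.sum_congr rfl fun v _ => ?_
  by_cases hv : v ∈ D.bag c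
  · rw [if_pos hv, sum_map_eq (D.bag_nodup c) (· ∈ D.bag c) fun _ => Iff.rfl]
    refine Finset.sum_congr rfl fun w _ => ?_
    simp only [Set.mem_singleton_iff, exists_eq_left, Top, hu, hv, true_and, hc]
    rw [contr_congr (l := fun x => D.dig Z l x % 8) (l' := l) (dig_mod (hl u)) (dig_mod (hl v))
      (dig_mod (hl w))]
    by_cases hw : w ∈ D.bag c <;>
      by_cases h : u ∈ D.bag t ∧ v ∈ D.bag t ∧ w ∈ D.bag t <;> simp [hw, h]
  · rw [if_neg hv]
    exact (Finset.sum_eq_zero fun w _ => if_neg fun ⟨s, hs, ht⟩ => hv (hs ▸ ht.1.2.1)).symm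

theorem lost_dig {t c : T} (hc : D.par c = t) {Z : Set T} {l : V → ℕ}
    (hl : ∀ u, l u ≤ 5) : D.lost t c (D.dig Z l) = D.cost {c} l := by
  classical
  rw [lost, sum_map_eq (D.bag_nodup c) (· ∈ D.bag c) fun _ => Iff.rfl, cost]
  refine Finset.sum_congr rfl fun v _ => ?_
  rw [dig_mod (hl v), ← ite_and]
  congr 1
  simp only [Done, TopV, Set.mem_singleton_iff, exists_eq_left, hc, eq_iff_iff]
  tauto

/-! ### Tables -/

variable (D) in
/-- The table `f` holds, for every state of `t`, one plus the least number of deleted vertices in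
the part `Z` below `t`, or `0` if the state is impossible. -/
structure Table (k : ℕ) (t : T) (Z : Set T) (f : ℕ → ℕ) : Prop where
  le : ∀ l, D.Partial k t Z l → f (D.code t (D.dig Z l)) ≠ 0 ∧
    f (D.code t (D.dig Z l)) ≤ D.cost Z l + 1
  exists_eq : ∀ a < 16384 ^ (D.bag t).length, f a ≠ 0 →
    ∃ l, D.Partial k t Z l ∧ D.code t (D.dig Z l) = a ∧ D.cost Z l + 1 = f a

/-- Three bits for the label and eleven for the charge: `5 + 8 * 2047 < 16384`. -/
theorem Partial.dig_lt {k : ℕ} {t : T} {Z : Set T} {l : V → ℕ} (h : D.Partial k t Z l) {u : V}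
    (hu : u ∈ D.bag t) : D.dig Z l u < 16384 := by
  have := h.lt u hu
  have := (h.label u).2
  rw [dig]; omega

open Classical in
-- No node has been processed, so there are no charges and the digits are the labels themselves.
-- Vertices outside the bag may get any label, and `1` is chosen.
theorem table_empty {k : ℕ} {t : T} {f : ℕ → ℕ}
    (hf : ∀ σ : V → ℕ, (∀ u, σ u < 16384) →
      f (D.code t σ) = if ∀ u ∈ D.bag t, 1 ≤ σ u ∧ σ u ≤ 5 then 1 else 0) :
    D.Table k t ∅ f := by
  have h0 : ∀ l u, D.cnt ∅ l u = 0 := fun l u => cnt_eq_zero (by simp)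
  have c0 : ∀ l, D.cost ∅ l = 0 := fun l => by simp [cost, Done]
  have d0 : ∀ l, D.dig ∅ l = l := fun l => by funext u; simp [dig, h0]
  refine ⟨fun l h => ?_, fun a ha hfa => ?_⟩
  · rw [d0, hf l (fun u => by have := (h.label u).2; omega), if_pos fun u _ => h.label u]
    omega
  · obtain ⟨σ, hσ, rfl⟩ := exists_ofDigits (by norm_num) (D.bag_nodup t) ha
    have h1 := hf σ hσ
    rw [code] at h1
    rw [h1] at hfa ⊢
    split at hfa
    · next h2 =>
      refine ⟨fun u => if u ∈ D.bag t then σ u else 1, ⟨fun u => ?_, fun u _ => ?_,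
        fun u hu => ?_, ?_⟩, ?_, ?_⟩
      · split
        · next hu => exact h2 u hu
        · omega
      · rw [h0]; norm_num
      · simp [Done] at hu
      · rw [c0]; omega
      · rw [d0]
        exact code_congr fun u hu => if_pos hu
      · rw [c0, if_pos h2]
    · exact absurd rfl hfa

/-- Entries are costs plus one, so merging two of them gives `h + 1 = f + g + lost`, and the budget
`k` turns into `k + 2` on the right. The hypotheses `hsound` and `hcomplete` speak of pairs of
states, which is what the program enumerates; `Partial.split` and `Partial.glue` translate them into
labels. -/
theorem Table.combine {k : ℕ} {t c : T} (hcr : c ≠ D.root) (hc : D.par c = t) {Z Z' : Set T}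
    (hZ : D.Branches t Z) (hZ' : D.Branches c Z') (hW : D.below [c] = Z' ∪ {c})
    (hd : Disjoint Z (Z' ∪ {c})) {f g h : ℕ → ℕ} (hf : D.Table k t Z f) (hg : D.Table k c Z' g)
    (hsound : ∀ a < 16384 ^ (D.bag t).length, h a ≠ 0 → ∃ σ τ : V → ℕ,
      (∀ u, σ u < 16384) ∧ (∀ u, τ u < 16384) ∧ f (D.code t σ) ≠ 0 ∧ g (D.code c τ) ≠ 0 ∧
      D.Compatible t c σ τ ∧ D.code t (D.joined t c σ τ) = a ∧
      h a + 1 = f (D.code t σ) + g (D.code c τ) + D.lost t c τ ∧ h a ≤ k + 1)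
    (hcomplete : ∀ σ τ : V → ℕ, (∀ u, σ u < 16384) → (∀ u, τ u < 16384) →
      f (D.code t σ) ≠ 0 → g (D.code c τ) ≠ 0 → D.Compatible t c σ τ →
      f (D.code t σ) + g (D.code c τ) + D.lost t c τ ≤ k + 2 →
      h (D.code t (D.joined t c σ τ)) ≠ 0 ∧
      h (D.code t (D.joined t c σ τ)) + 1 ≤ f (D.code t σ) + g (D.code c τ) + D.lost t c τ) :
    D.Table k t (Z ∪ (Z' ∪ {c})) h := by
  classical
  have hcW : ∀ l, D.cost (Z' ∪ {c}) l = D.cost Z' l + D.cost {c} l :=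
    cost_union hZ'.disjoint_singleton
  have hBW : D.Branches t (Z' ∪ {c}) := hW ▸ branches_below (by simp [hcr, hc])
  have hbump : ∀ {l}, (∀ u, l u ≤ 5) → ∀ u ∈ D.bag c,
      D.bump t c (D.dig Z' l) u / 8 = D.cnt (Z' ∪ {c}) l u := fun hl u hu => by
    rw [bump_dig hc hZ' hl hu, dig_div (hl u)]
  -- A vertex of the bag of `t` that is missing at `c` occurs nowhere below `c`, so its digit is
  -- unchanged.
  have zero : ∀ l u, u ∉ D.bag c → u ∈ D.bag t → D.cnt (Z' ∪ {c}) l u = 0 := by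
    intro l u hu hut
    refine cnt_eq_zero fun s hs hus => ?_
    rw [← hW] at hs
    obtain ⟨c', hc', hs⟩ := hs
    rw [List.mem_singleton] at hc'
    subst hc'
    rcases hs.top_or hus with ⟨t', h1, h2⟩ | h1
    · have := (h1.desc hut).depth_le
      have := h2.depth_le
      have := D.depth_par c' hcr
      rw [hc] at this
      omega
    · exact hu h1.1
  refine ⟨fun l hl => ?_, fun a ha hha => ?_⟩
  · obtain ⟨p1, p2, hok, hlt, hk⟩ := hl.split hZ hZ' hc hd
    have hl5 : ∀ u, l u ≤ 5 := fun u => (hl.label u).2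
    obtain ⟨f0, fle⟩ := hf.le l p1
    obtain ⟨g0, gle⟩ := hg.le l p2
    -- The digits are set to `0` off the bag, because `dig` is known to be bounded on the bag only.
    set σ : V → ℕ := fun u => if u ∈ D.bag t then D.dig Z l u else 0 with hσ
    set τ : V → ℕ := fun u => if u ∈ D.bag c then D.dig Z' l u else 0 with hτ
    have eσ : ∀ u ∈ D.bag t, σ u = D.dig Z l u := fun u hu => if_pos hu
    have eτ : ∀ u ∈ D.bag c, τ u = D.dig Z' l u := fun u hu => if_pos hu
    have ebump : ∀ u ∈ D.bag c, D.bump t c τ u / 8 = D.cnt (Z' ∪ {c}) l u := fun u hu => by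
      rw [bump_congr eτ hu, hbump hl5 u hu]
    have elost : D.lost t c τ = D.cost {c} l := by rw [lost_congr eτ, lost_dig hc hl5]
    have ejoin : D.code t (D.joined t c σ τ) = D.code t (D.dig (Z ∪ (Z' ∪ {c})) l) := by
      refine code_congr fun u hu => ?_
      rw [joined, eσ u hu, dig, dig, cnt_union hd]
      split
      · next huc => rw [ebump u huc]; ring
      · next huc => rw [zero l u huc hu]; ring
    have := hcomplete σ τ (fun u => ?_) (fun u => ?_) (by rwa [code_congr eσ])
      (by rwa [code_congr eτ]) ⟨fun u hu hut => ?_, fun u hu hut => ?_, fun u hu hut => ?_⟩ ?_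
    · rw [ejoin, code_congr eσ, code_congr eτ, elost] at this
      refine ⟨this.1, ?_⟩
      rw [cost_union hd, hcW]
      omega
    · simp only [hσ]
      split
      · next hu => exact p1.dig_lt hu
      · norm_num
    · simp only [hτ]
      split
      · next hu => exact p2.dig_lt hu
      · norm_num
    · rw [ebump u hu]
      exact hok u hu hut
    · rw [eσ u hut, eτ u hu, dig_mod (hl5 u), dig_mod (hl5 u)]
    · rw [eσ u hut, ebump u hu, dig]
      have := hlt u hut
      have := hl5 u
      omega
    · rw [code_congr eσ, code_congr eτ, elost]
      rw [hcW] at hk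
      omega
  · obtain ⟨σ, τ, hσ, hτ, f0, g0, ⟨cok, ceq, clt⟩, rfl, hval, hle⟩ := hsound a ha hha
    obtain ⟨l, pl, el, vl⟩ := hf.exists_eq _
      (ofDigits_map_lt (by norm_num) fun u _ => hσ u) f0
    obtain ⟨l', pl', el', vl'⟩ := hg.exists_eq _
      (ofDigits_map_lt (by norm_num) fun u _ => hτ u) g0
    have eσ : ∀ u ∈ D.bag t, σ u = D.dig Z l u := fun u hu =>
      (ofDigits_map_inj (by norm_num) (fun u hu => pl.dig_lt hu) (fun u _ => hσ u) el u hu).symm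
    have eτ : ∀ u ∈ D.bag c, τ u = D.dig Z' l' u := fun u hu =>
      (ofDigits_map_inj (by norm_num) (fun u hu => pl'.dig_lt hu) (fun u _ => hτ u) el' u hu).symm
    change _ = f (D.code t σ) at vl
    change _ = g (D.code c τ) at vl'
    have hl5 : ∀ u, l u ≤ 5 := fun u => (pl.label u).2
    have hl5' : ∀ u, l' u ≤ 5 := fun u => (pl'.label u).2
    have ebump : ∀ u ∈ D.bag c, D.bump t c τ u / 8 = D.cnt (Z' ∪ {c}) l' u := fun u hu => by
      rw [bump_congr eτ hu, hbump hl5' u hu]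
    have elost : D.lost t c τ = D.cost {c} l' := by rw [lost_congr eτ, lost_dig hc hl5']
    rw [elost] at hval
    have hglue := pl.glue hZ hZ' hc hd pl' (fun u hu hut => ?_) (fun u hu hut => ?_)
      (fun u hut => ?_) ?_ hBW
    · obtain ⟨m, pm, hm, mcnt, mcost⟩ := hglue
      refine ⟨m, pm, code_congr fun u hu => ?_, ?_⟩
      · rw [joined, eσ u hu, dig, dig, mcnt, hm u hu]
        split
        · next huc => rw [ebump u huc]; ring
        · next huc => rw [zero l' u huc hu]; ring
      · rw [mcost, hcW]
        omega
    · have := ceq u hu hut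
      rwa [eσ u hut, eτ u hu, dig_mod (hl5 u), dig_mod (hl5' u)] at this
    · rw [← ebump u hu]
      exact cok u hu hut
    · by_cases hu : u ∈ D.bag c
      · have := clt u hu hut
        rw [eσ u hut, ebump u hu, dig] at this
        omega
      · rw [zero l' u hu hut, add_zero]
        exact pl.lt u hut
    · rw [hcW]
      omega

/-- The table at the root decides whether there are admissible labels. -/
theorem Table.root {k : ℕ} {cs : List T} (hcs : ∀ s, s ∈ cs ↔ s ≠ D.root ∧ D.par s = D.root)
    {f : ℕ → ℕ} (h : D.Table k D.root (D.below cs) f) :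
    f 0 ≠ 0 ↔ ∃ l, ValidLabels G l ∧ (Finset.univ.filter fun v => l v = 5).card ≤ k := by
  classical
  -- At the root nothing is left open: every vertex and every clique has its topmost node below a
  -- child of the root, so partial charges and costs are the total ones.
  have hmem : ∀ s, s ≠ D.root → s ∈ D.below cs := by
    intro s hs
    have h1 : s ∈ D.below [D.root] := ⟨D.root, by simp, desc_root s⟩
    rw [below_singleton hcs] at h1
    exact h1.resolve_right hs
  have hdone : ∀ u, D.Done (D.below cs) u := by
    intro u
    obtain ⟨s, hs⟩ := D.cover u
    obtain ⟨t, ht, -⟩ := exists_topV hs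
    exact ⟨t, hmem t (ne_root ht.1), ht⟩
  have hcnt : ∀ l u, D.cnt (D.below cs) l u = tot G l u := by
    intro l u
    rw [cnt, tot]
    refine Finset.sum_congr rfl fun v _ => Finset.sum_congr rfl fun w _ => ?_
    by_cases hq : Cliq G u v w
    · obtain ⟨s, hs⟩ := exists_top_of_cliq (D := D) hq
      rw [if_pos ⟨s, hmem s (ne_root hs.1.1), hs⟩]
    · simp [contr, hq]
  have hcost : ∀ l, D.cost (D.below cs) l = (Finset.univ.filter fun v => l v = 5).card := by
    intro l
    simp [cost, hdone]
  have hcode : ∀ σ, D.code D.root σ = 0 := fun σ => by simp [code, D.bag_root]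
  constructor
  · intro h0
    obtain ⟨l, hl, -, -⟩ := h.exists_eq 0 (by positivity) h0
    refine ⟨l, fun u => ⟨hl.label u, ?_⟩, hcost l ▸ hl.cost⟩
    rw [← hcnt]
    exact hl.ok u (hdone u)
  · rintro ⟨l, hl, hk⟩
    have := (h.le l ⟨fun u => (hl u).1, fun u hu => ?_, fun u _ => ?_, (hcost l).trans_le hk⟩).1
    · rwa [hcode] at this
    · simp [D.bag_root] at hu
    · rw [hcnt]
      exact (hl u).2

end RTree

/-! ### Parents in a rooted tree -/

section tree

variable {T : Type*} {A : SimpleGraph T} (hA : A.IsTree) (r : T)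

/-- The neighbour of `t` on the way to `r`. -/
noncomputable def parent (t : T) : T := (hA.existsUnique_path r t).choose.penultimate

variable {hA r}

theorem eq_parent {x t : T} (h : A.Adj x t) (hd : A.dist r t = A.dist r x + 1) :
    x = parent hA r t := by
  obtain ⟨q, hq⟩ := hA.connected.exists_walk_length_eq_dist r x
  have hp : (q.concat h).IsPath := SimpleGraph.Walk.isPath_of_length_eq_dist _ (by simp [hq, hd])
  rw [parent, ← (hA.existsUnique_path r t).choose_spec.2 _ hp]
  simp

theorem parent_adj {t : T} (ht : t ≠ r) :
    A.Adj (parent hA r t) t ∧ A.dist r t = A.dist r (parent hA r t) + 1 := by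
  set p := (hA.existsUnique_path r t).choose with hp
  have hpath : p.IsPath := (hA.existsUnique_path r t).choose_spec.1
  have hnil : ¬ p.Nil := fun h => ht h.eq.symm
  have hadj : A.Adj (parent hA r t) t := p.adj_penultimate hnil
  refine ⟨hadj, ?_⟩
  obtain ⟨q, hq, hq'⟩ := hA.connected.exists_path_of_dist r t
  have e : p = q := ((hA.existsUnique_path r t).choose_spec.2 q hq).symm
  have h1 : p.length = A.dist r t := by rw [e, hq']
  have h2 := SimpleGraph.dist_le p.dropLast
  have h3 : p.length ≠ 0 := fun h => hnil (SimpleGraph.Walk.length_eq_zero_iff.1 h)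
  have h5 : A.dist r (parent hA r t) ≤ p.length - 1 := h2.trans (by simp)
  rcases hA.dist_eq_dist_add_one_of_adj r hadj with h4 | h4
  · omega
  · exact h4

theorem mem_children_iff {s t : T} :
    s ∈ children A r t ↔ s ≠ r ∧ parent hA r s = t := by
  constructor
  · rintro ⟨h1, h2⟩
    refine ⟨?_, (eq_parent h1 h2).symm⟩
    rintro rfl
    simp at h2
  · rintro ⟨h, rfl⟩
    exact parent_adj h

/-- A path of a tree contains the parent of one of its ends. -/
theorem parent_mem_support {s s' : T} (hs : s ≠ s') (p : A.Walk s s') (hp : p.IsPath) :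
    parent hA r s ∈ p.support ∨ parent hA r s' ∈ p.support := by
  by_contra! h
  -- The distance from `r` grows along the whole path: a first step towards `r` would lead to the
  -- parent of `s`, a later one back to the previous vertex. Consequently the last vertex but one is
  -- the parent of `s'`.
  have key : ∀ i, i ≤ p.length → A.dist r (p.getVert i) = A.dist r s + i := by
    intro i
    induction i using Nat.strong_induction_on with
    | _ i ih =>
      intro hi
      rcases i with _ | i
      · simp
      have hadj := p.adj_getVert_succ (i := i) (by omega)
      rcases hA.dist_eq_dist_add_one_of_adj r hadj with h1 | h1
      · have e := eq_parent (hA := hA) hadj.symm h1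
        rcases i with _ | i
        · rw [SimpleGraph.Walk.getVert_zero] at e
          exact absurd (e ▸ p.getVert_mem_support 1) h.1
        · have e' := eq_parent (hA := hA) (p.adj_getVert_succ (i := i) (by omega))
            (by rw [ih (i + 1) (by omega) (by omega), ih i (by omega) (by omega)]; ring)
          have := hp.getVert_injOn (by simp; omega) (by simp; omega) (e.trans e'.symm)
          omega
      · rw [h1, ih i (by omega) (by omega)]; ring
  have hl : p.length ≠ 0 := fun h => hs (SimpleGraph.Walk.eq_of_length_eq_zero h)
  have hadj := p.adj_getVert_succ (i := p.length - 1) (by omega)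
  rw [show p.length - 1 + 1 = p.length by omega, SimpleGraph.Walk.getVert_length] at hadj
  have h2 := key _ le_rfl
  rw [SimpleGraph.Walk.getVert_length] at h2
  have e := eq_parent (hA := hA) hadj (by rw [h2, key _ (Nat.sub_le _ _)]; omega)
  exact h.2 (e ▸ p.getVert_mem_support _)

end tree

theorem TreeDecomposition.card_bag_le {V T : Type*} [Fintype T] {G : SimpleGraph V}
    (D : TreeDecomposition G T) (t : T) : (D.bag t).card ≤ D.width + 1 := by
  have := Finset.le_sup (f := fun t => (D.bag t).card) (Finset.mem_univ t)
  rw [TreeDecomposition.width]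
  omega

theorem NiceTreeDecomposition.length_children_le {V T : Type*} {G : SimpleGraph V}
    (D : NiceTreeDecomposition G T) {t : T} {l : List T} (hl : l.Nodup)
    (h : ∀ s, s ∈ l ↔ s ∈ children D.tree D.root t) : l.length ≤ 2 := by
  classical
  rw [← List.toFinset_card_of_nodup hl]
  rcases D.node t with ⟨h1, -⟩ | ⟨t', h1, -⟩ | ⟨t', t'', -, h1, -⟩
  · have : l.toFinset = ∅ := by ext s; simp [h, h1]
    simp [this]
  · have : l.toFinset = {t'} := by ext s; simp [h, h1]
    simp [this]
  · have : l.toFinset = {t', t''} := by ext s; simp [h, h1]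
    rw [this]
    exact Finset.card_le_two

/-- The decomposition in terms of parents. -/
noncomputable def NiceTreeDecomposition.toRTree {V T : Type*} {G : SimpleGraph V}
    (D : NiceTreeDecomposition G T) (bs : T → List V)
    (hbs : ∀ t, (bs t).Nodup ∧ ∀ v, v ∈ bs t ↔ v ∈ D.bag t) : RTree G T where
  root := D.root
  par := parent D.isTree D.root
  bag := bs
  depth := D.tree.dist D.root
  depth_par t ht := by rw [(parent_adj (hA := D.isTree) ht).2]; omega
  bag_nodup t := (hbs t).1
  bag_root := by
    rw [List.eq_nil_iff_forall_not_mem]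
    intro v hv
    rw [(hbs _).2, D.bag_root] at hv
    simp at hv
  top_unique v s s' h1 h2 h3 h4 := by
    simp only [(hbs _).2] at h1 h2 h3 h4
    by_contra hs
    obtain ⟨p, hp, -⟩ := D.isTree.existsUnique_path s s'
    -- Two topmost nodes of `v` would be joined by a path through the parent of one of them, and `v`
    -- belongs to all bags along this path.
    rcases parent_mem_support (hA := D.isTree) (r := D.root) hs p hp with h | h
    · exact h2 (D.bag_of_mem_path _ _ _ p hp h v h1 h3)
    · exact h4 (D.bag_of_mem_path _ _ _ p hp h v h1 h3)
  cover v := by simpa only [(hbs _).2] using D.exists_mem_bag v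
  cover_edge u v h := by simpa only [(hbs _).2] using D.exists_edge_bag u v h

/-! ### The input -/

/-- The data from which an input is built. -/
structure Enc (n N : ℕ) where
  G : SimpleGraph (Fin n)
  D : RTree G (Fin N)
  k : ℕ
  w : ℕ
  es : List (Fin n × Fin n)
  ch : Fin N → List (Fin N)
  es_nodup : (es.map (fun e => s(e.1, e.2))).Nodup
  adj_iff : ∀ u v, G.Adj u v ↔ s(u, v) ∈ es.map (fun e => s(e.1, e.2))
  ch_nodup : ∀ t, (ch t).Nodup
  mem_ch : ∀ t s, s ∈ ch t ↔ s ≠ D.root ∧ D.par s = t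
  length_ch : ∀ t, (ch t).length ≤ 2
  length_bag : ∀ t, (D.bag t).length ≤ w + 1

namespace Enc

variable {n N : ℕ} (E : Enc n N)

/-- The part of the input that belongs to one node. -/
def record (t : Fin N) : List ℕ :=
  (E.ch t).length :: (E.ch t).map Fin.val ++ (E.D.bag t).length :: (E.D.bag t).map Fin.val

def input : List ℕ :=
  [n, E.es.length, E.k, N, (E.D.root : ℕ)] ++ E.es.flatMap (fun e => [(e.1 : ℕ), (e.2 : ℕ)]) ++
    (List.finRange N).flatMap E.record

/-- The part of the input before the records of the nodes `t`, `t + 1`, …. -/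
def prefixLength (t : ℕ) : ℕ :=
  5 + 2 * E.es.length + (((List.finRange N).take t).map fun t => (E.record t).length).sum

end Enc

theorem bind_pure_val {n : ℕ} (l : List (Fin n)) :
    (do let a ← l; pure (a : ℕ) : List ℕ) = l.map Fin.val := by
  simp [List.map_eq_flatMap]

theorem IsEncoding.exists_enc {n N : ℕ} {G : SimpleGraph (Fin n)} {k : ℕ}
    {D : NiceTreeDecomposition G (Fin N)} {input : List ℕ} (h : IsEncoding G k D input) :
    ∃ E : Enc n N, E.G = G ∧ E.k = k ∧ E.w = D.width ∧ E.input = input := by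
  obtain ⟨es, ch, bs, h1, h2, h3, h4, rfl⟩ := h
  refine ⟨⟨G, D.toRTree bs h4, k, D.width, es, ch, h1, h2, fun t => (h3 t).1, fun t s => ?_,
    fun t => D.length_children_le (h3 t).1 (h3 t).2, fun t => ?_⟩, rfl, rfl, rfl, ?_⟩
  · rw [(h3 t).2, mem_children_iff (hA := D.isTree)]
    rfl
  · refine le_trans (le_of_eq ?_) (D.card_bag_le t)
    change (bs t).length = _
    classical
    rw [← List.toFinset_card_of_nodup (h4 t).1]
    congr 1
    ext v
    simp [(h4 t).2]
  · simp only [Enc.input, List.map_id', bind_pure_val]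
    rfl

/-! ### Reading the input -/

theorem getD_append_right' {α : Type*} (l l' : List α) (d : α) (i : ℕ) :
    (l ++ l').getD (l.length + i) d = l'.getD i d := by
  rw [List.getD_append_right _ _ _ _ (by omega)]
  congr 1
  omega

theorem getD_flatMap {α : Type*} (l : List α) (f : α → List ℕ) (t i : ℕ) (ht : t < l.length)
    (hi : i < (f l[t]).length) :
    (l.flatMap f).getD (((l.take t).map fun a => (f a).length).sum + i) 0 =
      (f l[t]).getD i 0 := by
  induction l generalizing t with
  | nil => simp at ht
  | cons a l ih =>
    rcases t with _ | t
    · rw [List.flatMap_cons]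
      simpa using List.getD_append _ _ _ _ hi
    · simp only [List.flatMap_cons, List.take_succ_cons, List.map_cons, List.sum_cons,
        List.getElem_cons_succ, add_assoc, getD_append_right']
      exact ih t (by simpa using ht) hi

theorem getD_map_fin {n : ℕ} (l : List (Fin n)) {i : ℕ} (hi : i < l.length) :
    (l.map Fin.val).getD i 0 = l[i] := by
  rw [List.getD_eq_getElem _ _ (by simpa), List.getElem_map]

namespace Enc

variable {n N : ℕ} (E : Enc n N)

/-- The position of the number of children of a node. -/
def chp (t : Fin N) : ℕ := E.prefixLength t

/-- The position of the size of the bag of a node. -/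
def bgp (t : Fin N) : ℕ := E.chp t + 1 + (E.ch t).length

/-- The input, as a memory content. -/
def inp (i : ℕ) : ℕ := E.input.getD i 0

theorem prefixLength_succ (t : Fin N) :
    E.prefixLength (t + 1) = E.bgp t + 1 + (E.D.bag t).length := by
  rw [bgp, chp, prefixLength, prefixLength, List.take_add_one]
  simp [record]
  ring

theorem input_length : E.input.length = E.prefixLength N := by
  rw [input, prefixLength, List.take_of_length_le (by simp)]
  simp [List.length_flatMap]
  ring

theorem inp_header : E.inp 0 = n ∧ E.inp 1 = E.es.length ∧ E.inp 2 = E.k ∧ E.inp 3 = N ∧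
    E.inp 4 = E.D.root := by
  simp [inp, input]

theorem inp_edge (e : ℕ) (he : e < E.es.length) :
    E.inp (5 + 2 * e) = E.es[e].1 ∧ E.inp (6 + 2 * e) = E.es[e].2 := by
  have key : ∀ i < 2, E.inp (5 + (2 * e + i)) = [(E.es[e].1 : ℕ), (E.es[e].2 : ℕ)].getD i 0 := by
    intro i hi
    have h := getD_flatMap E.es (fun e => [(e.1 : ℕ), (e.2 : ℕ)]) e i he hi
    simp only [List.length_cons, List.length_nil, List.map_const', List.sum_replicate,
      List.length_take, min_eq_left he.le, smul_eq_mul] at h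
    rw [← h, inp, input, List.append_assoc]
    refine (getD_append_right' [n, E.es.length, E.k, N, (E.D.root : ℕ)] _ 0 (2 * e + i)).trans ?_
    rw [List.getD_append, mul_comm]
    rw [List.length_flatMap]
    simp
    omega
  have h0 := key 0 (by norm_num)
  have h1 := key 1 (by norm_num)
  refine ⟨h0, ?_⟩
  rw [← show 5 + (2 * e + 1) = 6 + 2 * e by ring, h1]
  rfl

theorem inp_record (t : Fin N) (i : ℕ) (hi : i < (E.record t).length) :
    E.inp (E.chp t + i) = (E.record t).getD i 0 := by
  have h := getD_flatMap (List.finRange N) E.record t i (by simp) (by simpa using hi)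
  simp only [List.getElem_finRange, Fin.cast_mk, Fin.eta] at h
  rw [← h, inp, input, chp, prefixLength, add_assoc]
  have hl : 5 + 2 * E.es.length = ([n, E.es.length, E.k, N, (E.D.root : ℕ)] ++
      E.es.flatMap (fun e => [(e.1 : ℕ), (e.2 : ℕ)])).length := by
    simp [List.length_flatMap]
    ring
  rw [hl, getD_append_right']

theorem inp_chp (t : Fin N) : E.inp (E.chp t) = (E.ch t).length := by
  have := E.inp_record t 0 (by simp [record])
  simpa [record] using this

theorem inp_child (t : Fin N) (i : ℕ) (hi : i < (E.ch t).length) :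
    E.inp (E.chp t + 1 + i) = (E.ch t)[i] := by
  have := E.inp_record t (1 + i) (by simp [record]; omega)
  rw [← add_assoc] at this
  rw [this, record, List.getD_append _ _ _ _ (by simp; omega), add_comm 1 i, List.getD_cons_succ,
    getD_map_fin _ hi]

theorem inp_bgp (t : Fin N) : E.inp (E.bgp t) = (E.D.bag t).length := by
  have := E.inp_record t (1 + (E.ch t).length) (by simp [record]; omega)
  rw [← add_assoc] at this
  rw [bgp, this, record]
  refine (congrArg (fun j => List.getD _ j 0) ?_).trans
    ((getD_append_right' ((E.ch t).length :: (E.ch t).map Fin.val) _ 0 0).trans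
      (List.getD_cons_zero ..))
  simp
  ring

theorem inp_bag (t : Fin N) (i : ℕ) (hi : i < (E.D.bag t).length) :
    E.inp (E.bgp t + 1 + i) = (E.D.bag t)[i] := by
  have := E.inp_record t (1 + (E.ch t).length + (1 + i)) (by simp [record]; omega)
  rw [bgp, show E.chp t + 1 + (E.ch t).length + 1 + i =
    E.chp t + (1 + (E.ch t).length + (1 + i)) by ring, this, record]
  refine (congrArg (fun j => List.getD _ j 0) ?_).trans
    ((getD_append_right' ((E.ch t).length :: (E.ch t).map Fin.val) _ 0 (1 + i)).trans
      ?_)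
  · simp
    ring
  · rw [add_comm 1 i, List.getD_cons_succ, getD_map_fin _ hi]

/-! ### Sizes -/

/-- The number of states of the largest bags. -/
def R : ℕ := 16384 ^ (E.w + 1)

/-- A bound for the length of the input. -/
def L : ℕ := N * E.R

/-- A bound for all numbers in a computation. -/
def M : ℕ := 64 * (N * (E.R * E.R) + E.k)

theorem pos_N {n N : ℕ} (E : Enc n N) : 0 < N := Fin.pos E.D.root

/-- The square is at most `4 ^ (w + 1)`, and `16384 = 4096 * 4` leaves a factor `4096` to spare. -/
theorem sq_le_R : 12 * ((E.w + 1) * (E.w + 1)) ≤ E.R := by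
  have h : E.w + 1 ≤ 2 ^ (E.w + 1) := Nat.lt_two_pow_self.le
  have h2 : (E.w + 1) * (E.w + 1) ≤ 4 ^ (E.w + 1) := by
    calc _ ≤ 2 ^ (E.w + 1) * 2 ^ (E.w + 1) := Nat.mul_le_mul h h
      _ = 4 ^ (E.w + 1) := (mul_pow 2 2 _).symm
  have h3 : 12 * 4 ^ (E.w + 1) ≤ 4096 ^ (E.w + 1) * 4 ^ (E.w + 1) :=
    Nat.mul_le_mul_right _ (le_trans (by norm_num) (Nat.le_self_pow (by omega) 4096))
  rw [← mul_pow] at h3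
  rw [R]
  norm_num at h3
  omega

theorem le_R : 16384 ≤ E.R := Nat.le_self_pow (by omega) _

theorem w_le_R : E.w + 1 ≤ E.R := by
  have := E.sq_le_R
  nlinarith

theorem pow_le_R (t : Fin N) : 16384 ^ (E.D.bag t).length ≤ E.R :=
  Nat.pow_le_pow_right (by norm_num) (E.length_bag t)

/-- Every edge lies in a bag, and a bag contains at most `(w + 1) * (w + 1)` pairs. Therefore
reading the edges is affordable in a time linear in the number of nodes. -/
theorem length_es_le : E.es.length ≤ N * ((E.w + 1) * (E.w + 1)) := by
  classical
  rw [← List.length_map (f := fun e : Fin n × Fin n => s(e.1, e.2)),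
    ← List.toFinset_card_of_nodup E.es_nodup]
  have hsub : (E.es.map fun e => s(e.1, e.2)).toFinset ⊆ Finset.univ.biUnion fun t : Fin N =>
      ((E.D.bag t).toFinset ×ˢ (E.D.bag t).toFinset).image fun e => s(e.1, e.2) := by
    intro x hx
    rw [List.mem_toFinset] at hx
    induction x with
    | _ u v =>
      obtain ⟨t, h1, h2⟩ := E.D.cover_edge u v ((E.adj_iff u v).2 hx)
      simp only [Finset.mem_biUnion, Finset.mem_univ, true_and, Finset.mem_image]
      exact ⟨t, (u, v), by simp [h1, h2], rfl⟩
  refine (Finset.card_le_card hsub).trans ((Finset.card_biUnion_le_card_mul _ _ _ fun t _ =>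
    Finset.card_image_le.trans ?_).trans (le_of_eq (by rw [Finset.card_univ, Fintype.card_fin])))
  rw [Finset.card_product]
  have := (List.toFinset_card_le (E.D.bag t)).trans (E.length_bag t)
  exact Nat.mul_le_mul this this

theorem prefixLength_le (t : ℕ) (ht : t ≤ N) :
    E.prefixLength t ≤ 5 + 2 * E.es.length + t * (E.w + 5) := by
  induction t with
  | zero => simp [prefixLength]
  | succ t ih =>
    have h := E.prefixLength_succ ⟨t, ht⟩
    have h1 := E.length_ch ⟨t, ht⟩
    have h2 := E.length_bag ⟨t, ht⟩
    have h3 := ih (by omega)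
    simp only [bgp, chp] at h
    rw [add_mul]
    omega

/-- In units of `N * (w + 1) * (w + 1)`, the header takes at most `5`, the edges `2` and the records
of the nodes `5`; hence the `12` in `sq_le_R`. -/
theorem prefixLength_le_L (t : ℕ) (ht : t ≤ N) : E.prefixLength t ≤ E.L := by
  have h1 := E.prefixLength_le t ht
  have h2 := E.length_es_le
  have h3 := Nat.mul_le_mul_left N E.sq_le_R
  have h4 := E.pos_N
  have h5 : t * (E.w + 5) ≤ N * (5 * ((E.w + 1) * (E.w + 1))) :=
    Nat.mul_le_mul ht (by nlinarith)
  have h6 : N ≤ N * ((E.w + 1) * (E.w + 1)) := Nat.le_mul_of_pos_right _ (by positivity)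
  rw [L]
  nlinarith

theorem length_es_le_L : E.es.length ≤ E.L := by
  have := E.prefixLength_le_L 0 (by omega)
  simp [prefixLength] at this
  omega

theorem N_le_L : N ≤ E.L := Nat.le_mul_of_pos_right _ (by have := E.le_R; omega)

/-- Comparison of the basic quantities with the bound `M`. -/
theorem M_facts : E.M = 64 * (N * (E.R * E.R) + E.k) ∧ E.L * 16384 ≤ N * (E.R * E.R) ∧
    E.R * E.R ≤ N * (E.R * E.R) ∧ E.R * 16384 ≤ E.R * E.R ∧ 16384 ≤ E.R ∧ E.w + 1 ≤ E.R ∧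
    N ≤ E.L ∧ E.es.length ≤ E.L ∧ 0 < N ∧ E.R ≤ E.L := by
  refine ⟨rfl, ?_, Nat.le_mul_of_pos_left _ E.pos_N, Nat.mul_le_mul_left _ E.le_R, E.le_R, E.w_le_R,
    E.N_le_L, E.length_es_le_L, E.pos_N, Nat.le_mul_of_pos_left _ E.pos_N⟩
  rw [L, mul_assoc]
  exact Nat.mul_le_mul_left _ (Nat.mul_le_mul_left _ E.le_R)

theorem n_le_L : n ≤ E.L := by
  classical
  have hsub : (Finset.univ : Finset (Fin n)) ⊆ Finset.univ.biUnion fun t : Fin N =>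
      (E.D.bag t).toFinset := by
    intro v _
    obtain ⟨t, ht⟩ := E.D.cover v
    simpa using ⟨t, ht⟩
  have h := (Finset.card_le_card hsub).trans (Finset.card_biUnion_le_card_mul _ _ (E.w + 1) fun t _ =>
    (List.toFinset_card_le (E.D.bag t)).trans (E.length_bag t))
  simp only [Finset.card_univ, Fintype.card_fin] at h
  exact h.trans (Nat.mul_le_mul_left _ E.w_le_R)

theorem inp_lt (i : ℕ) : E.inp i < E.M := by
  obtain ⟨h1, h2, h3, h4, h5, h6, h7, h8, h9, h10⟩ := E.M_facts
  have h11 := E.n_le_L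
  rw [inp]
  by_cases hi : i < E.input.length
  · rw [List.getD_eq_getElem _ _ hi]
    have hm := List.getElem_mem hi
    generalize E.input[i] = x at hm
    simp only [input, record, List.mem_append, List.mem_cons, List.not_mem_nil, or_false,
      List.mem_flatMap, List.mem_map] at hm
    rcases hm with ((h | h | h | h | h) | ⟨e, -, h⟩) | ⟨t, -, (h | ⟨s, -, h⟩) | h | ⟨v, -, h⟩⟩
    · omega
    · omega
    · omega
    · omega
    · have := E.D.root.isLt; omega
    · have := e.1.isLt; have := e.2.isLt; omega
    · have := E.length_ch t; omega
    · have := s.isLt; omega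
    · have := E.length_bag t; omega
    · have := v.isLt; omega
  · rw [List.getD_eq_default _ _ (by omega)]
    omega

end Enc

open SingleExp.Expr SingleExp.Cmd

local infixl:65 " +ₑ " => Expr.op ArithOp.add
local infixl:65 " -ₑ " => Expr.op ArithOp.sub
local infixl:70 " *ₑ " => Expr.op ArithOp.mul
local infixl:70 " /ₑ " => Expr.op ArithOp.div
local infixr:60 " ;; " => Cmd.seq

/-! ### Preprocessing -/

theorem Frame.trans {rs as rs' as' : List ℕ} {s s' s'' : VState} (h : Frame rs as s s')
    (h' : Frame rs' as' s' s'') : Frame (rs ++ rs') (as ++ as') s s'' :=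
  ⟨fun x hx => by
    rw [List.mem_append, not_or] at hx
    rw [h'.reg x hx.2, h.reg x hx.1],
   fun j hj => by
    rw [List.mem_append, not_or] at hj
    rw [h'.arr j hj.2, h.arr j hj.1]⟩

/-- Arrays `1` and `2` hold the positions of the children and of the bag of every node, and register
`11` the size of the largest bag. -/
def readPointers : Cmd :=
  assign 1 (arr 0 (lit 1)) ;; assign 2 (arr 0 (lit 3)) ;; assign 3 (arr 0 (lit 2)) ;;
  assign 4 (arr 0 (lit 4)) ;; assign 11 (lit 0) ;; assign 5 (lit 5 +ₑ lit 2 *ₑ reg 1) ;;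
  forUp true 6 2 (
    store 1 (reg 6) (reg 5) ;; assign 5 (reg 5 +ₑ lit 1 +ₑ arr 0 (reg 5)) ;;
    store 2 (reg 6) (reg 5) ;; assign 11 (reg 11 +ₑ (arr 0 (reg 5) -ₑ reg 11)) ;;
    assign 5 (reg 5 +ₑ lit 1 +ₑ arr 0 (reg 5)))

namespace Enc

variable {n N : ℕ} (E : Enc n N)

/-- The parts of the state that do not change after `readPointers`. -/
structure Base (s : VState) : Prop where
  inp : s.arr 0 = E.inp
  hm : s.reg 1 = E.es.length
  hN : s.reg 2 = N
  hk : s.reg 3 = E.k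
  hroot : s.reg 4 = E.D.root
  chp : ∀ t : Fin N, s.arr 1 t = E.chp t
  bgp : ∀ t : Fin N, s.arr 2 t = E.bgp t
  le_W : ∀ t : Fin N, (E.D.bag t).length ≤ s.reg 11
  W_le : s.reg 11 ≤ E.w + 1

variable {E}

theorem Base.frame {rs as : List ℕ} {s s' : VState} (h : E.Base s) (F : Frame rs as s s')
    (hr : ∀ x ∈ [1, 2, 3, 4, 11], x ∉ rs) (ha : ∀ j ∈ [0, 1, 2], j ∉ as) : E.Base s' where
  inp := by rw [F.arr 0 (ha 0 (by simp)), h.inp]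
  hm := by rw [F.reg 1 (hr 1 (by simp)), h.hm]
  hN := by rw [F.reg 2 (hr 2 (by simp)), h.hN]
  hk := by rw [F.reg 3 (hr 3 (by simp)), h.hk]
  hroot := by rw [F.reg 4 (hr 4 (by simp)), h.hroot]
  chp t := by rw [F.arr 1 (ha 1 (by simp)), h.chp]
  bgp t := by rw [F.arr 2 (ha 2 (by simp)), h.bgp]
  le_W t := by rw [F.reg 11 (hr 11 (by simp))]; exact h.le_W t
  W_le := by rw [F.reg 11 (hr 11 (by simp))]; exact h.W_le

theorem chp_lt {n N : ℕ} (E : Enc n N) (t : Fin N) : E.chp t + 1 + (E.ch t).length ≤ E.L ∧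
    E.bgp t + 1 + (E.D.bag t).length ≤ E.L := by
  have h1 := E.prefixLength_le_L (t + 1) t.isLt
  have h2 := E.prefixLength_succ t
  simp only [bgp] at *
  omega

theorem wp_readPointers {s : VState} {Q : VState → Prop} (h0 : s.arr 0 = E.inp)
    (hQ : ∀ s', Frame readPointers.regs readPointers.arrs s s' → E.Base s' → Q s') :
    readPointers.wp E.M E.R E.L Q s := by
  obtain ⟨f1, f2, f3, f4, f5, f6, f7, f8, f9, f10⟩ := E.M_facts
  obtain ⟨-, i1, i2, i3, i4⟩ := E.inp_header
  suffices h : readPointers.wp E.M E.R E.L E.Base s from h.frame.mono fun s' hs' => hQ s' hs'.1 hs'.2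
  simp only [readPointers, wp_seq, wp_assign]
  simp [h0, i1, i2, i3, i4]
  refine ⟨by omega, by omega, by omega, by omega, by omega, by omega, ?_⟩
  -- Register `5` moves from record to record. With truncated subtraction, `x + (y - x)` is the
  -- maximum, so register `11` collects the largest size of a bag.
  refine Cmd.wp_forUp (fun t s' => s'.reg 5 = E.prefixLength t ∧
    s'.reg 11 ≤ E.w + 1 ∧ (∀ t' : Fin N, (t' : ℕ) < t →
      s'.arr 1 t' = E.chp t' ∧ s'.arr 2 t' = E.bgp t' ∧ (E.D.bag t').length ≤ s'.reg 11)) ?_ (by decide)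
    ?_ ?_ ?_
  · simpa using f7
  · simp [prefixLength]
  · intro t ht s' F ht' ⟨h5, h11, hp⟩
    simp at ht
    have a0 : s'.arr 0 = E.inp := by rw [F.arr 0 (by decide)]; simpa using h0
    have hc := E.chp_lt ⟨t, ht⟩
    have e1 := E.inp_chp ⟨t, ht⟩
    have e2 := E.inp_bgp ⟨t, ht⟩
    have e3 := E.prefixLength_succ ⟨t, ht⟩
    have e4 : E.prefixLength t = E.chp ⟨t, ht⟩ := rfl
    have e5 : E.chp ⟨t, ht⟩ + 1 + (E.ch ⟨t, ht⟩).length = E.bgp ⟨t, ht⟩ := rfl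
    rw [e4] at h5
    simp [h5, a0, ht', e1, e5, e2, e3]
    have e6 := E.length_bag ⟨t, ht⟩
    refine ⟨by omega, by omega, by omega, by omega, fun t' htt' => ?_⟩
    simp only [Function.update_apply]
    by_cases hx : (t' : ℕ) = t
    · have : t' = ⟨t, ht⟩ := Fin.ext hx
      subst this
      simpa using by omega
    · have := hp t' (by omega)
      simp [hx, this]
      omega
  · intro s' F h6 ⟨h5, h11, hp⟩
    refine ⟨?_, ?_, ?_, ?_, ?_, fun t => (hp t ?_).1, fun t => (hp t ?_).2.1, fun t => (hp t ?_).2.2, h11⟩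
    · rw [F.arr 0 (by decide)]; simpa using h0
    · rw [F.reg 1 (by decide)]; simp
    · rw [F.reg 2 (by decide)]; simp
    · rw [F.reg 3 (by decide)]; simp
    · rw [F.reg 4 (by decide)]; simp
    all_goals simp

end Enc

namespace Enc

variable {n N : ℕ} (E : Enc n N)

/-! ### Breadth-first search -/

/-- The queue of a breadth-first search after `h` steps, with the nodes that have been removed. -/
def queue : ℕ → List (Fin N)
  | 0 => [E.D.root]
  | h + 1 => queue h ++ ((queue h)[h]?.elim [] E.ch)

theorem queue_prefix {h h' : ℕ} (hh : h ≤ h') : E.queue h <+: E.queue h' := by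
  induction hh with
  | refl => exact List.prefix_rfl
  | step _ ih => exact ih.trans (List.prefix_append _ _)

theorem mem_queue (h : ℕ) (j : ℕ) (hj : j < (E.queue h).length) :
    (E.queue h)[j] = E.D.root ∨
      ∃ i, ∃ hi : i < (E.queue h).length, i < h ∧ i < j ∧ (E.queue h)[i] = E.D.par (E.queue h)[j] := by
  induction h with
  | zero =>
    left
    simp [queue] at hj ⊢
  | succ h ih =>
    by_cases hj' : j < (E.queue h).length
    · simp only [queue, List.getElem_append_left hj']
      rcases ih hj' with h1 | ⟨i, hi, h1, h2, h3⟩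
      · exact .inl h1
      · exact .inr ⟨i, by simp; omega, by omega, h2, by rw [List.getElem_append_left hi, h3]⟩
    · by_cases hh : h < (E.queue h).length
      · right
        refine ⟨h, by simp [queue]; omega, by omega, by omega, ?_⟩
        have hm : (E.queue (h + 1))[j] ∈ E.ch (E.queue h)[h] := by
          simp only [queue, List.getElem_append_right (not_lt.1 hj'), List.getElem?_eq_getElem hh,
            Option.elim_some, List.getElem_mem]
        rw [((E.mem_ch _ _).1 hm).2]
        simp only [queue, List.getElem_append_left hh]
      · simp [queue, List.getElem?_eq_none (not_lt.1 hh)] at hj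
        exact absurd hj hj'

/-- If a child of the entry number `h` were already present, then by `mem_queue` its parent would
also occur at an index smaller than `h`. -/
theorem queue_nodup (h : ℕ) : (E.queue h).Nodup := by
  induction h with
  | zero => simp [queue]
  | succ h ih =>
    by_cases hh : h < (E.queue h).length
    · simp only [queue, List.getElem?_eq_getElem hh, Option.elim_some]
      refine List.nodup_append'.2 ⟨ih, E.ch_nodup _, fun x hx hx' => ?_⟩
      obtain ⟨j, hj, rfl⟩ := List.getElem_of_mem hx
      obtain ⟨h1, h2⟩ := (E.mem_ch _ _).1 hx'
      rcases E.mem_queue h j hj with h3 | ⟨i, hi, h3, -, h4⟩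
      · exact h1 h3
      · rw [h2] at h4
        have := (ih.getElem_inj_iff).1 h4
        omega
    · simpa [queue, List.getElem?_eq_none (not_lt.1 hh)] using ih

theorem length_queue_le (h : ℕ) : (E.queue h).length ≤ N := by
  simpa using (E.queue_nodup h).length_le_card

/-- A queue that runs dry is closed under children and contains the root, hence contains all `N`
nodes. -/
theorem lt_length_queue {h : ℕ} (hN : h < N) : h < (E.queue h).length := by
  induction h with
  | zero => simp [queue]
  | succ h ih =>
    by_contra hlt
    have hle := (E.queue_prefix (show h ≤ h + 1 by omega)).length_le
    have hlen : (E.queue (h + 1)).length = h + 1 := by have := ih (by omega); omega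
    have hmem : ∀ t, t ∈ E.queue (h + 1) := by
      intro t
      have hd := RTree.desc_root (D := E.D) t
      induction hd with
      | refl => exact (E.queue_prefix (Nat.zero_le _)).subset (by simp [queue])
      | @step s hs _ ihs =>
        obtain ⟨i, hi, e⟩ := List.getElem_of_mem ihs
        have h1 : i < (E.queue i).length := by
          by_cases hih : i ≤ h
          · rcases hih.lt_or_eq with h2 | rfl
            · by_contra h3
              -- Once the next entry is missing, the queue no longer changes.
              have h4 : ∀ d, E.queue (i + d) = E.queue i := by
                intro d
                induction d with
                | zero => rfl
                | succ d ihd =>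
                  rw [← add_assoc, queue, ihd, List.getElem?_eq_none (by omega)]
                  simp
              have h5 := h4 (h + 1 - i)
              rw [show i + (h + 1 - i) = h + 1 by omega] at h5
              rw [h5] at hi
              exact h3 hi
            · exact ih (by omega)
          · omega
        have h2 : (E.queue i)[i] = E.D.par s := by
          rw [← e]
          exact (E.queue_prefix (show i ≤ h + 1 by omega)).getElem h1
        refine (E.queue_prefix (show i + 1 ≤ h + 1 by omega)).subset ?_
        rw [queue, List.getElem?_eq_getElem h1, Option.elim_some, List.mem_append, h2]
        exact .inr ((E.mem_ch _ _).2 ⟨hs, rfl⟩)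
    have := Fintype.card_le_of_surjective (fun i : Fin (E.queue (h + 1)).length =>
      (E.queue (h + 1))[i]) fun t => by
        obtain ⟨i, hi, e⟩ := List.getElem_of_mem (hmem t)
        exact ⟨⟨i, hi⟩, e⟩
    simp at this
    omega

/-- The nodes in the order of a breadth-first search. -/
def order : List (Fin N) := E.queue N

theorem length_order : E.order.length = N := by
  refine le_antisymm (E.length_queue_le N) ?_
  have h := E.pos_N
  have h1 := E.lt_length_queue (h := N - 1) (by omega)
  have h2 := (E.queue_prefix (show N - 1 ≤ N by omega)).length_le
  rw [order]
  omega

/-- The node with the number `i`. -/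
def nth (i : Fin N) : Fin N := E.order[i]'(by rw [E.length_order]; exact i.isLt)

theorem nth_injective : Function.Injective E.nth := fun i j h => by
  have := ((E.queue_nodup N).getElem_inj_iff).1 h
  exact Fin.ext this

noncomputable def numbering : Fin N ≃ Fin N :=
  Equiv.ofBijective E.nth (Finite.injective_iff_bijective.1 E.nth_injective)

/-- The number of a node. -/
noncomputable def idx (t : Fin N) : Fin N := E.numbering.symm t

@[simp] theorem nth_idx (t : Fin N) : E.nth (E.idx t) = t := E.numbering.apply_symm_apply t

@[simp] theorem idx_nth (i : Fin N) : E.idx (E.nth i) = i := E.numbering.symm_apply_apply i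

/-- This is the purpose of the search: decreasing numbers visit children before parents, and the
numbering can replace the depth in `mem_bag_top`. -/
theorem idx_par {t : Fin N} (ht : t ≠ E.D.root) : (E.idx (E.D.par t) : ℕ) < E.idx t := by
  have hl := E.length_order
  rcases E.mem_queue N (E.idx t) (by rw [← order]; omega) with h | ⟨i, hi, -, h2, h3⟩
  · exact absurd ((E.nth_idx t).symm.trans h) ht
  · have hi' : i < N := lt_of_lt_of_le hi (E.length_queue_le N)
    have h4 : E.nth ⟨i, hi'⟩ = E.D.par t := by
      refine h3.trans (congrArg _ (E.nth_idx t))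
    rw [← h4, idx_nth]
    exact h2

end Enc

/-- Array `3` holds the nodes in the order of a breadth-first search. -/
def bfs : Cmd :=
  store 3 (lit 0) (reg 4) ;; assign 7 (lit 1) ;;
  forUp true 6 2 (
    assign 8 (arr 3 (reg 6)) ;; assign 5 (arr 1 (reg 8)) ;; assign 9 (arr 0 (reg 5)) ;;
    assign 5 (reg 5 +ₑ lit 1) ;;
    forUp false 10 9 (
      store 3 (reg 7) (arr 0 (reg 5 +ₑ reg 10)) ;; assign 7 (reg 7 +ₑ lit 1)))

/-- Array `4` holds, for every vertex, the smallest number of a node whose bag contains it. -/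
def positions : Cmd :=
  forUp true 6 2 (
    assign 8 (reg 2 -ₑ lit 1 -ₑ reg 6) ;; assign 9 (arr 2 (arr 3 (reg 8))) ;;
    assign 10 (arr 0 (reg 9)) ;; assign 9 (reg 9 +ₑ lit 1) ;;
    forUp false 12 10 (store 4 (arr 0 (reg 9 +ₑ reg 12)) (reg 8)))

/-- A list is stored at the start of an array. -/
def Holds {n : ℕ} (f : ℕ → ℕ) (l : List (Fin n)) : Prop := ∀ j, ∀ hj : j < l.length, f j = l[j]

theorem Holds.append_singleton {n : ℕ} {f : ℕ → ℕ} {l : List (Fin n)} (h : Holds f l) (x : Fin n) :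
    Holds (Function.update f l.length x) (l ++ [x]) := by
  intro j hj
  rw [Function.update_apply]
  by_cases h1 : j = l.length
  · subst h1; simp
  · have h2 : j < l.length := by simp at hj; omega
    rw [if_neg h1, h j h2, List.getElem_append_left h2]

theorem mem_take_succ {α : Type*} {l : List α} {i : ℕ} (hi : i < l.length) {x : α} :
    x ∈ l.take (i + 1) ↔ x ∈ l.take i ∨ x = l[i] := by
  rw [List.take_add_one, List.getElem?_eq_getElem hi]
  simp only [Option.toList_some, List.mem_append, List.mem_singleton]

namespace Enc

variable {n N : ℕ} {E : Enc n N}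

theorem wp_bfs {s : VState} {Q : VState → Prop} (h0 : E.Base s)
    (hQ : ∀ s', Frame bfs.regs bfs.arrs s s' → (∀ i : Fin N, s'.arr 3 i = E.nth i) → Q s') :
    bfs.wp E.M E.R E.L Q s := by
  obtain ⟨f1, f2, f3, f4, f5, f6, f7, f8, f9, f10⟩ := E.M_facts
  suffices h : bfs.wp E.M E.R E.L (fun s' => ∀ i : Fin N, s'.arr 3 i = E.nth i) s from
    h.frame.mono fun s' hs' => hQ s' hs'.1 hs'.2
  simp only [bfs, wp_seq, wp_assign, wp_store]
  simp
  refine ⟨by omega, by omega, ?_⟩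
  refine Cmd.wp_forUp (fun h s' => s'.reg 7 = (E.queue h).length ∧ Holds (s'.arr 3) (E.queue h)) ?_
    (by decide) ?_ ?_ ?_
  · simpa [h0.hN] using f7
  · simp [queue, Holds, h0.hroot]
  · intro h hh s' F h6 ⟨h7, hq⟩
    simp [h0.hN] at hh
    have hl := E.lt_length_queue hh
    set t := (E.queue h)[h] with ht
    have b0 : s'.arr 0 = E.inp := by rw [F.arr 0 (by decide)]; simpa using h0.inp
    have b1 : s'.arr 1 t = E.chp t := by rw [F.arr 1 (by decide)]; simpa using h0.chp t
    have hc := E.chp_lt t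
    have hlen := E.length_ch t
    have e8 : s'.arr 3 h = t := hq h hl
    have e9 := E.inp_chp t
    simp only [wp_seq, wp_assign]
    simp [h6, e8, b1, b0, e9]
    refine ⟨by omega, ?_⟩
    have hqs : E.queue (h + 1) = E.queue h ++ (E.ch t).take (E.ch t).length := by
      rw [List.take_length, queue, List.getElem?_eq_getElem hl, Option.elim_some]
    refine Cmd.wp_forUp (fun i s'' => s''.reg 7 = (E.queue h ++ (E.ch t).take i).length ∧
      Holds (s''.arr 3) (E.queue h ++ (E.ch t).take i)) ?_ (by decide) ?_ ?_ ?_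
    · simp; omega
    · simpa [h7] using hq
    · intro i hi s'' F' h10 ⟨h7', hq'⟩
      simp at hi
      have b0' : s''.arr 0 = E.inp := by rw [F'.arr 0 (by decide)]; simpa using b0
      have b5' : s''.reg 5 = E.chp t + 1 := by rw [F'.reg 5 (by decide)]; simp
      have hlq : (E.queue h ++ (E.ch t).take i).length + 1 ≤ N := by
        have := E.length_queue_le (h + 1)
        rw [hqs] at this
        simp at this ⊢
        omega
      have h7'' : s''.reg 7 < N := by omega
      have hts : (E.ch t).take (i + 1) = (E.ch t).take i ++ [(E.ch t)[i]] := by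
        rw [List.take_add_one, List.getElem?_eq_getElem hi]; rfl
      simp only [wp_seq, wp_assign, wp_store]
      simp [h10, b0', b5', E.inp_child t i hi]
      refine ⟨by omega, by omega, ?_, ?_⟩
      · rw [h7', List.length_append, List.length_take]; omega
      · rw [hts, ← List.append_assoc, h7']
        exact hq'.append_singleton _
    · intro s'' F' h10 ⟨h7', hq'⟩
      simp at h7' hq'
      simp [hqs]
      exact ⟨h7', hq'⟩
  · intro s' F h6 ⟨h7, hq⟩ i
    have : s.reg 2 = N := h0.hN
    simp [this] at hq
    exact hq i (by have := E.length_order; rw [order] at this; omega)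

/-- The nodes are visited by decreasing number and overwrite each other, so the last one to write at
`v` is the topmost node of `v`. -/
theorem wp_positions {s : VState} {Q : VState → Prop} (h0 : E.Base s)
    (h3 : ∀ i : Fin N, s.arr 3 i = E.nth i)
    (hQ : ∀ s', Frame positions.regs positions.arrs s s' →
      (∀ v t, E.D.TopV v t → s'.arr 4 v = E.idx t) → Q s') :
    positions.wp E.M E.R E.L Q s := by
  obtain ⟨f1, f2, f3, f4, f5, f6, f7, f8, f9, f10⟩ := E.M_facts
  suffices h : positions.wp E.M E.R E.L (fun s' => ∀ v t, E.D.TopV v t → s'.arr 4 v = E.idx t) s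
    from h.frame.mono fun s' hs' => hQ s' hs'.1 hs'.2
  refine Cmd.wp_forUp (fun h s' => ∀ v t, E.D.TopV v t → N ≤ E.idx t + h → s'.arr 4 v = E.idx t) ?_
    (by decide) ?_ ?_ ?_
  · simpa [h0.hN] using f7
  · intro v t _ h
    have := (E.idx t).isLt
    omega
  · intro h hh s' F h6 hp
    rw [h0.hN] at hh
    have B := h0.frame F (by decide) (by decide)
    set i : Fin N := ⟨N - 1 - h, by omega⟩ with hi
    have e3 : s'.arr 3 (N - 1 - h) = E.nth i := by rw [F.arr 3 (by decide)]; exact h3 i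
    set t := E.nth i with ht
    have hc := E.chp_lt t
    have hlen := E.length_bag t
    have e9 := E.inp_bgp t
    simp only [wp_seq, wp_assign]
    simp [h6, B.hN, e3, B.bgp, B.inp, e9]
    refine ⟨by omega, by omega, ?_⟩
    refine Cmd.wp_forUp (fun j s'' => ∀ v t', E.D.TopV v t' →
      (N ≤ E.idx t' + h ∨ t' = t ∧ v ∈ (E.D.bag t).take j) → s''.arr 4 v = E.idx t') ?_
      (by decide) ?_ ?_ ?_
    · simp; omega
    · intro v t' h1 h2
      simpa using hp v t' h1 (by simpa using h2)
    · intro j hj s'' F' h12 hp'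
      simp at hj
      have b0 : s''.arr 0 = E.inp := by rw [F'.arr 0 (by decide)]; simpa using B.inp
      have b9 : s''.reg 9 = E.bgp t + 1 := by rw [F'.reg 9 (by decide)]; simp
      have b8 : s''.reg 8 = N - 1 - h := by rw [F'.reg 8 (by decide)]; simp
      simp only [wp_store]
      simp [h12, b0, b9, b8, E.inp_bag t j hj]
      refine ⟨by omega, fun v t' h1 h2 => ?_⟩
      rw [Function.update_apply]
      split
      · next hv =>
        have hv' : v = (E.D.bag t)[j] := Fin.ext hv
        have hd := h1.desc (hv' ▸ List.getElem_mem hj : v ∈ E.D.bag t)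
        rcases h2 with h2 | ⟨rfl, -⟩
        -- The current node would be a proper descendant of the topmost node `t'` of `v` and yet
        -- have a smaller number.
        · exfalso
          have mono : ∀ {t s}, E.D.Desc t s → (E.idx t : ℕ) ≤ E.idx s := by
            intro t s h
            induction h with
            | refl => exact le_rfl
            | step hs _ ih => exact ih.trans (E.idx_par hs).le
          have := mono hd
          rw [ht, idx_nth, hi] at this
          simp at this
          omega
        · rw [ht, idx_nth]
      · next hv =>
        refine hp' v t' h1 (h2.imp_right fun h => ⟨h.1, ?_⟩)
        refine ((mem_take_succ hj).1 h.2).resolve_right fun e => hv (by rw [e])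
    · intro s'' F' h12 hp' v t' h1 h2
      simp at hp' ⊢
      refine hp' v t' h1 ?_
      by_cases h3 : N ≤ E.idx t' + h
      · exact .inl h3
      · right
        have : E.idx t' = i := Fin.ext (by simp [hi]; omega)
        have : t' = t := by rw [ht, ← this, nth_idx]
        exact ⟨this, this ▸ h1.1⟩
  · intro s' F h6 hp v t h1
    rw [h0.hN] at hp
    exact hp v t h1 (by omega)

end Enc

/-! ### Adjacency queries in time proportional to the size of a bag -/

/-- Every edge is stored at the end whose position is larger. -/
def buckets : Cmd :=
  forUp true 6 1 (
    assign 8 (arr 0 (lit 5 +ₑ lit 2 *ₑ reg 6)) ;; assign 9 (arr 0 (lit 6 +ₑ lit 2 *ₑ reg 6)) ;;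
    ite (arr 4 (reg 9) -ₑ arr 4 (reg 8))
      (assign 10 (reg 8) ;; assign 8 (reg 9) ;; assign 9 (reg 10)) skip ;;
    store 5 (reg 11 *ₑ reg 8 +ₑ arr 6 (reg 8)) (reg 9) ;;
    store 6 (reg 8) (arr 6 (reg 8) +ₑ lit 1))

/-- An expression that vanishes if and only if `a` and `b` are equal. -/
def ne (a b : Expr) : Expr := (a -ₑ b) +ₑ (b -ₑ a)

@[simp] theorem eval_ne {s : VState} {a b : Expr} :
    (ne a b).eval s = (a.eval s - b.eval s) + (b.eval s - a.eval s) := rfl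

@[simp] theorem safe_ne {M : ℕ} {s : VState} {a b : Expr} : (ne a b).Safe M s ↔
    (a.Safe M s ∧ b.Safe M s) ∧ (b.Safe M s ∧ a.Safe M s) ∧
      (a.eval s - b.eval s) + (b.eval s - a.eval s) < M := Iff.rfl

/-- Register `r` becomes `1` if the vertex in register `b` is stored at the one in register `a`. -/
def halfQuery (a b r : ℕ) : Cmd :=
  assign 50 (arr 6 (reg a)) ;;
  forUp false 51 50 (
    ite (ne (arr 5 (reg 11 *ₑ reg a +ₑ reg 51)) (reg b)) skip (assign r (lit 1)))

/-- Register `r` becomes `1` if the vertices in the registers `a` and `b` are adjacent, and `0`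
otherwise. -/
def query (a b r : ℕ) : Cmd := assign r (lit 0) ;; halfQuery a b r ;; halfQuery b a r

namespace Enc

variable {n N : ℕ} (E : Enc n N)

theorem exists_topV (v : Fin n) : ∃ t, E.D.TopV v t := by
  obtain ⟨s, hs⟩ := E.D.cover v
  obtain ⟨t, ht, -⟩ := RTree.exists_topV hs
  exact ⟨t, ht⟩

noncomputable def top (v : Fin n) : Fin N := (E.exists_topV v).choose

theorem topV_top (v : Fin n) : E.D.TopV v (E.top v) := (E.exists_topV v).choose_spec

/-- An edge, oriented so that the position of the first end is not smaller. -/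
noncomputable def arc (e : Fin n × Fin n) : Fin n × Fin n :=
  if E.idx (E.top e.1) < E.idx (E.top e.2) then (e.2, e.1) else e

theorem sym2_arc (e : Fin n × Fin n) : s((E.arc e).1, (E.arc e).2) = s(e.1, e.2) := by
  rw [arc]
  split
  · exact Sym2.eq_swap
  · rfl

theorem idx_arc (e : Fin n × Fin n) :
    (E.idx (E.top (E.arc e).2) : ℕ) ≤ E.idx (E.top (E.arc e).1) := by
  rw [arc]
  split
  · next h => exact le_of_lt h
  · next h => exact not_lt.1 h

/-- What the first `e` edges store at the vertex `u`. -/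
noncomputable def out (e : ℕ) (u : Fin n) : List (Fin n) :=
  (((E.es.take e).map E.arc).filter fun p => p.1 = u).map Prod.snd

theorem mem_out {e : ℕ} {u v : Fin n} :
    v ∈ E.out e u ↔ (u, v) ∈ (E.es.take e).map E.arc := by
  simp [out]

theorem out_succ {e : ℕ} (he : e < E.es.length) (u : Fin n) :
    E.out (e + 1) u = E.out e u ++ if (E.arc E.es[e]).1 = u then [(E.arc E.es[e]).2] else [] := by
  rw [out, List.take_add_one, List.getElem?_eq_getElem he]
  simp only [Option.toList_some, List.map_append, List.map_cons, List.map_nil, List.filter_append,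
    List.filter_singleton, out]
  by_cases h : (E.arc E.es[e]).1 = u <;> simp [h]

theorem out_nodup (e : ℕ) (u : Fin n) : (E.out e u).Nodup := by
  have h : ((E.es.take e).map E.arc).Nodup := by
    refine List.Nodup.of_map (fun p : Fin n × Fin n => s(p.1, p.2)) ?_
    have := E.es_nodup.sublist ((List.take_sublist e E.es).map _)
    rw [List.map_map]
    simpa only [Function.comp_def, sym2_arc] using this
  refine List.Nodup.map_on (fun p hp q hq hpq => ?_) (h.filter _)
  simp only [List.mem_filter, decide_eq_true_eq] at hp hq
  exact Prod.ext (hp.2.trans hq.2.symm) hpq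

theorem adj_of_mem_out {e : ℕ} {u v : Fin n} (h : v ∈ E.out e u) : E.G.Adj u v := by
  rw [mem_out, List.mem_map] at h
  obtain ⟨p, hp, hpe⟩ := h
  have := E.sym2_arc p
  rw [hpe] at this
  rw [E.adj_iff, this]
  exact List.mem_map_of_mem (List.mem_of_mem_take hp)

/-- A neighbour stored at `u` does not have a later topmost node than `u`, so by `mem_bag_top` it
belongs to the bag at the topmost node of `u`. Buckets whose capacity is the size of the largest bag
therefore suffice. -/
theorem length_out_le (e : ℕ) (u : Fin n) : (E.out e u).length ≤ (E.D.bag (E.top u)).length := by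
  refine (List.Nodup.subperm (E.out_nodup e u) fun v hv => ?_).length_le
  obtain ⟨s, h1, h2⟩ := E.D.cover_edge u v (E.adj_of_mem_out hv)
  rw [mem_out, List.mem_map] at hv
  obtain ⟨p, -, hpe⟩ := hv
  have := E.idx_arc p
  rw [hpe] at this
  exact RTree.mem_bag_top (ι := fun t => (E.idx t : ℕ)) (fun t ht => E.idx_par ht) h1 h2
    (E.topV_top u) (E.topV_top v) this

theorem adj_iff_out (u v : Fin n) :
    E.G.Adj u v ↔ v ∈ E.out E.es.length u ∨ u ∈ E.out E.es.length v := by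
  refine ⟨fun h => ?_, fun h => h.elim E.adj_of_mem_out fun h => (E.adj_of_mem_out h).symm⟩
  rw [E.adj_iff, List.mem_map] at h
  obtain ⟨p, hp, hpe⟩ := h
  rw [← E.sym2_arc, Sym2.eq_iff] at hpe
  simp only [mem_out, List.take_length, List.mem_map]
  rcases hpe with ⟨rfl, rfl⟩ | ⟨rfl, rfl⟩
  · exact .inl ⟨p, hp, rfl⟩
  · exact .inr ⟨p, hp, rfl⟩

/-- The first `e` edges are stored. -/
def Buckets (e : ℕ) (s : VState) : Prop := ∀ u : Fin n, s.arr 6 u = (E.out e u).length ∧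
  ∀ i, ∀ hi : i < (E.out e u).length, s.arr 5 (s.reg 11 * u + i) = (E.out e u)[i]

variable {E}

theorem Base.mul_add_lt {s : VState} (h : E.Base s) (u : Fin n) {i : ℕ} (hi : i ≤ s.reg 11) :
    s.reg 11 * u + i < E.M := by
  obtain ⟨f1, f2, f3, f4, f5, f6, f7, f8, f9, f10⟩ := E.M_facts
  have h1 := h.W_le
  have h2 := E.n_le_L
  have h3 : s.reg 11 * (u + 1) ≤ E.R * E.L := Nat.mul_le_mul (by omega) (by omega)
  have h4 : E.R * E.L = N * (E.R * E.R) := by rw [L]; ring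
  rw [mul_add] at h3
  omega

theorem Base.length_out_le {s : VState} (h : E.Base s) (e : ℕ) (u : Fin n) :
    (E.out e u).length ≤ s.reg 11 := (E.length_out_le e u).trans (h.le_W _)

theorem Buckets.succ {e : ℕ} {s s' : VState} (h0 : E.Base s) (h : E.Buckets e s)
    (he : e < E.es.length) (h11 : s'.reg 11 = s.reg 11)
    (h5 : s'.arr 5 = Function.update (s.arr 5) (s.reg 11 * (E.arc E.es[e]).1 +
      (E.out e (E.arc E.es[e]).1).length) (E.arc E.es[e]).2)
    (h6 : s'.arr 6 = Function.update (s.arr 6) (E.arc E.es[e]).1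
      ((E.out e (E.arc E.es[e]).1).length + 1)) : E.Buckets (e + 1) s' := by
  intro u
  have hs := E.out_succ he
  have hl := h0.length_out_le (e + 1)
  set p := E.arc E.es[e] with hp
  have hlp : (E.out e p.1).length < s.reg 11 := by
    have := hl p.1
    rw [hs] at this
    simpa using this
  rw [h5, h6, h11]
  by_cases hu : p.1 = u
  · subst hu
    rw [hs, if_pos rfl]
    refine ⟨by simp, fun i hi => ?_⟩
    simp only [Function.update_apply, add_right_inj]
    by_cases h1 : i = (E.out e p.1).length
    · subst h1; simp
    · have h2 : i < (E.out e p.1).length := by simp at hi; omega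
      rw [if_neg h1, (h p.1).2 i h2, List.getElem_append_left h2]
  · have hu' : ¬ (u : ℕ) = p.1 := fun h => hu (Fin.ext h.symm)
    have e1 : E.out (e + 1) u = E.out e u := by rw [hs, if_neg hu, List.append_nil]
    rw [e1, Function.update_of_ne hu']
    refine ⟨(h u).1, fun i hi => ?_⟩
    rw [Function.update_of_ne, (h u).2 i hi]
    intro h1
    have h2 := h0.length_out_le e u
    -- Division by the capacity recovers the owner of a cell. This needs that both offsets are below
    -- the capacity, that is, that there was still room for the new entry.
    have h3 := congrArg (· / s.reg 11) h1
    rw [Nat.mul_add_div (by omega), Nat.mul_add_div (by omega), Nat.div_eq_of_lt (by omega),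
      Nat.div_eq_of_lt hlp] at h3
    exact hu' (by simpa using h3)

theorem wp_buckets {s : VState} {Q : VState → Prop} (h0 : E.Base s)
    (h4 : ∀ v t, E.D.TopV v t → s.arr 4 v = E.idx t) (h6 : ∀ i, s.arr 6 i = 0)
    (hQ : ∀ s', Frame buckets.regs buckets.arrs s s' → E.Buckets E.es.length s' → Q s') :
    buckets.wp E.M E.R E.L Q s := by
  obtain ⟨f1, f2, f3, f4, f5, f6, f7, f8, f9, f10⟩ := E.M_facts
  suffices h : buckets.wp E.M E.R E.L (E.Buckets E.es.length) s
    from h.frame.mono fun s' hs' => hQ s' hs'.1 hs'.2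
  refine Cmd.wp_forUp (fun e s' => E.Buckets e s') ?_ (by decide) ?_ ?_ ?_
  · simpa [h0.hm] using f8
  · intro u
    simp [out, h6]
  · intro e he s' F hr6 hI
    rw [h0.hm] at he
    have B := h0.frame F (by decide) (by decide)
    obtain ⟨e1, e2⟩ := E.inp_edge e he
    set p := E.es[e] with hp
    have a4 : ∀ v : Fin n, s'.arr 4 v = E.idx (E.top v) := fun v => by
      rw [F.arr 4 (by decide)]; exact h4 _ _ (E.topV_top v)
    have key : ∀ a : Fin n × Fin n, E.arc p = a →
        s'.reg 11 * a.1 + (E.out e a.1).length < E.M ∧ s'.reg 11 * a.1 < E.M ∧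
          (E.out e a.1).length + 1 < E.M := by
      intro a _
      have h1 := B.mul_add_lt a.1 (B.length_out_le e a.1)
      have h2 := B.length_out_le e a.1
      have h3 := B.W_le
      exact ⟨h1, by omega, by omega⟩
    simp only [wp_seq, wp_assign, wp_ite, wp_skip, wp_store]
    simp [hr6, B.inp, e1, e2, a4]
    refine ⟨by omega, by omega, fun h => ?_, fun h => ?_⟩
    · have ha : E.arc p = (p.2, p.1) := by rw [arc, if_pos (Fin.lt_def.2 (by omega))]
      have := key _ ha
      simp at this
      simp [(hI p.2).1]
      refine ⟨by omega, by omega, ?_⟩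
      exact hI.succ B he rfl (by simp [← hp, ha]) (by simp [← hp, ha])
    · have ha : E.arc p = p := by rw [arc, if_neg (fun h' => by have := Fin.lt_def.1 h'; omega)]
      have := key _ ha
      simp [(hI p.1).1]
      refine ⟨by omega, by omega, ?_⟩
      exact hI.succ B he rfl (by simp [← hp, ha]) (by simp [← hp, ha])
  · intro s' F h6 hI
    rwa [h0.hm] at hI

/-- The state after the preprocessing. -/
structure Ready (E : Enc n N) (s : VState) : Prop extends E.Base s where
  nth : ∀ i : Fin N, s.arr 3 i = E.nth i
  buckets : E.Buckets E.es.length s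

theorem Ready.frame {rs as : List ℕ} {s s' : VState} (h : E.Ready s) (F : Frame rs as s s')
    (hr : ∀ x ∈ [1, 2, 3, 4, 11], x ∉ rs) (ha : ∀ j ∈ [0, 1, 2, 3, 5, 6], j ∉ as) : E.Ready s' where
  toBase := h.toBase.frame F hr fun j hj => ha j (by simp at hj ⊢; omega)
  nth i := by rw [F.arr 3 (ha 3 (by simp)), h.nth]
  buckets u := by
    rw [F.arr 5 (ha 5 (by simp)), F.arr 6 (ha 6 (by simp)), F.reg 11 (hr 11 (by simp))]
    exact h.buckets u

def preprocess : Cmd := readPointers ;; bfs ;; positions ;; SingleExp.buckets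

theorem wp_preprocess {s : VState} {Q : VState → Prop} (h0 : s.arr 0 = E.inp)
    (h6 : ∀ i, s.arr 6 i = 0)
    (hQ : ∀ s', Frame preprocess.regs preprocess.arrs s s' → E.Ready s' → Q s') :
    preprocess.wp E.M E.R E.L Q s := by
  suffices h : preprocess.wp E.M E.R E.L E.Ready s
    from h.frame.mono fun s' hs' => hQ s' hs'.1 hs'.2
  simp only [preprocess, wp_seq]
  refine wp_readPointers h0 fun s1 F1 B1 => wp_bfs B1 fun s2 F2 h3 => ?_
  have B2 := B1.frame F2 (by decide) (by decide)
  refine wp_positions B2 h3 fun s3 F3 h4 => ?_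
  have B3 := B2.frame F3 (by decide) (by decide)
  refine wp_buckets B3 h4 (fun i => ?_) fun s4 F4 h5 => ?_
  · rw [F3.arr 6 (by decide), F2.arr 6 (by decide), F1.arr 6 (by decide), h6]
  · have B4 := B3.frame F4 (by decide) (by decide)
    refine ⟨B4, fun i => ?_, h5⟩
    rw [F4.arr 3 (by decide), F3.arr 3 (by decide), h3]

theorem wp_halfQuery {a b r : ℕ} (har : a ≠ r) (hbr : b ≠ r) (ha : a < 50) (hb : b < 50)
    (hr : r < 50) (hr11 : r ≠ 11) {s : VState} {Q : VState → Prop} (h : E.Ready s) {u v : Fin n}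
    (hu : s.reg a = u) (hv : s.reg b = v)
    (hQ : ∀ s', Frame [50, 51, r] [] s s' →
      s'.reg r = (if v ∈ E.out E.es.length u then 1 else s.reg r) → Q s') :
    (halfQuery a b r).wp E.M E.R E.L Q s := by
  obtain ⟨f1, f2, f3, f4, f5, f6, f7, f8, f9, f10⟩ := E.M_facts
  suffices h : (halfQuery a b r).wp E.M E.R E.L
      (fun s' => s'.reg r = (if v ∈ E.out E.es.length u then 1 else s.reg r)) s from
    h.frame.mono fun s' hs' => hQ s' ⟨fun x hx => hs'.1.reg x (by
      simpa [halfQuery, Cmd.regs] using hx), fun j hj => hs'.1.arr j (by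
      simp [halfQuery, Cmd.arrs])⟩ hs'.2
  have hl := h.length_out_le E.es.length u
  have hW := h.W_le
  have hB := h.buckets u
  simp only [halfQuery, wp_seq, wp_assign]
  simp [hu, hB.1]
  refine Cmd.wp_forUp (fun i s' => s'.reg r = if v ∈ (E.out E.es.length u).take i then 1
    else s.reg r) ?_ ?_ ?_ ?_ ?_
  · simp; omega
  · simp [Cmd.regs]; omega
  · simp [show r ≠ 50 by omega, show r ≠ 51 by omega]
  · intro i hi s' F h51 hI
    simp at hi
    have F' : ∀ x, x ≠ 50 → x ≠ 51 → x ≠ r → s'.reg x = s.reg x := fun x h1 h2 h3 => by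
      rw [F.reg x (by simp [Cmd.regs]; omega)]
      simp [h1]
    have a5 : s'.arr 5 = s.arr 5 := by rw [F.arr 5 (by simp [Cmd.arrs])]; simp
    have h1 := h.mul_add_lt u (i := i) (by omega)
    simp only [wp_assign, wp_ite, wp_skip]
    have e11 : s'.reg 11 = s.reg 11 := F' 11 (by omega) (by omega) hr11.symm
    have ea : s'.reg a = u := by rw [F' a (by omega) (by omega) har, hu]
    have eb : s'.reg b = v := by rw [F' b (by omega) (by omega) hbr, hv]
    set o := (E.out E.es.length u)[i] with ho
    have e5 : s'.arr 5 (s.reg 11 * u + i) = o := by rw [a5]; exact hB.2 i hi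
    have hn := E.n_le_L
    have hmem : v ∈ (E.out E.es.length u).take (i + 1) ↔
      v ∈ (E.out E.es.length u).take i ∨ v = o := mem_take_succ hi
    have hr51 : r ≠ 51 := by omega
    simp [e11, ea, eb, h51, e5, hmem, hr51]
    refine ⟨by omega, fun h => ?_, fun h h' => ?_⟩
    · rw [hI]
      have : v ≠ o := by rintro rfl; omega
      simp [this]
    · have : v = o := Fin.ext (by omega)
      simp [this]
      omega
  · intro s' F h51 hI
    simpa [show r ≠ 50 by omega] using hI

theorem wp_query {a b r : ℕ} (har : a ≠ r) (hbr : b ≠ r) (ha : a < 50) (hb : b < 50)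
    (hr : r < 50) (hr11 : 11 < r) {s : VState} {Q : VState → Prop} (h : E.Ready s) {u v : Fin n}
    (hu : s.reg a = u) (hv : s.reg b = v)
    (hQ : ∀ s', Frame [50, 51, r] [] s s' →
      (s'.reg r = 0 ∧ ¬ E.G.Adj u v ∨ s'.reg r = 1 ∧ E.G.Adj u v) → Q s') :
    (query a b r).wp E.M E.R E.L Q s := by
  obtain ⟨f1, f2, f3, f4, f5, f6, f7, f8, f9, f10⟩ := E.M_facts
  simp only [query, wp_seq, wp_assign]
  refine ⟨by simp; omega, ?_⟩
  have F0 : Frame [50, 51, r] [] s (s.set r ((lit 0).eval s)) :=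
    ⟨fun x hx => by simp at hx; simp [hx], fun _ _ => rfl⟩
  have sub : ∀ x ∈ [1, 2, 3, 4, 11], x ∉ [50, 51, r] := fun x hx => by simp at hx ⊢; omega
  have R0 := h.frame F0 sub (by simp)
  refine wp_halfQuery har hbr ha hb hr (by omega) R0 (u := u) (v := v) (by simp [har, hu])
    (by simp [hbr, hv]) fun s1 F1 h1 => ?_
  have R1 := R0.frame F1 sub (by simp)
  refine wp_halfQuery hbr har hb ha hr (by omega) R1 (u := v) (v := u) ?_ ?_ fun s2 F2 h2 => ?_
  · rw [F1.reg b (by simp; omega)]; simp [hbr, hv]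
  · rw [F1.reg a (by simp; omega)]; simp [har, hu]
  · refine hQ s2 ⟨fun x hx => ?_, fun j hj => ?_⟩ ?_
    · rw [F2.reg x hx, F1.reg x hx, F0.reg x hx]
    · rw [F2.arr j hj, F1.arr j hj, F0.arr j hj]
    · rw [h2, h1, E.adj_iff_out]
      by_cases hx : u ∈ E.out E.es.length v <;> by_cases hy : v ∈ E.out E.es.length u <;>
        simp [hx, hy]

end Enc

/-! ### Loops over a bag -/

/-- A loop with the counter `i`, in which register `x` runs through the bag that stands in the input
from the position in register `bp` on and whose size is in register `len`. -/
def forBag (i x bp len : ℕ) (body : Cmd) : Cmd :=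
  forUp false i len (assign x (arr 0 (reg bp +ₑ reg i)) ;; body)

/-- The remainder of `e` modulo `q`. -/
def rem (e : Expr) (q : ℕ) : Expr := e -ₑ e /ₑ lit q *ₑ lit q

@[simp] theorem eval_rem {s : VState} {e : Expr} {q : ℕ} : (rem e q).eval s = e.eval s % q := by
  simp only [rem, Expr.eval, ArithOp.eval]
  exact (Nat.sub_eq_iff_eq_add (Nat.div_mul_le_self _ _)).2 (by rw [Nat.mul_comm, Nat.mod_add_div])

theorem safe_rem {M : ℕ} {s : VState} {e : Expr} {q : ℕ} (he : e.Safe M s) (hM : e.eval s < M)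
    (hq : q < M) : (rem e q).Safe M s :=
  ⟨he, ⟨⟨he, hq⟩, hq, (Nat.div_mul_le_self _ _).trans_lt hM⟩⟩

theorem Cmd.wp_ite_iff {M R L : ℕ} {Q : VState → Prop} {s : VState} {e : Expr} {c c' : Cmd}
    {p : Prop} (hp : e.eval s ≠ 0 ↔ p) (he : e.Safe M s) (h : p → c.wp M R L Q s)
    (h' : ¬ p → c'.wp M R L Q s) : (ite e c c').wp M R L Q s :=
  wp_ite.2 ⟨he, fun x => h (hp.1 x), fun x => h' fun y => hp.2 y x⟩

namespace Enc

variable {n N : ℕ} {E : Enc n N}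

/-- The invariant is indexed by the part of the bag already visited. By `hset` it does not depend on
the counter and on the register for the current vertex, which the loop itself overwrites. -/
theorem wp_forBag {i x bp len : ℕ} {body : Cmd} {t : Fin N} {s : VState} {Q : VState → Prop}
    (I : List (Fin n) → VState → Prop) (hin : s.arr 0 = E.inp) (hbp : s.reg bp = E.bgp t + 1)
    (hlen : s.reg len = (E.D.bag t).length) (hi : i ∉ x :: body.regs)
    (hbp' : bp ∉ i :: x :: body.regs) (ha : 0 ∉ body.arrs)
    (hset : ∀ l s r v, r = i ∨ r = x → I l s → I l (s.set r v)) (h0 : I [] s)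
    (hI : ∀ l (u : Fin n) l', E.D.bag t = l ++ u :: l' → ∀ s', Frame (i :: x :: body.regs) body.arrs s s' →
      s'.reg x = u → I l s' → body.wp E.M E.R E.L (I (l ++ [u])) s')
    (hQ : ∀ s', Frame (i :: x :: body.regs) body.arrs s s' → I (E.D.bag t) s' → Q s') :
    (forBag i x bp len body).wp E.M E.R E.L Q s := by
  obtain ⟨f1, f2, f3, f4, f5, f6, f7, f8, f9, f10⟩ := E.M_facts
  have hl := E.length_bag t
  have hc := E.chp_lt t
  refine Cmd.wp_forUp (fun k s' => I ((E.D.bag t).take k) s') (by simp; omega) hi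
    (hset _ _ _ _ (.inl rfl) h0) (fun k hk s' F hk' hI' => ?_) (fun s' F _ hI' => hQ s' F ?_)
  · rw [hlen] at hk
    have F' : Frame (i :: x :: body.regs) body.arrs s s' := F
    have e0 : s'.arr 0 = E.inp := by rw [F'.arr 0 ha, hin]
    have e1 : s'.reg bp = E.bgp t + 1 := by rw [F'.reg bp hbp', hbp]
    simp only [wp_seq, wp_assign]
    refine ⟨by simp [e1, hk']; omega, ?_⟩
    have e2 : (arr 0 (reg bp +ₑ reg i)).eval s' = (E.D.bag t)[k] := by
      simp [e0, e1, hk', E.inp_bag t k hk]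
    rw [e2]
    have hx : ((s'.set x (E.D.bag t)[k])).reg x = (E.D.bag t)[k] := by simp
    have hsplit : E.D.bag t = (E.D.bag t).take k ++ (E.D.bag t)[k] :: (E.D.bag t).drop (k + 1) := by
      simp
    refine (hI _ _ _ hsplit (s'.set x (E.D.bag t)[k]) ⟨fun r hr => ?_, F'.arr⟩ hx (hset _ _ _ _ (.inr rfl) hI')).mono
      fun s'' h => hset _ _ _ _ (.inl rfl) ?_
    · have hr' := hr
      simp only [List.mem_cons, not_or] at hr'
      rw [VState.set_reg, if_neg hr'.2.1, F'.reg r hr]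
    · rw [List.take_add_one, List.getElem?_eq_getElem hk]
      exact h
  · rwa [hlen, List.take_length] at hI'

theorem code_lt (t : Fin N) {σ : Fin n → ℕ} (hσ : ∀ u, σ u < 16384) :
    E.D.code t σ < 16384 ^ (E.D.bag t).length := ofDigits_map_lt (by norm_num) fun u _ => hσ u

end Enc

/-! ### States of a bag -/

/-- The digits of the number in register `code` are written into array `j`, at the vertices of the
bag; there, arrays `12` and `14` are filled with `m` and `0`. -/
def decode (j m bp len code : ℕ) : Cmd :=
  assign 22 (reg code) ;;
  forBag 23 24 bp len (
    store j (reg 24) (rem (reg 22) 16384) ;; store 12 (reg 24) (lit m) ;;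
    store 14 (reg 24) (lit 0) ;; assign 22 (reg 22 /ₑ lit 16384))

/-- The table from register `58` on becomes that of a node without children. -/
def initTable : Cmd :=
  forUp false 66 57 (
    assign 22 (reg 66) ;; assign 70 (lit 1) ;;
    forBag 23 24 55 56 (
      ite (rem (reg 22) 16384) (ite (rem (reg 22) 16384 -ₑ lit 5) (assign 70 (lit 0)) skip)
        (assign 70 (lit 0)) ;;
      assign 22 (reg 22 /ₑ lit 16384)) ;;
    ite (reg 70) (store 10 (reg 58 +ₑ reg 66) (lit 1)) skip)

namespace Enc

variable {n N : ℕ} {E : Enc n N}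

theorem wp_decode {j m bp len code : ℕ} (hj : j ≠ 0) (hj' : j ≠ 12) (hj'' : j ≠ 14) (hm : m < 2)
    (hbp : 24 < bp) (hlen : 24 < len) (t : Fin N) (σ : Fin n → ℕ) (hσ : ∀ u, σ u < 16384)
    {s : VState} {Q : VState → Prop}
    (hin : s.arr 0 = E.inp) (h1 : s.reg bp = E.bgp t + 1) (h2 : s.reg len = (E.D.bag t).length)
    (h3 : s.reg code = E.D.code t σ)
    (hQ : ∀ s', Frame [22, 23, 24] [j, 12, 14] s s' →
      (∀ u ∈ E.D.bag t, s'.arr j u = σ u ∧ s'.arr 12 u = m ∧ s'.arr 14 u = 0) →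
      (∀ u : Fin n, u ∉ E.D.bag t → s'.arr 12 u = s.arr 12 u ∧ s'.arr 14 u = s.arr 14 u) → Q s') :
    (decode j m bp len code).wp E.M E.R E.L Q s := by
  obtain ⟨f1, f2, f3, f4, f5, f6, f7, f8, f9, f10⟩ := E.M_facts
  have hn := E.n_le_L
  have hp := E.pow_le_R t
  simp only [decode, wp_seq, wp_assign]
  refine ⟨trivial, ?_⟩
  refine wp_forBag (t := t) (fun l s' => (∀ r, E.D.bag t = l ++ r →
    s'.reg 22 = Nat.ofDigits 16384 (r.map σ)) ∧
      (∀ u ∈ l, s'.arr j u = σ u ∧ s'.arr 12 u = m ∧ s'.arr 14 u = 0) ∧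
      (∀ u : Fin n, u ∉ l → s'.arr 12 u = s.arr 12 u ∧ s'.arr 14 u = s.arr 14 u)) (by simpa using hin)
    (by simp [h1]; omega) (by simp [h2]; omega) (by simp [Cmd.regs])
    (by simp [Cmd.regs]; omega) (by simp [Cmd.arrs]; omega) ?_ ?_ ?_ ?_
  · rintro l s r v (rfl | rfl) h <;> simpa using h
  · refine ⟨?_, by simp, by simp⟩
    rintro r rfl'
    simp at rfl'
    simp [h3, RTree.code, rfl']
  · intro l u l' hl s' F hu ⟨hy, ha, hb⟩
    have h22 := hy _ hl
    rw [List.map_cons, Nat.ofDigits_cons] at h22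
    have hb22 : s'.reg 22 < E.M := by
      rw [hy _ hl]
      have : Nat.ofDigits 16384 ((u :: l').map σ) < 16384 ^ (u :: l').length :=
        ofDigits_map_lt (by norm_num) fun u _ => hσ u
      have h' : 16384 ^ (u :: l').length ≤ 16384 ^ (E.D.bag t).length :=
        Nat.pow_le_pow_right (by norm_num) (by rw [hl]; simp)
      omega
    have hmod : s'.reg 22 % 16384 = σ u := by
      rw [h22]
      have := hσ u
      omega
    have hdiv : s'.reg 22 / 16384 = Nat.ofDigits 16384 (l'.map σ) := by
      rw [h22]
      have := hσ u
      omega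
    simp only [wp_seq, wp_assign, wp_store]
    refine ⟨⟨trivial, safe_rem trivial hb22 (by omega)⟩, ⟨trivial, by simp; omega⟩,
      ⟨trivial, by simp; omega⟩, ⟨trivial, by simp; omega⟩, ?_, ?_, ?_⟩
    · intro r hr
      rw [hl, List.append_assoc, List.append_cancel_left_eq, List.singleton_append,
        List.cons.injEq] at hr
      simp [hdiv, hr.2]
    · intro x hx
      by_cases hxu : x = u
      · subst hxu
        simp [hu, hmod, hj', hj'', hj'.symm, hj''.symm]
      · have hxu' : (x : ℕ) ≠ u := fun h => hxu (Fin.ext h)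
        have hx' : x ∈ l := by simpa [hxu] using hx
        simpa [hu, hj', hj'', hj'.symm, hj''.symm, Function.update_of_ne hxu'] using ha x hx'
    · intro x hx
      simp only [List.mem_append, List.mem_singleton, not_or] at hx
      have hxu' : (x : ℕ) ≠ u := fun h => hx.2 (Fin.ext h)
      simpa [hu, hj', hj'', hj'.symm, hj''.symm, Function.update_of_ne hxu'] using hb x hx.1
  · intro s' F ⟨hy, ha, hb⟩
    refine hQ s' ⟨fun x hx => ?_, fun x hx => ?_⟩ ha hb
    · rw [F.reg x (by simp [Cmd.regs] at hx ⊢; omega)]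
      simp at hx
      simp [hx]
    · rw [F.arr x (by simpa [Cmd.arrs] using hx)]
      simp

theorem wp_initTable {t : Fin N} {s : VState} {Q : VState → Prop} (hin : s.arr 0 = E.inp)
    (h1 : s.reg 55 = E.bgp t + 1) (h2 : s.reg 56 = (E.D.bag t).length)
    (h3 : s.reg 57 = 16384 ^ (E.D.bag t).length) (h4 : s.reg 58 + E.R < E.M)
    (h5 : ∀ x, s.reg 58 ≤ x → s.arr 10 x = 0)
    (hQ : ∀ s', Frame initTable.regs initTable.arrs s s' →
      (∀ x, x < s.reg 58 ∨ s.reg 58 + s.reg 57 ≤ x → s'.arr 10 x = s.arr 10 x) →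
      E.D.Table E.k t ∅ (fun a => s'.arr 10 (s.reg 58 + a)) → Q s') :
    initTable.wp E.M E.R E.L Q s := by
  classical
  obtain ⟨f1, f2, f3, f4, f5, f6, f7, f8, f9, f10⟩ := E.M_facts
  have hp := E.pow_le_R t
  refine Cmd.wp_forUp (fun a s' =>
    (∀ x, x < s.reg 58 ∨ s.reg 58 + a ≤ x → s'.arr 10 x = s.arr 10 x) ∧
    ∀ σ : Fin n → ℕ, (∀ u, σ u < 16384) → E.D.code t σ < a → s'.arr 10 (s.reg 58 + E.D.code t σ) =
      if ∀ u ∈ E.D.bag t, 1 ≤ σ u ∧ σ u ≤ 5 then 1 else 0) ?_ (by decide) ?_ ?_ ?_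
  · simpa [h3] using hp
  · exact ⟨fun x _ => rfl, fun σ _ h => by omega⟩
  · intro a ha s1 F h66 ⟨hI1, hI2⟩
    rw [h3] at ha
    obtain ⟨σ, hσ, hcode⟩ := exists_ofDigits (by norm_num) (E.D.bag_nodup t) ha
    have e0 : s1.arr 0 = E.inp := by rw [F.arr 0 (by decide), hin]
    have e55 : s1.reg 55 = E.bgp t + 1 := by rw [F.reg 55 (by decide), h1]
    have e56 : s1.reg 56 = (E.D.bag t).length := by rw [F.reg 56 (by decide), h2]
    have e58 : s1.reg 58 = s.reg 58 := F.reg 58 (by decide)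
    simp only [wp_seq, wp_assign]
    refine ⟨trivial, by simp; omega, ?_⟩
    refine wp_forBag (t := t) (fun l s' => (∀ r, E.D.bag t = l ++ r →
      s'.reg 22 = Nat.ofDigits 16384 (r.map σ)) ∧
        s'.reg 70 = if ∀ u ∈ l, 1 ≤ σ u ∧ σ u ≤ 5 then 1 else 0) (by simpa using e0)
      (by simp [e55]) (by simp [e56]) (by decide) (by decide) (by decide) ?_ ?_ ?_ ?_
    · rintro l s r v (rfl | rfl) h <;> simpa using h
    · refine ⟨?_, by simp⟩
      rintro r hr
      rw [List.nil_append] at hr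
      simp [h66, ← hcode, hr]
    · intro l u l' hl s' F' hu ⟨hy, h70⟩
      have h22 := hy _ hl
      rw [List.map_cons, Nat.ofDigits_cons] at h22
      have hb22 : s'.reg 22 < E.M := by
        rw [hy _ hl]
        have : Nat.ofDigits 16384 ((u :: l').map σ) < 16384 ^ (u :: l').length :=
          ofDigits_map_lt (by norm_num) fun u _ => hσ u
        have h' : 16384 ^ (u :: l').length ≤ 16384 ^ (E.D.bag t).length :=
          Nat.pow_le_pow_right (by norm_num) (by rw [hl]; simp)
        omega
      have hmod : s'.reg 22 % 16384 = σ u := by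
        rw [h22]
        have := hσ u
        omega
      have hdiv : s'.reg 22 / 16384 = Nat.ofDigits 16384 (l'.map σ) := by
        rw [h22]
        have := hσ u
        omega
      have hs : (rem (reg 22) 16384).Safe E.M s' := safe_rem trivial hb22 (by omega)
      have hdone : ∀ r, E.D.bag t = l ++ [u] ++ r → s'.reg 22 / 16384 =
          Nat.ofDigits 16384 (r.map σ) := by
        intro r hr
        rw [hl, List.append_assoc, List.append_cancel_left_eq, List.singleton_append,
          List.cons.injEq] at hr
        rw [hdiv, hr.2]
      simp only [wp_seq, wp_assign, wp_ite, wp_skip]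
      simp only [eval_rem, Expr.eval, ArithOp.eval, hmod]
      have h16 : (reg 22 /ₑ lit 16384).Safe E.M s' := ⟨trivial, by simp; omega⟩
      refine ⟨hs, fun h0 => ⟨⟨hs, by simp; omega⟩, fun h6 => ⟨by simp; omega, h16, ?_, ?_⟩,
        fun h6 => ⟨h16, ?_, ?_⟩⟩, fun h0 => ⟨by simp; omega, h16, ?_, ?_⟩⟩
      · simpa using hdone
      · have : ¬ (∀ x ∈ l ++ [u], 1 ≤ σ x ∧ σ x ≤ 5) := fun h => by
          have := h u (by simp)
          omega
        simp only [VState.set_reg, if_neg this]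
        simp
      · simpa using hdone
      · have : (∀ x ∈ l ++ [u], 1 ≤ σ x ∧ σ x ≤ 5) ↔ ∀ x ∈ l, 1 ≤ σ x ∧ σ x ≤ 5 := by
          simp only [List.mem_append, List.mem_singleton]
          refine ⟨fun h x hx => h x (.inl hx), fun h x hx => hx.elim (h x) ?_⟩
          rintro rfl
          omega
        simp only [VState.set_reg, this, h70]
        simp
      · simpa using hdone
      · have : ¬ (∀ x ∈ l ++ [u], 1 ≤ σ x ∧ σ x ≤ 5) := fun h => by
          have := h u (by simp)
          omega
        simp only [VState.set_reg, if_neg this]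
        simp
    · intro s2 F' ⟨_, h70⟩
      have g58 : s2.reg 58 = s.reg 58 := by rw [F'.reg 58 (by decide)]; simpa using e58
      have g66 : s2.reg 66 = a := by rw [F'.reg 66 (by decide)]; simpa using h66
      have g10 : s2.arr 10 = s1.arr 10 := by rw [F'.arr 10 (by decide)]; rfl
      have key : ∀ v, (v = if ∀ u ∈ E.D.bag t, 1 ≤ σ u ∧ σ u ≤ 5 then 1 else 0) → ∀ f : ℕ → ℕ,
          f = Function.update (s1.arr 10) (s.reg 58 + a) v →
          (∀ x, x < s.reg 58 ∨ s.reg 58 + (a + 1) ≤ x → f x = s.arr 10 x) ∧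
          ∀ σ : Fin n → ℕ, (∀ u, σ u < 16384) → E.D.code t σ < a + 1 →
            f (s.reg 58 + E.D.code t σ) =
            if ∀ u ∈ E.D.bag t, 1 ≤ σ u ∧ σ u ≤ 5 then 1 else 0 := by
        rintro v hv f rfl
        refine ⟨fun x hx => ?_, fun σ' hσ' hc => ?_⟩
        · rw [Function.update_of_ne (by omega)]
          exact hI1 x (by omega)
        · rw [Function.update_apply]
          split
          · next h =>
            have h' : E.D.code t σ' = E.D.code t σ := (Nat.add_left_cancel h).trans hcode.symm
            have := ofDigits_map_inj (by norm_num) (fun u _ => hσ' u) (fun u _ => hσ u) h'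
            rw [hv]
            congr 1
            simp only [eq_iff_iff]
            exact forall₂_congr fun u hu => by rw [this u hu]
          · exact hI2 σ' hσ' (by omega)
      simp only [wp_ite, wp_store, wp_skip]
      refine ⟨trivial, fun h => ⟨by simp [g58, g66]; omega, ?_⟩, fun h => ?_⟩
      · simp only [Expr.eval] at h
        have h' := key 1 (by by_contra hc; rw [if_neg (by intro hn; rw [if_pos hn] at hc; exact hc rfl)] at h70; exact h h70) _ rfl
        simpa [g58, g66, g10] using h'
      · simp only [Expr.eval] at h
        have h' := key 0 (by rw [← h70, h]) _ rfl
        -- The program writes nothing for an impossible state: the cell is fresh and contains `0`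
        -- already.
        have h0 : Function.update (s1.arr 10) (s.reg 58 + a) 0 = s1.arr 10 := by
          rw [Function.update_eq_self_iff, hI1 _ (by omega), h5 _ (by omega)]
        rw [h0] at h'
        simpa [g58, g66, g10] using h'
  · intro s' F _ ⟨hI1, hI2⟩
    rw [h3] at hI1 hI2
    refine hQ s' F (by rwa [h3]) (RTree.table_empty fun σ hσ => by convert hI2 σ hσ (code_lt t hσ))

end Enc

/-! ### Charges in a bag -/

/-- Register `37`, if it is zero, becomes the charge for an edge with the labels in the registers
`34` and `35`. -/
def edgeCharge : Cmd :=
  ite (ne (reg 34) (lit 5)) (ite (ne (reg 35) (lit 5)) (ite (ne (reg 34) (lit 4))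
    (assign 37 (lit 256 *ₑ (lit 5 -ₑ reg 34)) ;;
      ite (ne (reg 34) (lit 3)) skip (assign 37 (reg 37 +ₑ lit 16 *ₑ (reg 35 -ₑ lit 1))))
    (ite (ne (reg 35) (lit 1)) (assign 37 (lit 2048)) skip)) skip) skip

/-- Register `37`, if it is zero, becomes the charge for a triangle with the labels in the registers
`34`, `35` and `36`. -/
def triCharge : Cmd :=
  ite (ne (reg 34) (lit 3)) skip (ite (ne (reg 35) (lit 5)) (ite (ne (reg 36) (lit 5))
    (assign 37 (lit 1)) skip) skip)

/-- Register `37` becomes the charge of the vertex in register `31` for those in the registers `32`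
and `33`. -/
def charge : Cmd :=
  query 31 32 40 ;; query 31 33 41 ;; query 32 33 42 ;; assign 37 (lit 0) ;;
  ite (reg 40) (ite (reg 41) (ite (ne (reg 32) (reg 33)) (ite (reg 42) triCharge skip) edgeCharge)
    skip) skip

def chargesOfPair : Cmd :=
  forBag 27 33 61 62 (
    assign 36 (rem (arr 13 (reg 33)) 8) ;;
    ite (lit 1 -ₑ arr 12 (reg 31) *ₑ arr 12 (reg 32) *ₑ arr 12 (reg 33))
      (charge ;; assign 38 (reg 38 +ₑ lit 8 *ₑ reg 37)) skip)

def chargesOfVertex : Cmd :=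
  forBag 26 32 61 62 (assign 35 (rem (arr 13 (reg 32)) 8) ;; chargesOfPair)

/-- Array `14` becomes array `13` plus the charges in a bag. -/
def charges : Cmd :=
  forBag 25 31 61 62 (
    assign 34 (rem (arr 13 (reg 31)) 8) ;; assign 38 (arr 13 (reg 31)) ;; chargesOfVertex ;;
    store 14 (reg 31) (reg 38))

theorem sub_add_sub_ne_zero {a b : ℕ} : a - b + (b - a) ≠ 0 ↔ a ≠ b := by omega

theorem edgeW_le {a b : ℕ} (hb : b ≤ 7) : edgeW a b ≤ 2048 := by
  rw [edgeW]; split_ifs <;> omega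

theorem triW_le {a b c : ℕ} : triW a b c ≤ 2048 := by
  rw [triW]; split_ifs <;> omega

theorem contr_le {V : Type*} {G : SimpleGraph V} {l : V → ℕ} (hl : ∀ v, l v ≤ 7) {u v w : V} :
    contr G l u v w ≤ 2048 := by
  rw [contr]
  split_ifs
  · exact edgeW_le (hl v)
  · exact triW_le
  · omega

theorem sum_map_le {α : Type*} {l : List α} {f : α → ℕ} {c : ℕ} (h : ∀ x, f x ≤ c) :
    (l.map f).sum ≤ l.length * c := by
  simpa using List.sum_le_card_nsmul (l.map f) c (by simpa using fun x _ => h x)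

open Classical in
/-- The contribution of `u v w` to `bump`. -/
noncomputable def RTree.term {V T : Type*} {G : SimpleGraph V} (D : RTree G T) (t : T) (σ : V → ℕ)
    (u v w : V) : ℕ :=
  if u ∈ D.bag t ∧ v ∈ D.bag t ∧ w ∈ D.bag t then 0 else contr G (fun x => σ x % 8) u v w

theorem RTree.bump_eq {V T : Type*} {G : SimpleGraph V} (D : RTree G T) (t c : T) (σ : V → ℕ)
    (u : V) : D.bump t c σ u = σ u + 8 * ((D.bag c).map fun v =>
      ((D.bag c).map fun w => D.term t σ u v w).sum).sum := rfl

theorem RTree.term_le {V T : Type*} {G : SimpleGraph V} {D : RTree G T} {t : T} {σ : V → ℕ}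
    {u v w : V} : D.term t σ u v w ≤ 2048 := by
  rw [term]
  split_ifs
  · omega
  · exact contr_le fun x => by omega

namespace Enc

variable {n N : ℕ} {E : Enc n N}

theorem wp_edgeCharge {s : VState} {a b : ℕ} (ha : s.reg 34 = a) (hb : s.reg 35 = b) (ha' : a ≤ 7)
    (hb' : b ≤ 7) (h37 : s.reg 37 = 0) :
    edgeCharge.wp E.M E.R E.L (fun s' => s'.reg 37 = edgeW a b) s := by
  obtain ⟨f1, f2, f3, f4, f5, f6, f7, f8, f9, f10⟩ := E.M_facts
  refine wp_ite_iff (p := a ≠ 5) (by simp [ha]; omega) (by simp [ha]; omega) (fun h1 =>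
    wp_ite_iff (p := b ≠ 5) (by simp [hb]; omega) (by simp [hb]; omega) (fun h2 =>
    wp_ite_iff (p := a ≠ 4) (by simp [ha]; omega) (by simp [ha]; omega) (fun h3 =>
    wp_seq.2 (wp_assign.2 ⟨by simp [ha]; omega, wp_ite_iff (p := a ≠ 3) (by simp [ha]; omega)
      (by simp [ha]; omega) (fun h4 => wp_skip.2 ?_) (fun h4 => wp_assign.2 ⟨by simp [ha, hb]; omega,
        ?_⟩)⟩)) (fun h3 => wp_ite_iff (p := b ≠ 1) (by simp [hb]; omega) (by simp [hb]; omega)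
      (fun h4 => wp_assign.2 ⟨by simp; omega, ?_⟩) (fun h4 => wp_skip.2 ?_)))
    (fun h2 => wp_skip.2 ?_)) (fun h1 => wp_skip.2 ?_)
  all_goals simp_all [edgeW]

theorem wp_triCharge {s : VState} {a b c : ℕ} (ha : s.reg 34 = a) (hb : s.reg 35 = b)
    (hc : s.reg 36 = c) (ha' : a ≤ 7) (hb' : b ≤ 7) (hc' : c ≤ 7) (h37 : s.reg 37 = 0) :
    triCharge.wp E.M E.R E.L (fun s' => s'.reg 37 = triW a b c) s := by
  obtain ⟨f1, f2, f3, f4, f5, f6, f7, f8, f9, f10⟩ := E.M_facts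
  refine wp_ite_iff (p := a ≠ 3) (by simp [ha]; omega) (by simp [ha]; omega)
    (fun h1 => wp_skip.2 ?_) (fun h1 =>
    wp_ite_iff (p := b ≠ 5) (by simp [hb]; omega) (by simp [hb]; omega) (fun h2 =>
    wp_ite_iff (p := c ≠ 5) (by simp [hc]; omega) (by simp [hc]; omega) (fun h3 =>
      wp_assign.2 ⟨by simp; omega, ?_⟩) (fun h3 => wp_skip.2 ?_)) (fun h2 => wp_skip.2 ?_))
  all_goals simp_all [triW]

/-- For `v = w` the third query is meaningless and its result is ignored; the edge is then charged
instead of a triangle. -/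
theorem wp_charge {s : VState} (h : E.Ready s) {u v w : Fin n} {l : Fin n → ℕ} (hl : ∀ x, l x ≤ 7)
    (hu : s.reg 31 = u) (hv : s.reg 32 = v) (hw : s.reg 33 = w) (h34 : s.reg 34 = l u)
    (h35 : s.reg 35 = l v) (h36 : s.reg 36 = l w) :
    charge.wp E.M E.R E.L (fun s' => s'.reg 37 = contr E.G l u v w) s := by
  obtain ⟨f1, f2, f3, f4, f5, f6, f7, f8, f9, f10⟩ := E.M_facts
  have hn := E.n_le_L
  simp only [charge, wp_seq]
  refine wp_query (by decide) (by decide) (by decide) (by decide) (by decide) (by decide) h hu hv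
    fun s1 F1 h1 => ?_
  have R1 := h.frame F1 (by decide) (by decide)
  refine wp_query (by decide) (by decide) (by decide) (by decide) (by decide) (by decide) R1
    ((F1.reg 31 (by decide)).trans hu) ((F1.reg 33 (by decide)).trans hw) fun s2 F2 h2 => ?_
  have R2 := R1.frame F2 (by decide) (by decide)
  have F12 := F1.trans F2
  refine wp_query (by decide) (by decide) (by decide) (by decide) (by decide) (by decide) R2
    ((F12.reg 32 (by decide)).trans hv) ((F12.reg 33 (by decide)).trans hw) fun s3 F3 h3 => ?_
  have F := F12.trans F3
  rw [wp_assign]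
  refine ⟨by simp; omega, ?_⟩
  have g31 : s3.reg 31 = u := (F.reg 31 (by decide)).trans hu
  have g32 : s3.reg 32 = v := (F.reg 32 (by decide)).trans hv
  have g33 : s3.reg 33 = w := (F.reg 33 (by decide)).trans hw
  have g34 : s3.reg 34 = l u := (F.reg 34 (by decide)).trans h34
  have g35 : s3.reg 35 = l v := (F.reg 35 (by decide)).trans h35
  have g36 : s3.reg 36 = l w := (F.reg 36 (by decide)).trans h36
  have g41 : s3.reg 41 = s2.reg 41 := F3.reg 41 (by decide)
  have g40 : s3.reg 40 = s1.reg 40 := (F3.reg 40 (by decide)).trans (F2.reg 40 (by decide))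
  refine wp_ite_iff (p := E.G.Adj u v) ?_ trivial (fun a1 => ?_) (fun a1 => wp_skip.2 ?_)
  · rcases h1 with ⟨h1, h1'⟩ | ⟨h1, h1'⟩ <;> simp [g40, h1, h1']
  · refine wp_ite_iff (p := E.G.Adj u w) ?_ trivial (fun a2 => ?_) (fun a2 => wp_skip.2 ?_)
    · rcases h2 with ⟨h1, h1'⟩ | ⟨h1, h1'⟩ <;> simp [g41, h1, h1']
    · refine wp_ite_iff (p := v ≠ w) ?_ (by simp [g32, g33]; omega) (fun a3 => ?_) (fun a3 => ?_)
      · simp [g32, g33, Fin.ext_iff]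
        omega
      · refine wp_ite_iff (p := E.G.Adj v w) ?_ trivial (fun a4 => ?_) (fun a4 => wp_skip.2 ?_)
        · rcases h3 with ⟨h1, h1'⟩ | ⟨h1, h1'⟩ <;> simp [h1, h1']
        · refine (wp_triCharge (by simpa using g34) (by simpa using g35) (by simpa using g36) (hl _)
            (hl _) (hl _) (by simp)).mono fun s' h => ?_
          rw [h, contr, if_pos ⟨a1, a2, .inr a4⟩, if_neg a3]
        · simp [contr, Cliq, a3, a4]
      · refine (wp_edgeCharge (by simpa using g34) (by simpa using g35) (hl _) (hl _)
          (by simp)).mono fun s' h => ?_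
        have a3 := not_not.1 a3
        rw [h, contr, if_pos ⟨a1, a2, .inl a3⟩, if_pos a3]
    · simp [contr, Cliq, a2]
  · simp [contr, Cliq, a1]

open Classical in
/-- States of the bags of a node `t` and its child `c` have been decoded. -/
structure Work (E : Enc n N) (t c : Fin N) (σ τ : Fin n → ℕ) (s : VState) : Prop
    extends E.Ready s where
  h55 : s.reg 55 = E.bgp t + 1
  h56 : s.reg 56 = (E.D.bag t).length
  h61 : s.reg 61 = E.bgp c + 1
  h62 : s.reg 62 = (E.D.bag c).length
  h11 : ∀ u ∈ E.D.bag t, s.arr 11 u = σ u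
  h13 : ∀ u ∈ E.D.bag c, s.arr 13 u = τ u
  mark : ∀ u ∈ E.D.bag c, s.arr 12 u = if u ∈ E.D.bag t then 1 else 0

variable {t c : Fin N} {σ τ : Fin n → ℕ} {s : VState} {Q : VState → Prop}

theorem Work.frame {rs as : List ℕ} {s' : VState} (h : E.Work t c σ τ s) (F : Frame rs as s s')
    (hr : ∀ x ∈ [1, 2, 3, 4, 11, 55, 56, 61, 62], x ∉ rs)
    (ha : ∀ j ∈ [0, 1, 2, 3, 5, 6, 11, 12, 13], j ∉ as) : E.Work t c σ τ s' where
  toReady := h.toReady.frame F (fun x hx => hr x (by simp at hx ⊢; omega))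
    fun j hj => ha j (by simp at hj ⊢; omega)
  h55 := by rw [F.reg 55 (hr 55 (by simp)), h.h55]
  h56 := by rw [F.reg 56 (hr 56 (by simp)), h.h56]
  h61 := by rw [F.reg 61 (hr 61 (by simp)), h.h61]
  h62 := by rw [F.reg 62 (hr 62 (by simp)), h.h62]
  h11 := by rw [F.arr 11 (ha 11 (by simp))]; exact h.h11
  h13 := by rw [F.arr 13 (ha 13 (by simp))]; exact h.h13
  mark := by rw [F.arr 12 (ha 12 (by simp))]; exact h.mark

/-- Every summand contributes at most `8 * 2048 = 16384` to register `38`; this is the room reserved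
by `hb`. -/
theorem wp_chargesOfPair (h : E.Work t c σ τ s) (hτ : ∀ u, τ u < 16384) {u v : Fin n}
    (hu : u ∈ E.D.bag c) (hv : v ∈ E.D.bag c) (h31 : s.reg 31 = u) (h32 : s.reg 32 = v)
    (h34 : s.reg 34 = τ u % 8) (h35 : s.reg 35 = τ v % 8)
    (hb : s.reg 38 + 16384 * (E.D.bag c).length < E.M)
    (hQ : ∀ s', Frame chargesOfPair.regs chargesOfPair.arrs s s' → s'.reg 38 = s.reg 38 +
      8 * ((E.D.bag c).map fun w => E.D.term t τ u v w).sum → Q s') :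
    chargesOfPair.wp E.M E.R E.L Q s := by
  classical
  obtain ⟨f1, f2, f3, f4, f5, f6, f7, f8, f9, f10⟩ := E.M_facts
  refine wp_forBag (t := c) (fun l s' => s'.reg 38 = s.reg 38 +
      8 * (l.map fun w => E.D.term t τ u v w).sum) h.inp h.h61 h.h62 (by decide) (by decide)
    (by decide) ?_ (by simp) ?_ (fun s' F hI => hQ s' F hI)
  · rintro l s r v (rfl | rfl) h <;> simpa using h
  · intro l w l' hl s1 F h33 hI
    have W := h.frame F (by decide) (by decide)
    have hw : w ∈ E.D.bag c := by simp [hl]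
    have hlen := congrArg List.length hl
    simp only [List.length_append, List.length_cons] at hlen
    have hsum : (l.map fun w => E.D.term t τ u v w).sum ≤ l.length * 2048 :=
      sum_map_le fun w => RTree.term_le
    have g31 : s1.reg 31 = u := (F.reg 31 (by decide)).trans h31
    have g32 : s1.reg 32 = v := (F.reg 32 (by decide)).trans h32
    have g34 : s1.reg 34 = τ u % 8 := (F.reg 34 (by decide)).trans h34
    have g35 : s1.reg 35 = τ v % 8 := (F.reg 35 (by decide)).trans h35
    have m1 := W.mark u hu
    have m2 := W.mark v hv
    have m3 := W.mark w hw
    have hτw := hτ w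
    have hgoal : ∀ s' : VState, s'.reg 38 = s1.reg 38 + 8 * E.D.term t τ u v w → s'.reg 38 =
        s.reg 38 + 8 * ((l ++ [w]).map fun w => E.D.term t τ u v w).sum := by
      intro s' h'
      rw [h', hI]
      simp
      ring
    simp only [wp_seq, wp_assign]
    refine ⟨safe_rem trivial (by simp [h33, W.h13 w hw]; omega) (by omega), ?_⟩
    refine wp_ite_iff (p := ¬ (u ∈ E.D.bag t ∧ v ∈ E.D.bag t ∧ w ∈ E.D.bag t)) ?_ ?_ (fun hp => ?_)
      (fun hp => wp_skip.2 ?_)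
    -- The marks are `0` or `1`, so one minus their product vanishes exactly if all three vertices
    -- are in the bag of `t`; such a clique is charged further up.
    · simp only [Expr.eval, ArithOp.eval, VState.set_reg, VState.set_arr]
      simp only [Nat.reduceEqDiff, if_false, g31, g32, h33, m1, m2, m3]
      by_cases a1 : u ∈ E.D.bag t <;> by_cases a2 : v ∈ E.D.bag t <;>
        by_cases a3 : w ∈ E.D.bag t <;> simp [a1, a2, a3]
    · simp [g31, g32, h33, m1, m2, m3]
      split_ifs <;> omega
    · rw [wp_seq]
      have F0 : Frame [36] [] s1 (s1.set 36 ((rem (arr 13 (reg 33)) 8).eval s1)) :=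
        ⟨fun x hx => by simp at hx; simp [hx], fun _ _ => rfl⟩
      refine (wp_charge (l := fun x => τ x % 8) (W.toReady.frame F0 (by decide) (by decide))
        (fun x => by omega) (by simpa using g31) (by simpa using g32) (by simpa using h33)
        (by simpa using g34) (by simpa using g35) (by simp [h33, W.h13 w hw])).frame.mono
        fun s2 hs2 => ?_
      obtain ⟨F2, h37⟩ := hs2
      have g38 : s2.reg 38 = s1.reg 38 := by rw [F2.reg 38 (by decide)]; simp
      have hterm : s2.reg 37 = E.D.term t τ u v w := by rw [h37, RTree.term, if_neg hp]
      have ht := RTree.term_le (D := E.D) (t := t) (σ := τ) (u := u) (v := v) (w := w)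
      rw [wp_assign]
      refine ⟨by simp [hterm, g38, hI]; omega, hgoal _ ?_⟩
      simp [hterm, g38]
    · refine hgoal _ ?_
      simp [RTree.term, not_not.1 hp]

theorem wp_chargesOfVertex (h : E.Work t c σ τ s) (hτ : ∀ u, τ u < 16384) {u : Fin n}
    (hu : u ∈ E.D.bag c) (h31 : s.reg 31 = u) (h34 : s.reg 34 = τ u % 8) (h38 : s.reg 38 = τ u)
    (hQ : ∀ s', Frame chargesOfVertex.regs chargesOfVertex.arrs s s' →
      s'.reg 38 = E.D.bump t c τ u → Q s') :
    chargesOfVertex.wp E.M E.R E.L Q s := by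
  classical
  obtain ⟨f1, f2, f3, f4, f5, f6, f7, f8, f9, f10⟩ := E.M_facts
  have hsq := E.sq_le_R
  have hlen := E.length_bag c
  refine wp_forBag (t := c) (fun l s' => s'.reg 38 = τ u + 8 * (l.map fun v =>
      ((E.D.bag c).map fun w => E.D.term t τ u v w).sum).sum) h.inp h.h61 h.h62 (by decide)
    (by decide) (by decide) ?_ (by simp [h38]) ?_ (fun s' F hI => hQ s' F (by rw [hI, RTree.bump_eq]))
  · rintro l s r v (rfl | rfl) h <;> simpa using h
  · intro l v l' hl s1 F h32 hI
    have W := h.frame F (by decide) (by decide)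
    have hv : v ∈ E.D.bag c := by simp [hl]
    have hll := congrArg List.length hl
    simp only [List.length_append, List.length_cons] at hll
    have hsum := sum_map_le (l := l) fun v => sum_map_le (l := E.D.bag c) fun w =>
      RTree.term_le (D := E.D) (t := t) (σ := τ) (u := u) (v := v) (w := w)
    have hτv := hτ v
    have hτu := hτ u
    simp only [wp_seq, wp_assign]
    refine ⟨safe_rem trivial (by simp [h32, W.h13 v hv]; omega) (by omega), ?_⟩
    have F0 : Frame [35] [] s1 (s1.set 35 ((rem (arr 13 (reg 32)) 8).eval s1)) :=
      ⟨fun x hx => by simp at hx; simp [hx], fun _ _ => rfl⟩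
    refine wp_chargesOfPair (W.frame F0 (by decide) (by decide)) hτ hu hv
      (by simpa using (F.reg 31 (by decide)).trans h31) (by simpa using h32)
      (by simpa using (F.reg 34 (by decide)).trans h34) (by simp [h32, W.h13 v hv]) ?_
      fun s2 F2 h2 => ?_
    · have hm : (l.length + 1) * (E.D.bag c).length ≤ (E.w + 1) * (E.w + 1) :=
        Nat.mul_le_mul (by omega) hlen
      simp [hI]
      nlinarith
    · rw [h2]
      simp [hI]
      ring

theorem wp_charges (h : E.Work t c σ τ s) (hτ : ∀ u, τ u < 16384)
    (hQ : ∀ s', Frame charges.regs charges.arrs s s' →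
      (∀ u ∈ E.D.bag c, s'.arr 14 u = E.D.bump t c τ u) →
      (∀ u : Fin n, u ∉ E.D.bag c → s'.arr 14 u = s.arr 14 u) → Q s') :
    charges.wp E.M E.R E.L Q s := by
  obtain ⟨f1, f2, f3, f4, f5, f6, f7, f8, f9, f10⟩ := E.M_facts
  refine wp_forBag (t := c) (fun l s' => (∀ u ∈ l, s'.arr 14 u = E.D.bump t c τ u) ∧
      ∀ u : Fin n, u ∉ l → s'.arr 14 u = s.arr 14 u) h.inp h.h61 h.h62 (by decide)
    (by decide) (by decide) ?_ (by simp) ?_ (fun s' F hI => hQ s' F hI.1 hI.2)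
  · rintro l s r v (rfl | rfl) h <;> simpa using h
  · intro l u l' hl s1 F h31 ⟨hI, hI'⟩
    have W := h.frame F (by decide) (by decide)
    have hu : u ∈ E.D.bag c := by simp [hl]
    have hτu := hτ u
    simp only [wp_seq, wp_assign]
    refine ⟨safe_rem trivial (by simp [h31, W.h13 u hu]; omega) (by omega), trivial, ?_⟩
    have F0 : Frame [34, 38] [] s1 ((s1.set 34 ((rem (arr 13 (reg 31)) 8).eval s1)).set 38
        ((arr 13 (reg 31)).eval (s1.set 34 ((rem (arr 13 (reg 31)) 8).eval s1)))) :=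
      ⟨fun x hx => by simp at hx; simp [hx], fun _ _ => rfl⟩
    refine wp_chargesOfVertex (W.frame F0 (by decide) (by decide)) hτ hu (by simpa using h31)
      (by simp [h31, W.h13 u hu]) (by simp [h31, W.h13 u hu]) fun s2 F2 h2 => ?_
    have g31 : s2.reg 31 = u := by rw [F2.reg 31 (by decide)]; simpa using h31
    have g14 : s2.arr 14 = s1.arr 14 := by rw [F2.arr 14 (by decide)]; rfl
    rw [wp_store]
    refine ⟨⟨trivial, trivial⟩, fun x hx => ?_, fun x hx => ?_⟩
    · by_cases hxu : x = u
      · subst hxu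
        simp [g31, h2]
      · have hxu' : (x : ℕ) ≠ u := fun h => hxu (Fin.ext h)
        simpa [g31, Function.update_of_ne hxu', g14] using hI x (by simpa [hxu] using hx)
    · simp only [List.mem_append, List.mem_singleton, not_or] at hx
      have hxu' : (x : ℕ) ≠ u := fun h => hx.2 (Fin.ext h)
      simpa [g31, Function.update_of_ne hxu', g14] using hI' x hx.1

end Enc

/-! ### Combining two states -/

/-- The test for a vertex that is in both bags. -/
def checkInner : Cmd :=
  ite (ne (rem (arr 11 (reg 31)) 8) (reg 34)) (assign 70 (lit 0)) skip ;;
  ite (arr 11 (reg 31) +ₑ lit 8 *ₑ reg 35 -ₑ lit 16383) (assign 70 (lit 0)) skip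

/-- The test for a vertex that is only in the bag of the child. -/
def checkOuter : Cmd :=
  ite (reg 35 -ₑ lit 2047) (assign 70 (lit 0)) skip ;;
  ite (rem (reg 35 /ₑ lit 16) 16 -ₑ rem (reg 35) 16) (assign 70 (lit 0)) skip ;;
  ite (ne (reg 34) (lit 5)) skip (assign 71 (reg 71 +ₑ lit 1))

/-- Register `70` tells whether the states in the arrays `11` and `13` can be combined, and register
`71` counts the deleted vertices. -/
def check : Cmd :=
  assign 70 (lit 1) ;; assign 71 (lit 0) ;;
  forBag 25 31 61 62 (
    assign 34 (rem (arr 13 (reg 31)) 8) ;; assign 35 (arr 14 (reg 31) /ₑ lit 8) ;;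
    ite (arr 12 (reg 31)) checkInner checkOuter)

/-- Register `72` becomes the number of the combined state. -/
def encode : Cmd :=
  assign 72 (lit 0) ;; assign 73 (lit 1) ;;
  forBag 25 31 55 56 (
    assign 72 (reg 72 +ₑ reg 73 *ₑ (arr 11 (reg 31) +ₑ lit 8 *ₑ (arr 14 (reg 31) /ₑ lit 8))) ;;
    assign 73 (reg 73 *ₑ lit 16384))

/-- The condition for `Compatible` at one vertex. -/
def RTree.CompatibleAt {V T : Type*} {G : SimpleGraph V} (D : RTree G T) (t c : T) (σ τ : V → ℕ)
    (u : V) : Prop :=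
  (u ∉ D.bag t → OkW (D.bump t c τ u / 8)) ∧
    (u ∈ D.bag t → σ u % 8 = τ u % 8 ∧ σ u + 8 * (D.bump t c τ u / 8) < 16384)

theorem RTree.compatible_iff {V T : Type*} {G : SimpleGraph V} {D : RTree G T} {t c : T}
    {σ τ : V → ℕ} : D.Compatible t c σ τ ↔ ∀ u ∈ D.bag c, D.CompatibleAt t c σ τ u :=
  ⟨fun h u hu => ⟨h.ok u hu, fun hut => ⟨h.eq u hu hut, h.lt u hu hut⟩⟩,
    fun h => ⟨fun u hu => (h u hu).1, fun u hu hut => ((h u hu).2 hut).1,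
      fun u hu hut => ((h u hu).2 hut).2⟩⟩

open Classical in
/-- The contribution of `u` to `lost`. -/
noncomputable def RTree.lostAt {V T : Type*} {G : SimpleGraph V} (D : RTree G T) (t : T) (τ : V → ℕ)
    (u : V) : ℕ := if u ∉ D.bag t ∧ τ u % 8 = 5 then 1 else 0

theorem RTree.lostAt_le {V T : Type*} {G : SimpleGraph V} {D : RTree G T} {t : T} {τ : V → ℕ}
    {u : V} : D.lostAt t τ u ≤ 1 := by
  rw [lostAt]; split_ifs <;> omega

namespace Enc

variable {n N : ℕ} {E : Enc n N}

variable {t c : Fin N} {σ τ : Fin n → ℕ} {s : VState} {Q : VState → Prop}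

/-- There are at most `(w + 1) * (w + 1) ≤ R` summands. A sum that is too large for a digit still
fits into a word, so that the tests can detect it. -/
theorem bump_le (hτ : ∀ u, τ u < 16384) (u : Fin n) :
    E.D.bump t c τ u ≤ 16384 + 16384 * E.R := by
  have hlen := E.length_bag c
  have hsq := E.sq_le_R
  have hsum := sum_map_le (l := E.D.bag c) fun v => sum_map_le (l := E.D.bag c) fun w =>
    RTree.term_le (D := E.D) (t := t) (σ := τ) (u := u) (v := v) (w := w)
  have hm : (E.D.bag c).length * (E.D.bag c).length ≤ (E.w + 1) * (E.w + 1) :=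
    Nat.mul_le_mul hlen hlen
  have := hτ u
  rw [RTree.bump_eq]
  nlinarith

theorem wp_checkInner (s : VState) {a b y : ℕ} (ha : s.arr 11 (s.reg 31) = a) (hb : s.reg 34 = b)
    (hy : s.reg 35 = y) (ha' : a < 16384) (hb' : b ≤ 7) (hy' : y ≤ 16384 + 16384 * E.R) :
    checkInner.wp E.M E.R E.L (fun s' => (a % 8 = b ∧ a + 8 * y < 16384 → s'.reg 70 = s.reg 70) ∧
      (¬ (a % 8 = b ∧ a + 8 * y < 16384) → s'.reg 70 = 0) ∧ s'.reg 71 = s.reg 71) s := by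
  obtain ⟨f1, f2, f3, f4, f5, f6, f7, f8, f9, f10⟩ := E.M_facts
  have hs : (rem (arr 11 (reg 31)) 8).Safe E.M s := safe_rem trivial (by simp [ha]; omega) (by omega)
  refine wp_seq.2 (wp_ite_iff (p := a % 8 ≠ b) ?_ ?_ (fun h1 => wp_assign.2 ⟨by simp; omega, ?_⟩)
    (fun h1 => wp_skip.2 ?_))
  · simp only [eval_ne, eval_rem, Expr.eval, sub_add_sub_ne_zero, ha, hb]
  · refine safe_ne.2 ⟨⟨hs, trivial⟩, ⟨trivial, hs⟩, ?_⟩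
    simp [ha, hb]
    omega
  all_goals
    -- The truncated difference with `16383` is nonzero exactly from `16384` on.
    refine wp_ite_iff (p := ¬ a + 8 * y < 16384) ?_ ?_ (fun h2 => wp_assign.2 ⟨by simp; omega, ?_⟩)
      (fun h2 => wp_skip.2 ?_)
    · simp [ha, hy]
      omega
    · simp [ha, hy]
      omega
    all_goals simp [h1, h2]

theorem wp_checkOuter (s : VState) {b y z : ℕ} (hb : s.reg 34 = b) (hy : s.reg 35 = y)
    (hz : s.reg 71 = z) (hb' : b ≤ 7) (hy' : y ≤ 16384 + 16384 * E.R) (hz' : z + 1 < E.M) :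
    checkOuter.wp E.M E.R E.L (fun s' => (OkW y → s'.reg 70 = s.reg 70) ∧
      (¬ OkW y → s'.reg 70 = 0) ∧ s'.reg 71 = z + if b = 5 then 1 else 0) s := by
  obtain ⟨f1, f2, f3, f4, f5, f6, f7, f8, f9, f10⟩ := E.M_facts
  refine wp_seq.2 (wp_ite_iff (p := ¬ y < 2048) ?_ (by simp; omega)
    (fun h1 => wp_assign.2 ⟨by simp; omega, ?_⟩) (fun h1 => wp_skip.2 ?_))
  · simp [hy]
    omega
  all_goals
    refine wp_seq.2 (wp_ite_iff (p := ¬ y / 16 % 16 ≤ y % 16) ?_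
      ⟨safe_rem ⟨trivial, by simp; omega⟩ (by simp [hy]; omega) (by omega),
        safe_rem trivial (by simp [hy]; omega) (by omega)⟩
      (fun h2 => wp_assign.2 ⟨by simp; omega, ?_⟩) (fun h2 => wp_skip.2 ?_))
    · simp only [Expr.eval, ArithOp.eval, eval_rem]
      simp [hy]
      omega
    all_goals
      refine wp_ite_iff (p := b ≠ 5) ?_ (by simp [hb]; omega)
        (fun h3 => wp_skip.2 ?_) (fun h3 => wp_assign.2 ⟨by simp [hz]; omega, ?_⟩)
      · simp [hb]
        omega
      all_goals simp [OkW, h1, h2, h3, hz]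

theorem wp_check (h : E.Work t c σ τ s) (hσ : ∀ u, σ u < 16384) (hτ : ∀ u, τ u < 16384)
    (h14 : ∀ u ∈ E.D.bag c, s.arr 14 u = E.D.bump t c τ u)
    (hQ : ∀ s', Frame check.regs check.arrs s s' →
      s'.reg 70 ≤ 1 → (s'.reg 70 = 1 ↔ E.D.Compatible t c σ τ) → s'.reg 71 = E.D.lost t c τ → Q s') :
    check.wp E.M E.R E.L Q s := by
  obtain ⟨f1, f2, f3, f4, f5, f6, f7, f8, f9, f10⟩ := E.M_facts
  suffices h' : check.wp E.M E.R E.L (fun s' => (s'.reg 70 ≤ 1 ∧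
      (s'.reg 70 = 1 ↔ E.D.Compatible t c σ τ)) ∧ s'.reg 71 = E.D.lost t c τ) s from
    h'.frame.mono fun s' hs' => hQ s' hs'.1 hs'.2.1.1 hs'.2.1.2 hs'.2.2
  simp only [check, wp_seq, wp_assign]
  refine ⟨by simp; omega, by simp; omega, ?_⟩
  have F0 : Frame [70, 71] [] s ((s.set 70 ((lit 1).eval s)).set 71
      ((lit 0).eval (s.set 70 ((lit 1).eval s)))) :=
    ⟨fun x hx => by simp at hx; simp [hx], fun _ _ => rfl⟩
  have W0 := h.frame F0 (by decide) (by decide)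
  refine wp_forBag (t := c) (fun l s' =>
    (s'.reg 70 ≤ 1 ∧ (s'.reg 70 = 1 ↔ ∀ u ∈ l, E.D.CompatibleAt t c σ τ u)) ∧
    s'.reg 71 = (l.map (E.D.lostAt t τ)).sum) W0.inp W0.h61
    W0.h62 (by decide) (by decide) (by decide) ?_ (by simp) ?_ (fun s' F hI => ⟨?_, hI.2⟩)
  · rintro l s r v (rfl | rfl) h <;> simpa using h
  · intro l u l' hl s1 F h31 ⟨⟨h70, h70'⟩, h71⟩
    have W := W0.frame F (by decide) (by decide)
    have hu : u ∈ E.D.bag c := by simp [hl]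
    have hlen := E.length_bag c
    have hlen' := congrArg List.length hl
    simp only [List.length_append, List.length_cons] at hlen'
    have hsum : (l.map (E.D.lostAt t τ)).sum ≤ l.length * 1 := sum_map_le fun w => RTree.lostAt_le
    have hσu := hσ u
    have hτu := hτ u
    have e13 := W.h13 u hu
    have e12 := W.mark u hu
    have e14 : s1.arr 14 u = E.D.bump t c τ u := by
      rw [F.arr 14 (by decide)]; exact h14 u hu
    have hb := bump_le (E := E) (t := t) (c := c) hτ u
    set y := E.D.bump t c τ u with hy
    have hfinal : ∀ s' : VState, (E.D.CompatibleAt t c σ τ u → s'.reg 70 = s1.reg 70) →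
        (¬ E.D.CompatibleAt t c σ τ u → s'.reg 70 = 0) →
        (s'.reg 71 = s1.reg 71 + E.D.lostAt t τ u) →
        (s'.reg 70 ≤ 1 ∧ (s'.reg 70 = 1 ↔ ∀ x ∈ l ++ [u], E.D.CompatibleAt t c σ τ x)) ∧
        s'.reg 71 = ((l ++ [u]).map (E.D.lostAt t τ)).sum := by
      intro s' h1 h1' h2
      constructor
      · by_cases hc : E.D.CompatibleAt t c σ τ u
        · rw [h1 hc]
          refine ⟨h70, h70'.trans ⟨fun h x hx => ?_, fun h x hx => h x (by simp [hx])⟩⟩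
          rcases List.mem_append.1 hx with hx | hx
          · exact h x hx
          · rwa [List.mem_singleton.1 hx]
        · rw [h1' hc]
          simp only [zero_le, zero_ne_one, true_and, false_iff]
          exact fun h => hc (h u (by simp))
      · rw [h2, h71, List.map_append, List.sum_append]
        simp
    simp only [wp_seq, wp_assign]
    refine ⟨safe_rem trivial (by simp [h31, e13]; omega) (by omega), by simp; omega, ?_⟩
    refine wp_ite_iff (p := u ∈ E.D.bag t) (by simp [h31, e12]) trivial (fun hut => ?_)
      (fun hut => ?_)
    · have e11 := W.h11 u hut
      have hif : E.D.CompatibleAt t c σ τ u ↔ σ u % 8 = τ u % 8 ∧ σ u + 8 * (y / 8) < 16384 := by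
        simp [RTree.CompatibleAt, hut, hy]
      have hite : E.D.lostAt t τ u = 0 := if_neg fun h => h.1 hut
      rw [hif, hite] at hfinal
      refine (wp_checkInner (E := E) _ (a := σ u) (b := τ u % 8) (y := y / 8) (by simpa [h31] using e11)
        (by simp [h31, e13]) (by simp [h31, e14]) hσu (by omega) (by omega)).mono
        fun s' hs' => hfinal s' ?_ hs'.2.1 ?_
      · simpa using hs'.1
      · simpa using hs'.2.2
    · have hif : E.D.CompatibleAt t c σ τ u ↔ OkW (y / 8) := by
        simp [RTree.CompatibleAt, hut, hy]
      have hite : E.D.lostAt t τ u = if τ u % 8 = 5 then 1 else 0 := by simp [RTree.lostAt, hut]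
      rw [hif, hite] at hfinal
      refine (wp_checkOuter (E := E) _ (b := τ u % 8) (y := y / 8) (z := s1.reg 71)
        (by simp [h31, e13]) (by simp [h31, e14]) (by simp) (by omega) (by omega) (by omega)).mono
        fun s' hs' => hfinal s' ?_ hs'.2.1 hs'.2.2
      simpa using hs'.1
  · rw [RTree.compatible_iff]
    exact hI.1

/-- Compatibility bounds the digits of the combined state, so its number stays in the table. Array
`14` is `0` at the vertices missing from the bag of `c`, hence these keep their digit. -/
theorem wp_encode (h : E.Work t c σ τ s) (hσ : ∀ u, σ u < 16384)
    (hC : E.D.Compatible t c σ τ) (h14 : ∀ u ∈ E.D.bag c, s.arr 14 u = E.D.bump t c τ u)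
    (h14' : ∀ u ∈ E.D.bag t, u ∉ E.D.bag c → s.arr 14 u = 0)
    (hQ : ∀ s', Frame encode.regs encode.arrs s s' →
      s'.reg 72 = E.D.code t (E.D.joined t c σ τ) → s'.reg 72 < 16384 ^ (E.D.bag t).length → Q s') :
    encode.wp E.M E.R E.L Q s := by
  classical
  obtain ⟨f1, f2, f3, f4, f5, f6, f7, f8, f9, f10⟩ := E.M_facts
  have hlt : ∀ u ∈ E.D.bag t, E.D.joined t c σ τ u < 16384 := by
    intro u hu
    rw [RTree.joined]
    split_ifs with huc
    · exact hC.lt u huc hu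
    · exact hσ u
  have hdig : ∀ u ∈ E.D.bag t, s.arr 11 u + 8 * (s.arr 14 u / 8) = E.D.joined t c σ τ u := by
    intro u hu
    rw [RTree.joined, h.h11 u hu]
    split_ifs with huc
    · rw [h14 u huc]
    · rw [h14' u hu huc]
  have hp := E.pow_le_R t
  suffices h' : encode.wp E.M E.R E.L (fun s' => s'.reg 72 = E.D.code t (E.D.joined t c σ τ)) s from
    h'.frame.mono fun s' hs' => hQ s' hs'.1 hs'.2 (by
      rw [hs'.2]; exact ofDigits_map_lt (by norm_num) hlt)
  simp only [encode, wp_seq, wp_assign]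
  refine ⟨by simp; omega, by simp; omega, ?_⟩
  have F0 : Frame [72, 73] [] s ((s.set 72 ((lit 0).eval s)).set 73
      ((lit 1).eval (s.set 72 ((lit 0).eval s)))) :=
    ⟨fun x hx => by simp at hx; simp [hx], fun _ _ => rfl⟩
  have W0 := h.frame F0 (by decide) (by decide)
  refine wp_forBag (t := t) (fun l s' =>
    s'.reg 72 = Nat.ofDigits 16384 (l.map (E.D.joined t c σ τ)) ∧ s'.reg 73 = 16384 ^ l.length)
    W0.inp W0.h55 W0.h56 (by decide) (by decide) (by decide) ?_ (by simp) ?_ (fun s' F hI => hI.1)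
  · rintro l s r v (rfl | rfl) h <;> simpa using h
  · intro l u l' hl s1 F h31 ⟨h72, h73⟩
    have hu : u ∈ E.D.bag t := by simp [hl]
    have e11 : s1.arr 11 = s.arr 11 := by rw [F.arr 11 (by decide)]; rfl
    have e14 : s1.arr 14 = s.arr 14 := by rw [F.arr 14 (by decide)]; rfl
    have hd := hdig u hu
    have hd' := hlt u hu
    have hlen' := congrArg List.length hl
    simp only [List.length_append, List.length_cons] at hlen'
    have hpow : 16384 ^ (l.length + 1) ≤ 16384 ^ (E.D.bag t).length :=
      Nat.pow_le_pow_right (by norm_num) (by omega)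
    have h1 : Nat.ofDigits 16384 (l.map (E.D.joined t c σ τ)) < 16384 ^ l.length :=
      ofDigits_map_lt (by norm_num) fun x hx => hlt x (by simp [hl, hx])
    rw [pow_succ] at hpow
    have h2 : 16384 ^ l.length * E.D.joined t c σ τ u ≤ 16384 ^ l.length * 16384 :=
      Nat.mul_le_mul_left _ hd'.le
    simp only [wp_seq, wp_assign]
    have hb14 : 8 * (s.arr 14 u / 8) ≤ E.D.joined t c σ τ u := by omega
    refine ⟨?_, ?_, ?_, ?_⟩
    · simp [h31, e11, e14, h72, h73, hd]
      omega
    · simp [h73]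
      omega
    · simp [h31, e11, e14, h72, h73, hd, Nat.ofDigits_append]
    · simp [h73, pow_succ]

end Enc

/-! ### Combining two tables -/

/-- A nonzero entry `v` replaces the entry `x` if it is better. -/
def improve (x v : ℕ) : ℕ := if x = 0 then v else min x v

namespace RTree

variable {V T : Type*} {G : SimpleGraph V} {D : RTree G T}

variable (D) in
/-- The states `σ` and `τ` are possible for the tables `f` and `g` and give rise to the entry `v`. -/
structure Cand (k : ℕ) (t c : T) (f g : ℕ → ℕ) (σ τ : V → ℕ) (v : ℕ) : Prop where
  lt : ∀ u, σ u < 16384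
  lt' : ∀ u, τ u < 16384
  ne : f (D.code t σ) ≠ 0
  ne' : g (D.code c τ) ≠ 0
  compatible : D.Compatible t c σ τ
  eq : v + 1 = f (D.code t σ) + g (D.code c τ) + D.lost t c τ
  le : v ≤ k + 1

variable (D) in
/-- The table `h` consists of the best entries that arise from pairs of states, and covers those for
which `P` holds. -/
structure Covers (k : ℕ) (t c : T) (f g : ℕ → ℕ) (P : ℕ → ℕ → Prop) (h : ℕ → ℕ) : Prop where
  sound : ∀ a < 16384 ^ (D.bag t).length, h a ≠ 0 → ∃ σ τ, D.Cand k t c f g σ τ (h a) ∧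
    D.code t (D.joined t c σ τ) = a
  complete : ∀ σ τ v, D.Cand k t c f g σ τ v → P (D.code t σ) (D.code c τ) →
    h (D.code t (D.joined t c σ τ)) ≠ 0 ∧ h (D.code t (D.joined t c σ τ)) ≤ v

variable {k : ℕ} {t c : T} {f g h : ℕ → ℕ} {σ τ σ' τ' : V → ℕ} {v : ℕ} {P P' : ℕ → ℕ → Prop}

/-- A code determines its state on the bag, and nothing else about a state matters. So one pair of
numbers stands for all pairs of functions with these codes. -/
theorem Cand.congr (hc : D.Cand k t c f g σ' τ' v) (hσ : ∀ u, σ u < 16384) (hτ : ∀ u, τ u < 16384)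
    (e : D.code t σ' = D.code t σ) (e' : D.code c τ' = D.code c τ) :
    D.Cand k t c f g σ τ v ∧
      D.code t (D.joined t c σ' τ') = D.code t (D.joined t c σ τ) := by
  have h1 := ofDigits_map_inj (by norm_num) (fun u _ => hc.lt u) (fun u _ => hσ u) e
  have h2 := ofDigits_map_inj (by norm_num) (fun u _ => hc.lt' u) (fun u _ => hτ u) e'
  have hb : ∀ u ∈ D.bag c, D.bump t c τ' u = D.bump t c τ u := fun u hu => bump_congr h2 hu
  refine ⟨⟨hσ, hτ, e ▸ hc.ne, e' ▸ hc.ne', ⟨fun u hu hut => ?_, fun u hu hut => ?_,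
    fun u hu hut => ?_⟩, ?_, hc.le⟩, code_congr fun u hu => ?_⟩
  · rw [← hb u hu]; exact hc.compatible.ok u hu hut
  · rw [← h1 u hut, ← h2 u hu]; exact hc.compatible.eq u hu hut
  · rw [← h1 u hut, ← hb u hu]; exact hc.compatible.lt u hu hut
  · rw [← e, ← e', ← lost_congr h2, hc.eq]
  · rw [joined, joined, h1 u hu]
    split
    · next huc => rw [hb u huc]
    · rfl

/-- `P` records which pairs of codes have been visited. By `Cand.congr`, all candidates for the
newly visited pair have the same cell and the same value, so a single write covers them. -/
theorem Covers.update (H : D.Covers k t c f g P h) (hc : D.Cand k t c f g σ τ v)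
    (hP : ∀ a b, P' a b → P a b ∨ a = D.code t σ ∧ b = D.code c τ) :
    D.Covers k t c f g P' (Function.update h (D.code t (D.joined t c σ τ))
      (improve (h (D.code t (D.joined t c σ τ))) v)) := by
  set x := D.code t (D.joined t c σ τ) with hx
  have hv : v ≠ 0 := by
    have := hc.eq
    have := hc.ne
    have := hc.ne'
    omega
  refine ⟨fun a ha h0 => ?_, fun σ' τ' v' hc' hp => ?_⟩
  · by_cases hax : a = x
    · subst hax
      simp only [Function.update_self] at h0 ⊢
      rw [improve] at h0 ⊢
      split_ifs at h0 ⊢ with h1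
      · exact ⟨σ, τ, hc, rfl⟩
      · rcases min_choice (h x) v with h2 | h2
        · rw [h2]; exact H.sound x ha h1
        · rw [h2]; exact ⟨σ, τ, hc, rfl⟩
    · rw [Function.update_of_ne hax] at h0 ⊢
      exact H.sound a ha h0
  · rcases hP _ _ hp with hp | ⟨e, e'⟩
    · obtain ⟨h1, h2⟩ := H.complete σ' τ' v' hc' hp
      by_cases hax : D.code t (D.joined t c σ' τ') = x
      · rw [hax] at h1 h2 ⊢
        simp only [Function.update_self, improve, if_neg h1]
        omega
      · rw [Function.update_of_ne hax]
        exact ⟨h1, h2⟩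
    · obtain ⟨h1, h2⟩ := hc'.congr hc.lt hc.lt' e e'
      have h3 : v' = v := by
        have := h1.eq
        have := hc.eq
        omega
      rw [h2, ← hx, Function.update_self, improve, h3]
      split_ifs <;> omega

theorem Covers.skip (H : D.Covers k t c f g P h) (hσ : ∀ u, σ u < 16384) (hτ : ∀ u, τ u < 16384)
    (hc : ∀ v, ¬ D.Cand k t c f g σ τ v)
    (hP : ∀ a b, P' a b → P a b ∨ a = D.code t σ ∧ b = D.code c τ) :
    D.Covers k t c f g P' h := by
  refine ⟨H.sound, fun σ' τ' v' hc' hp => ?_⟩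
  rcases hP _ _ hp with hp | ⟨e, e'⟩
  · exact H.complete σ' τ' v' hc' hp
  · exact absurd (hc'.congr hσ hτ e e').1 (hc v')

theorem Covers.mono (H : D.Covers k t c f g P h) (hP : ∀ a b, P' a b → P a b) :
    D.Covers k t c f g P' h := ⟨H.sound, fun σ τ v hc hp => H.complete σ τ v hc (hP _ _ hp)⟩

theorem Covers.table [Fintype V] (hcr : c ≠ D.root) (hc : D.par c = t) {Z Z' : Set T}
    (hZ : D.Branches t Z) (hZ' : D.Branches c Z') (hW : D.below [c] = Z' ∪ {c})
    (hd : Disjoint Z (Z' ∪ {c})) (hf : D.Table k t Z f) (hg : D.Table k c Z' g)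
    (H : D.Covers k t c f g P h)
    (hP : ∀ a < 16384 ^ (D.bag t).length, ∀ b < 16384 ^ (D.bag c).length, P a b) :
    D.Table k t (Z ∪ (Z' ∪ {c})) h := by
  refine Table.combine hcr hc hZ hZ' hW hd hf hg (fun a ha h0 => ?_)
    fun σ τ hσ hτ f0 g0 hC hk => ?_
  · obtain ⟨σ, τ, hc, e⟩ := H.sound a ha h0
    exact ⟨σ, τ, hc.lt, hc.lt', hc.ne, hc.ne', hc.compatible, e, hc.eq, hc.le⟩
  · have := H.complete σ τ (f (D.code t σ) + g (D.code c τ) + D.lost t c τ - 1)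
      ⟨hσ, hτ, f0, g0, hC, by omega, by omega⟩
      (hP _ (ofDigits_map_lt (by norm_num) fun u _ => hσ u)
        _ (ofDigits_map_lt (by norm_num) fun u _ => hτ u))
    exact ⟨this.1, by omega⟩

end RTree

/-- The entry in register `76` is entered into the table from register `65` on. -/
def enter : Cmd :=
  assign 77 (arr 10 (reg 65 +ₑ reg 72)) ;;
  ite (reg 77) (ite (reg 77 -ₑ reg 76) (store 10 (reg 65 +ₑ reg 72) (reg 76)) skip)
    (store 10 (reg 65 +ₑ reg 72) (reg 76))

/-- The states in the registers `66` and `67` are combined. -/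
def combineStates : Cmd :=
  assign 68 (arr 10 (reg 58 +ₑ reg 66)) ;; assign 69 (arr 10 (reg 64 +ₑ reg 67)) ;;
  ite (reg 68) (ite (reg 69) (
    decode 13 0 61 62 67 ;; decode 11 1 55 56 66 ;; charges ;; check ;;
    ite (reg 70) (
      encode ;; assign 76 (reg 68 +ₑ reg 69 +ₑ reg 71 -ₑ lit 1) ;;
      ite (reg 76 -ₑ (reg 3 +ₑ lit 1)) skip enter) skip) skip) skip

namespace Enc

variable {n N : ℕ} {E : Enc n N} {t c : Fin N} {s : VState} {Q : VState → Prop}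

theorem wp_enter {p v : ℕ} (hp : s.reg 65 + s.reg 72 = p) (hv : s.reg 76 = v) (hpM : p < E.M)
    (hQ : ∀ s', Frame [77] [10] s s' →
      s'.arr 10 = Function.update (s.arr 10) p (improve (s.arr 10 p) v) → Q s') :
    enter.wp E.M E.R E.L Q s := by
  suffices h : enter.wp E.M E.R E.L
      (fun s' => s'.arr 10 = Function.update (s.arr 10) p (improve (s.arr 10 p) v)) s from
    h.frame.mono fun s' hs' => hQ s' ⟨fun x hx => hs'.1.reg x (by
      simpa [enter, Cmd.regs] using hx), fun j hj => hs'.1.arr j (by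
      simpa [enter, Cmd.arrs] using hj)⟩ hs'.2
  simp only [enter, wp_seq, wp_assign, wp_ite, wp_store, wp_skip]
  simp [hp, hv, hpM]
  refine ⟨fun h0 => ⟨fun h1 => ?_, fun h1 => ?_⟩, fun h0 => ?_⟩
  · rw [improve, if_neg h0, min_eq_right (by omega)]
  · rw [improve, if_neg h0, min_eq_left (by omega)]
  · rw [improve, if_pos h0]

/-- The registers for combining the tables of a node `t` and its child `c`. -/
structure Pair (E : Enc n N) (t c : Fin N) (s : VState) : Prop extends E.Ready s where
  h55 : s.reg 55 = E.bgp t + 1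
  h56 : s.reg 56 = (E.D.bag t).length
  h57 : s.reg 57 = 16384 ^ (E.D.bag t).length
  h61 : s.reg 61 = E.bgp c + 1
  h62 : s.reg 62 = (E.D.bag c).length
  h63 : s.reg 63 = 16384 ^ (E.D.bag c).length
  h58 : s.reg 58 + s.reg 57 ≤ s.reg 65
  h64 : s.reg 64 + s.reg 63 ≤ s.reg 65
  h65 : s.reg 65 + E.R < E.M

theorem Pair.frame {rs as : List ℕ} {s' : VState} (h : E.Pair t c s) (F : Frame rs as s s')
    (hr : ∀ x ∈ [1, 2, 3, 4, 11, 55, 56, 57, 58, 61, 62, 63, 64, 65], x ∉ rs)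
    (ha : ∀ j ∈ [0, 1, 2, 3, 5, 6], j ∉ as) : E.Pair t c s' where
  toReady := h.toReady.frame F (fun x hx => hr x (by simp at hx ⊢; omega))
    fun j hj => ha j (by simp at hj ⊢; omega)
  h55 := by rw [F.reg 55 (hr 55 (by simp)), h.h55]
  h56 := by rw [F.reg 56 (hr 56 (by simp)), h.h56]
  h57 := by rw [F.reg 57 (hr 57 (by simp)), h.h57]
  h61 := by rw [F.reg 61 (hr 61 (by simp)), h.h61]
  h62 := by rw [F.reg 62 (hr 62 (by simp)), h.h62]
  h63 := by rw [F.reg 63 (hr 63 (by simp)), h.h63]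
  h58 := by rw [F.reg 57 (hr 57 (by simp)), F.reg 58 (hr 58 (by simp)), F.reg 65 (hr 65 (by simp)),
    h.h57, ← h.h57]; exact h.h58
  h64 := by rw [F.reg 63 (hr 63 (by simp)), F.reg 64 (hr 64 (by simp)), F.reg 65 (hr 65 (by simp))]
            exact h.h64
  h65 := by rw [F.reg 65 (hr 65 (by simp))]; exact h.h65

theorem wp_combineStates (h : E.Pair t c s) {σ τ : Fin n → ℕ} (hσ : ∀ u, σ u < 16384)
    (hτ : ∀ u, τ u < 16384) (h66 : s.reg 66 = E.D.code t σ) (h67 : s.reg 67 = E.D.code c τ)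
    (hk : ∀ x, s.arr 10 x ≤ E.k + 1) {f g : ℕ → ℕ}
    (hf : f (E.D.code t σ) = s.arr 10 (s.reg 58 + E.D.code t σ))
    (hg : g (E.D.code c τ) = s.arr 10 (s.reg 64 + E.D.code c τ))
    (hQ : ∀ s', Frame combineStates.regs combineStates.arrs s s' →
      ((∃ v, E.D.Cand E.k t c f g σ τ v ∧ E.D.code t (E.D.joined t c σ τ) < s.reg 57 ∧
        s'.arr 10 = Function.update (s.arr 10) (s.reg 65 + E.D.code t (E.D.joined t c σ τ))
          (improve (s.arr 10 (s.reg 65 + E.D.code t (E.D.joined t c σ τ))) v)) ∨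
      (∀ v, ¬ E.D.Cand E.k t c f g σ τ v) ∧ s'.arr 10 = s.arr 10) → Q s') :
    combineStates.wp E.M E.R E.L Q s := by
  classical
  obtain ⟨f1, f2, f3, f4, f5, f6, f7, f8, f9, f10⟩ := E.M_facts
  have hp := E.pow_le_R t
  have hct := code_lt (E := E) t hσ
  have hcc := code_lt (E := E) c hτ
  have p58 := h.h58
  have p64 := h.h64
  have p65 := h.h65
  rw [h.h57] at p58
  rw [h.h63] at p64
  have kf := hk (s.reg 58 + E.D.code t σ)
  have kg := hk (s.reg 64 + E.D.code c τ)
  rw [← hf] at kf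
  rw [← hg] at kg
  suffices h' : combineStates.wp E.M E.R E.L (fun s' =>
      ((∃ v, E.D.Cand E.k t c f g σ τ v ∧ E.D.code t (E.D.joined t c σ τ) < s.reg 57 ∧
        s'.arr 10 = Function.update (s.arr 10) (s.reg 65 + E.D.code t (E.D.joined t c σ τ))
          (improve (s.arr 10 (s.reg 65 + E.D.code t (E.D.joined t c σ τ))) v)) ∨
      (∀ v, ¬ E.D.Cand E.k t c f g σ τ v) ∧ s'.arr 10 = s.arr 10)) s from
    h'.frame.mono fun s' hs' => hQ s' hs'.1 hs'.2
  simp only [combineStates, wp_seq, wp_assign]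
  refine ⟨by simp [h66]; omega, by simp [h67]; omega, ?_⟩
  have F0 : Frame [68, 69] [] s ((s.set 68 ((arr 10 (reg 58 +ₑ reg 66)).eval s)).set 69
      ((arr 10 (reg 64 +ₑ reg 67)).eval (s.set 68 ((arr 10 (reg 58 +ₑ reg 66)).eval s)))) :=
    ⟨fun x hx => by simp at hx; simp [hx], fun _ _ => rfl⟩
  have v68 : ((s.set 68 ((arr 10 (reg 58 +ₑ reg 66)).eval s)).set 69
      ((arr 10 (reg 64 +ₑ reg 67)).eval (s.set 68 ((arr 10 (reg 58 +ₑ reg 66)).eval s)))).reg 68 =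
      f (E.D.code t σ) := by simp [h66, hf]
  have v69 : ((s.set 68 ((arr 10 (reg 58 +ₑ reg 66)).eval s)).set 69
      ((arr 10 (reg 64 +ₑ reg 67)).eval (s.set 68 ((arr 10 (reg 58 +ₑ reg 66)).eval s)))).reg 69 =
      g (E.D.code c τ) := by simp [h67, hg]
  generalize (s.set 68 ((arr 10 (reg 58 +ₑ reg 66)).eval s)).set 69
      ((arr 10 (reg 64 +ₑ reg 67)).eval (s.set 68 ((arr 10 (reg 58 +ₑ reg 66)).eval s))) = s0 at *
  have P0 := h.frame F0 (by decide) (by decide)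
  refine wp_ite_iff (p := f (E.D.code t σ) ≠ 0) (by simp [v68]) trivial (fun f0 => ?_)
    (fun f0 => wp_skip.2 (.inr ⟨fun v hv => f0 hv.ne, by rw [F0.arr 10 (by decide)]⟩))
  refine wp_ite_iff (p := g (E.D.code c τ) ≠ 0) (by simp [v69]) trivial (fun g0 => ?_)
    (fun g0 => wp_skip.2 (.inr ⟨fun v hv => g0 hv.ne', by rw [F0.arr 10 (by decide)]⟩))
  rw [wp_seq]
  refine wp_decode (by decide) (by decide) (by decide) (by decide) (by decide) (by decide) c τ hτ
    P0.inp P0.h61 P0.h62 ((F0.reg 67 (by decide)).trans h67) fun s1 F1 d1 d1' => ?_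
  have P1 := P0.frame F1 (by decide) (by decide)
  have F01 := F0.trans F1
  rw [wp_seq]
  refine wp_decode (by decide) (by decide) (by decide) (by decide) (by decide) (by decide) t σ hσ
    P1.inp P1.h55 P1.h56 ((F01.reg 66 (by decide)).trans h66) fun s2 F2 d2 d2' => ?_
  have P2 := P1.frame F2 (by decide) (by decide)
  have F02 := F01.trans F2
  -- The order of the two decodings matters: the bag of `c` is marked with `0` and afterwards the
  -- bag of `t` with `1`, so that on the bag of `c` the marks show membership in the bag of `t`.
  have W2 : E.Work t c σ τ s2 := by
    refine ⟨P2.toReady, P2.h55, P2.h56, P2.h61, P2.h62, fun u hu => (d2 u hu).1, fun u hu => ?_,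
      fun u hu => ?_⟩
    · rw [F2.arr 13 (by decide)]; exact (d1 u hu).1
    · by_cases hut : u ∈ E.D.bag t
      · rw [if_pos hut]; exact (d2 u hut).2.1
      · rw [if_neg hut, (d2' u hut).1]; exact (d1 u hu).2.1
  rw [wp_seq]
  refine wp_charges W2 hτ fun s3 F3 b3 b3' => ?_
  have W3 := W2.frame F3 (by decide) (by decide)
  have F03 := F02.trans F3
  rw [wp_seq]
  refine wp_check W3 hσ hτ b3 fun s4 F4 c4 c4' l4 => ?_
  have W4 := W3.frame F4 (by decide) (by decide)
  have F04 := F03.trans F4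
  refine wp_ite_iff (p := E.D.Compatible t c σ τ) ?_ trivial (fun hC => ?_)
    (fun hC => wp_skip.2 (.inr ⟨fun v hv => hC hv.compatible, by rw [F04.arr 10 (by decide)]⟩))
  · rw [← c4']
    simp only [Expr.eval]
    omega
  rw [wp_seq]
  refine wp_encode W4 hσ hC (fun u hu => ?_) (fun u hu huc => ?_) fun s5 F5 y5 y5' => ?_
  · rw [F4.arr 14 (by decide)]; exact b3 u hu
  · rw [F4.arr 14 (by decide), b3' u huc]; exact (d2 u hu).2.2
  have F05 := F04.trans F5
  have W5 := W4.frame F5 (by decide) (by decide)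
  have e68 : s5.reg 68 = f (E.D.code t σ) := by
    rw [F5.reg 68 (by decide), F4.reg 68 (by decide), F3.reg 68 (by decide), F2.reg 68 (by decide),
      F1.reg 68 (by decide), v68]
  have e69 : s5.reg 69 = g (E.D.code c τ) := by
    rw [F5.reg 69 (by decide), F4.reg 69 (by decide), F3.reg 69 (by decide), F2.reg 69 (by decide),
      F1.reg 69 (by decide), v69]
  have e71 : s5.reg 71 = E.D.lost t c τ := by rw [F5.reg 71 (by decide), l4]
  have e65 : s5.reg 65 = s.reg 65 := F05.reg 65 (by decide)
  have e10 : s5.arr 10 = s.arr 10 := F05.arr 10 (by decide)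
  have hlost : E.D.lost t c τ ≤ (E.D.bag c).length * 1 := sum_map_le fun u => RTree.lostAt_le
  have hlen := E.length_bag c
  rw [wp_seq, wp_assign]
  refine ⟨by simp [e68, e69, e71]; omega, ?_⟩
  -- Values above `k + 1` exceed the budget and are dropped. This also keeps all entries, and sums
  -- of two of them, within the word size.
  refine wp_ite_iff (p := ¬ f (E.D.code t σ) + g (E.D.code c τ) + E.D.lost t c τ ≤ E.k + 2) ?_ ?_
    (fun hv => wp_skip.2 (.inr ⟨fun v hc => hv (by have := hc.eq; have := hc.le; omega), e10⟩))
    (fun hv => ?_)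
  · simp [e68, e69, e71, W5.hk]
    omega
  · simp [W5.hk]
    omega
  · refine wp_enter (p := s.reg 65 + E.D.code t (E.D.joined t c σ τ))
      (v := f (E.D.code t σ) + g (E.D.code c τ) + E.D.lost t c τ - 1) (by simp [e65, y5])
      (by simp [e68, e69, e71]) (by omega) fun s6 F6 h6 => .inl
        ⟨f (E.D.code t σ) + g (E.D.code c τ) + E.D.lost t c τ - 1, ⟨hσ, hτ, f0, g0, hC, ?_, ?_⟩,
        ?_, ?_⟩
    · omega
    · omega
    · rw [h.h57, ← y5]; exact y5'
    · rw [h6]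
      simp [e10]

end Enc

/-! ### The dynamic program -/

/-- All pairs of states are combined. -/
def processPairs : Cmd := forUp false 66 57 (forUp false 67 63 combineStates)

/-- Register `y` becomes the number of states of a bag whose size is in register `x`. -/
def power (x y : ℕ) : Cmd :=
  assign y (lit 1) ;; forUp false 78 x (assign y (reg y *ₑ lit 16384))

/-- The data of the child number `R[59]`, and space for a new table. -/
def loadChild : Cmd :=
  assign 60 (arr 0 (reg 75 +ₑ reg 59)) ;; assign 61 (arr 2 (reg 60)) ;;
  assign 62 (arr 0 (reg 61)) ;; assign 61 (reg 61 +ₑ lit 1) ;; assign 64 (arr 9 (reg 60)) ;;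
  assign 65 (reg 52) ;; assign 52 (reg 52 +ₑ reg 57)

def processChild : Cmd := loadChild ;; power 62 63 ;; processPairs ;; assign 58 (reg 65)

/-- The data of the node that is number `R[53]` from the end. -/
def loadNode : Cmd :=
  assign 54 (arr 3 (reg 2 -ₑ lit 1 -ₑ reg 53)) ;; assign 55 (arr 2 (reg 54)) ;;
  assign 56 (arr 0 (reg 55)) ;; assign 55 (reg 55 +ₑ lit 1) ;; assign 75 (arr 1 (reg 54)) ;;
  assign 74 (arr 0 (reg 75)) ;; assign 75 (reg 75 +ₑ lit 1) ;; assign 58 (reg 52)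

def processNode : Cmd :=
  loadNode ;; power 56 57 ;; assign 52 (reg 52 +ₑ reg 57) ;; initTable ;;
  forUp false 59 74 processChild ;; store 9 (reg 54) (reg 58)

/-- The algorithm, started with the input in array `0`. -/
def solve : Cmd :=
  Enc.preprocess ;; assign 52 (lit 0) ;; forUp true 53 2 processNode ;;
  ite (arr 10 (arr 9 (reg 4))) (assign 0 (lit 1)) (assign 0 (lit 0))

theorem improve_le {x v b : ℕ} (hx : x ≤ b) (hv : v ≤ b) : improve x v ≤ b := by
  rw [improve]
  split_ifs <;> omega

namespace Enc

variable {n N : ℕ} {E : Enc n N} {t c : Fin N} {s : VState} {Q : VState → Prop}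

/-- Both old tables end before register `65`, and writing takes place only from there on, so the
tables that are read stay fixed. The pairs covered so far are those that precede the current one
lexicographically. -/
theorem wp_processPairs (h : E.Pair t c s) (hk : ∀ x, s.arr 10 x ≤ E.k + 1)
    (h0 : ∀ x, s.reg 65 ≤ x → s.arr 10 x = 0)
    (hQ : ∀ s', Frame processPairs.regs processPairs.arrs s s' →
      (∀ x, x < s.reg 65 ∨ s.reg 65 + s.reg 57 ≤ x → s'.arr 10 x = s.arr 10 x) →
      (∀ x, s'.arr 10 x ≤ E.k + 1) →
      E.D.Covers E.k t c (fun a => s.arr 10 (s.reg 58 + a)) (fun b => s.arr 10 (s.reg 64 + b))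
        (fun a b => a < s.reg 57 ∧ b < s.reg 63) (fun x => s'.arr 10 (s.reg 65 + x)) → Q s') :
    processPairs.wp E.M E.R E.L Q s := by
  have hp := E.pow_le_R t
  have hp' := E.pow_le_R c
  have p58 := h.h58
  have p64 := h.h64
  let Good (P : ℕ → ℕ → Prop) (s' : VState) : Prop :=
    (∀ x, x < s.reg 65 ∨ s.reg 65 + s.reg 57 ≤ x → s'.arr 10 x = s.arr 10 x) ∧
      (∀ x, s'.arr 10 x ≤ E.k + 1) ∧
      E.D.Covers E.k t c (fun a => s.arr 10 (s.reg 58 + a)) (fun b => s.arr 10 (s.reg 64 + b))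
        P (fun x => s'.arr 10 (s.reg 65 + x))
  refine Cmd.wp_forUp (fun a => Good fun a' b' => a' < a ∧ b' < s.reg 63) ?_ (by decide) ?_ ?_
    fun s' F _ ⟨h1, h2, h3⟩ => hQ s' F h1 h2 h3
  · simpa [h.h57] using hp
  · refine ⟨fun _ _ => rfl, hk, fun a _ ha => absurd (h0 _ (by omega)) ha, fun _ _ _ _ hP => ?_⟩
    exact absurd hP.1 (by omega)
  · intro a ha s1 F1 h66 I1
    have e57 : s1.reg 57 = s.reg 57 := F1.reg 57 (by decide)
    have e63 : s1.reg 63 = s.reg 63 := F1.reg 63 (by decide)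
    have P1 := h.frame F1 (by decide) (by decide)
    refine Cmd.wp_forUp (fun b => Good fun a' b' => a' < a ∧ b' < s.reg 63 ∨ a' = a ∧ b' < b) ?_
      (by decide) ?_ ?_ ?_
    · simpa [P1.h63] using hp'
    · exact ⟨I1.1, I1.2.1, I1.2.2.mono fun a b h => by omega⟩
    · intro b hb s2 F2 h67 ⟨h1, h2, h3⟩
      have P2 := P1.frame F2 (by decide) (by decide)
      have F := F1.trans F2
      have g58 : s2.reg 58 = s.reg 58 := F.reg 58 (by decide)
      have g64 : s2.reg 64 = s.reg 64 := F.reg 64 (by decide)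
      have g65 : s2.reg 65 = s.reg 65 := F.reg 65 (by decide)
      have g57 : s2.reg 57 = s.reg 57 := F.reg 57 (by decide)
      have g66 : s2.reg 66 = a := (F2.reg 66 (by decide)).trans h66
      obtain ⟨σ, hσ, hσa⟩ := exists_ofDigits (by norm_num) (E.D.bag_nodup t) (h.h57 ▸ ha)
      obtain ⟨τ, hτ, hτb⟩ := exists_ofDigits (by norm_num) (E.D.bag_nodup c) (P1.h63 ▸ hb)
      change E.D.code t σ = a at hσa
      change E.D.code c τ = b at hτb
      refine wp_combineStates P2 hσ hτ (g66.trans hσa.symm) (h67.trans hτb.symm) h2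
        (f := fun a => s.arr 10 (s.reg 58 + a)) (g := fun b => s.arr 10 (s.reg 64 + b)) ?_ ?_
        fun s3 _ H => ?_
      · simp only [g58]
        exact (h1 _ (by omega)).symm
      · simp only [g64]
        exact (h1 _ (by omega)).symm
      · rcases H with ⟨v, hv, hlt, H⟩ | ⟨hv, H⟩
        · rw [g65] at H
          rw [g57] at hlt
          refine ⟨fun x hx => ?_, fun x => ?_, ?_⟩
          · rw [VState.set_arr, H, Function.update_of_ne (by omega), h1 x hx]
          · rw [VState.set_arr, H, Function.update_apply]
            split
            · exact improve_le (h2 _) hv.le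
            · exact h2 x
          · convert h3.update hv (P' := fun a' b' => a' < a ∧ b' < s.reg 63 ∨ a' = a ∧ b' < b + 1)
              fun a' b' hp => ?_ using 1
            · funext x
              simp only [VState.set_arr, H, Function.update_apply, Nat.add_left_cancel_iff]
            · omega
        · refine ⟨fun x hx => by rw [VState.set_arr, H, h1 x hx], fun x => by
            rw [VState.set_arr, H]; exact h2 x, ?_⟩
          simp only [VState.set_arr, H]
          exact h3.skip hσ hτ hv fun a' b' hp => by omega
    · intro s2 F2 _ ⟨h1, h2, h3⟩
      exact ⟨h1, h2, h3.mono fun a' b' hp => by rw [e63]; omega⟩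

theorem wp_power {x y : ℕ} (hy : y ≠ 78) (hxy : x ≠ y)
    (h : s.reg x = (E.D.bag t).length)
    (hQ : ∀ s', Frame [78, y] [] s s' → s'.reg y = 16384 ^ (E.D.bag t).length → Q s') :
    (power x y).wp E.M E.R E.L Q s := by
  obtain ⟨f1, f2, f3, f4, f5, f6, f7, f8, f9, f10⟩ := E.M_facts
  have hp := E.pow_le_R t
  have hlen := E.length_bag t
  suffices h' : (power x y).wp E.M E.R E.L (fun s' => s'.reg y = 16384 ^ (E.D.bag t).length) s from
    h'.frame.mono fun s' hs' => hQ s' ⟨fun z hz => hs'.1.reg z (by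
      simp [power, Cmd.regs] at hz ⊢; omega), fun j hj => hs'.1.arr j (by
      simp [power, Cmd.arrs])⟩ hs'.2
  simp only [power, wp_seq, wp_assign]
  refine ⟨by simp; omega, ?_⟩
  refine Cmd.wp_forUp (fun i s' => s'.reg y = 16384 ^ i) ?_ (by simpa [Cmd.regs] using hy.symm)
    ?_ ?_ ?_
  · simp [hxy, h]
    omega
  · simp [hy]
  · intro i hi s' F _ hi'
    simp [hxy, h] at hi
    have h1 : 16384 ^ (i + 1) ≤ 16384 ^ (E.D.bag t).length :=
      Nat.pow_le_pow_right (by norm_num) hi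
    rw [pow_succ] at h1
    simp [hi', hy, pow_succ]
    omega
  · intro s' F _ hi
    simpa [hxy, h] using hi

/-- The tables of the nodes from number `m` on have been computed. -/
structure Tables (E : Enc n N) (m : ℕ) (s : VState) : Prop extends E.Ready s where
  table : ∀ i : Fin N, m ≤ i → E.D.Table E.k (E.nth i) (E.D.below (E.ch (E.nth i)))
    (fun a => s.arr 10 (s.arr 9 (E.nth i) + a))
  le : ∀ i : Fin N, m ≤ i → s.arr 9 (E.nth i) + 16384 ^ (E.D.bag (E.nth i)).length ≤ s.reg 52
  zero : ∀ x, s.reg 52 ≤ x → s.arr 10 x = 0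
  entry_le : ∀ x, s.arr 10 x ≤ E.k + 1

end Enc

namespace RTree

variable {V T : Type*} {G : SimpleGraph V} {D : RTree G T} {k : ℕ} {t : T} {Z : Set T}

theorem Table.congr [Fintype V] {f g : ℕ → ℕ} (h : D.Table k t Z f)
    (hfg : ∀ a < 16384 ^ (D.bag t).length, g a = f a) : D.Table k t Z g where
  le l hl := by
    have e : g (D.code t (D.dig Z l)) = f (D.code t (D.dig Z l)) :=
      hfg _ (ofDigits_map_lt (by norm_num) fun u hu => hl.dig_lt hu)
    rw [e]
    exact h.le l hl
  exists_eq a ha h0 := by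
    rw [hfg a ha] at h0 ⊢
    exact h.exists_eq a ha h0

theorem Table.entry_le [Fintype V] {f : ℕ → ℕ} (h : D.Table k t Z f) {a : ℕ}
    (ha : a < 16384 ^ (D.bag t).length) : f a ≤ k + 1 := by
  by_cases h0 : f a = 0
  · omega
  · obtain ⟨l, hl, -, e⟩ := h.exists_eq a ha h0
    have := hl.cost
    omega

end RTree

namespace Enc

variable {n N : ℕ} {E : Enc n N} {t c : Fin N} {s : VState} {Q : VState → Prop} {m : ℕ}

/-- Finished tables lie below the first free cell, whose number is in register `52`; a command that
changes array `10` only from there on preserves them. -/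
theorem Tables.extend {rs as : List ℕ} {s' : VState} (h : E.Tables m s) (F : Frame rs as s s')
    (hr : ∀ x ∈ [1, 2, 3, 4, 11], x ∉ rs) (ha : ∀ j ∈ [0, 1, 2, 3, 5, 6, 9], j ∉ as)
    (h52 : s.reg 52 ≤ s'.reg 52) (h10 : ∀ x < s.reg 52, s'.arr 10 x = s.arr 10 x)
    (h0 : ∀ x, s'.reg 52 ≤ x → s'.arr 10 x = 0) (hk : ∀ x, s'.arr 10 x ≤ E.k + 1) :
    E.Tables m s' where
  toReady := h.toReady.frame F hr fun j hj => ha j (by simp at hj ⊢; omega)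
  table i hi := by
    have h1 := h.le i hi
    rw [F.arr 9 (ha 9 (by simp))]
    exact (h.table i hi).congr fun a ha => h10 _ (by omega)
  le i hi := by
    rw [F.arr 9 (ha 9 (by simp))]
    exact (h.le i hi).trans h52
  zero := h0
  entry_le := hk

theorem Tables.frame {rs as : List ℕ} {s' : VState} (h : E.Tables m s) (F : Frame rs as s s')
    (hr : ∀ x ∈ [1, 2, 3, 4, 11, 52], x ∉ rs) (ha : ∀ j ∈ [0, 1, 2, 3, 5, 6, 9, 10], j ∉ as) :
    E.Tables m s' := by
  have e52 : s'.reg 52 = s.reg 52 := F.reg 52 (hr 52 (by simp))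
  have e10 : s'.arr 10 = s.arr 10 := F.arr 10 (ha 10 (by simp))
  refine h.extend F (fun x hx => hr x (by simp at hx ⊢; omega))
    (fun j hj => ha j (by simp at hj ⊢; omega)) e52.ge (fun x _ => by rw [e10]) ?_ ?_
  · rw [e52, e10]; exact h.zero
  · rw [e10]; exact h.entry_le

/-- The registers while the node `t` is processed, after its children in the list `cs`. -/
structure Node (E : Enc n N) (m : ℕ) (t : Fin N) (cs : List (Fin N)) (s : VState) : Prop
    extends E.Tables m s where
  h54 : s.reg 54 = t
  h55 : s.reg 55 = E.bgp t + 1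
  h56 : s.reg 56 = (E.D.bag t).length
  h57 : s.reg 57 = 16384 ^ (E.D.bag t).length
  h75 : s.reg 75 = E.chp t + 1
  h58 : s.reg 58 + s.reg 57 ≤ s.reg 52
  current : E.D.Table E.k t (E.D.below cs) (fun a => s.arr 10 (s.reg 58 + a))

theorem wp_loadChild {i : ℕ} (hi : i < (E.ch t).length) (hc : (E.ch t)[i] = c)
    (h : E.Node m t ((E.ch t).take i) s)
    (h59 : s.reg 59 = i) (h52 : s.reg 52 + E.R < E.M)
    (hQ : ∀ s', Frame loadChild.regs loadChild.arrs s s' →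
      s'.reg 61 = E.bgp c + 1 → s'.reg 62 = (E.D.bag c).length →
      s'.reg 64 = s.arr 9 c → s'.reg 65 = s.reg 52 → s'.reg 52 = s.reg 52 + s.reg 57 → Q s') :
    loadChild.wp E.M E.R E.L Q s := by
  obtain ⟨f1, f2, f3, f4, f5, f6, f7, f8, f9, f10⟩ := E.M_facts
  have hp := E.pow_le_R t
  have hl := E.chp_lt c
  have hl' := E.chp_lt t
  have e1 := E.inp_child t i hi
  have e2 := E.inp_bgp c
  have h57 := h.h57
  rw [hc] at e1
  suffices h' : loadChild.wp E.M E.R E.L (fun s' => s'.reg 61 = E.bgp c + 1 ∧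
      s'.reg 62 = (E.D.bag c).length ∧ s'.reg 64 = s.arr 9 c ∧
      s'.reg 65 = s.reg 52 ∧ s'.reg 52 = s.reg 52 + s.reg 57) s from
    h'.frame.mono fun s' ⟨F, q1, q2, q3, q4, q5⟩ => hQ s' F q1 q2 q3 q4 q5
  simp only [loadChild, wp_seq, wp_assign]
  simp [h.h75, h59, h.inp, e1, h.bgp, e2]
  refine ⟨?_, ?_, ?_⟩ <;> omega

/-- The table of the child is available because its number is at least `m`. The result is written to
a fresh table, which then takes the role of the current one; the old one is abandoned. -/
theorem wp_processChild {i : ℕ} (hi : i < (E.ch t).length) (hc : (E.ch t)[i] = c)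
    (h : E.Node m t ((E.ch t).take i) s)
    (h59 : s.reg 59 = i) (h52 : s.reg 52 + 2 * E.R < E.M) (hm : m ≤ E.idx c)
    (hQ : ∀ s', Frame processChild.regs processChild.arrs s s' →
      E.Node m t ((E.ch t).take (i + 1)) s' → s'.reg 52 = s.reg 52 + s.reg 57 → Q s') :
    processChild.wp E.M E.R E.L Q s := by
  suffices h' : processChild.wp E.M E.R E.L (fun s' => E.Node m t ((E.ch t).take (i + 1)) s' ∧
      s'.reg 52 = s.reg 52 + s.reg 57) s from
    h'.frame.mono fun s' ⟨F, q1, q2⟩ => hQ s' F q1 q2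
  have hp := E.pow_le_R t
  have hcm : c ≠ E.D.root ∧ E.D.par c = t := (E.mem_ch t c).1 (hc ▸ List.getElem_mem hi)
  have h9 := h.le (E.idx c) hm
  have htab := h.table (E.idx c) hm
  rw [nth_idx] at h9 htab
  have h58 := h.h58
  have h57 := h.h57
  simp only [processChild, wp_seq]
  refine wp_loadChild hi hc h h59 (by omega) fun s1 F1 a61 a62 a64 a65 a52 => ?_
  refine wp_power (by decide) (by decide) a62 fun s2 F2 a63 => ?_
  have F := F1.trans F2
  have b52 : s2.reg 52 = s.reg 52 + s.reg 57 := (F2.reg 52 (by decide)).trans a52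
  have b10 : s2.arr 10 = s.arr 10 := F.arr 10 (by decide)
  have b57 : s2.reg 57 = s.reg 57 := F.reg 57 (by decide)
  have b58 : s2.reg 58 = s.reg 58 := F.reg 58 (by decide)
  have b65 : s2.reg 65 = s.reg 52 := (F2.reg 65 (by decide)).trans a65
  have b64 : s2.reg 64 = s.arr 9 c := (F2.reg 64 (by decide)).trans a64
  have R2 : E.Ready s2 := h.toReady.frame F (by decide) (by decide)
  have P2 : E.Pair t c s2 := by
    refine ⟨R2, ?_, ?_, b57.trans h57, ?_, ?_, a63, ?_, ?_, ?_⟩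
    · rw [F.reg 55 (by decide), h.h55]
    · rw [F.reg 56 (by decide), h.h56]
    · rw [F2.reg 61 (by decide), a61]
    · rw [F2.reg 62 (by decide), a62]
    · omega
    · omega
    · omega
  refine wp_processPairs P2 (by rw [b10]; exact h.entry_le) (fun x hx => ?_) fun s3 F3 c1 c2 c3 => ?_
  · rw [b10]; exact h.zero x (by omega)
  rw [b65, b57, b10] at c1
  have c52 : s3.reg 52 = s2.reg 52 := F3.reg 52 (by decide)
  have c65 : s3.reg 65 = s.reg 52 := (F3.reg 65 (by decide)).trans b65
  rw [wp_assign]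
  refine ⟨trivial, ?_⟩
  have F4 : Frame [58] [] s3 (s3.set 58 (s3.reg 65)) :=
    ⟨fun x hx => by simp at hx; simp [hx], fun _ _ => rfl⟩
  have d58 : (s3.set 58 (s3.reg 65)).reg 58 = s.reg 52 := by simp [c65]
  simp only [Expr.eval]
  generalize s3.set 58 (s3.reg 65) = s4 at *
  have F04 := (F.trans F3).trans F4
  have d10 : s4.arr 10 = s3.arr 10 := F4.arr 10 (by decide)
  have d52 : s4.reg 52 = s.reg 52 + s.reg 57 := by rw [F4.reg 52 (by decide), c52, b52]
  have d57 : s4.reg 57 = s.reg 57 := F04.reg 57 (by decide)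
  refine ⟨⟨h.toTables.extend F04 (by decide) (by decide) (by omega) (fun x hx => ?_) (fun x hx => ?_)
    (by rwa [d10]), ?_, ?_, ?_, d57.trans h57, ?_, by omega, ?_⟩, d52⟩
  · rw [d10, c1 x (by omega)]
  · rw [d10, c1 x (by omega), h.zero x (by omega)]
  · rw [F04.reg 54 (by decide), h.h54]
  · rw [F04.reg 55 (by decide), h.h55]
  · rw [F04.reg 56 (by decide), h.h56]
  · rw [F04.reg 75 (by decide), h.h75]
  · have hch : ∀ x ∈ (E.ch t).take i, x ≠ E.D.root ∧ E.D.par x = t := fun x hx =>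
      (E.mem_ch t x).1 (List.mem_of_mem_take hx)
    have hbc := RTree.below_singleton (E.mem_ch c)
    have hn : c ∉ (E.ch t).take i := by
      rw [List.mem_take_iff_getElem]
      rintro ⟨j, hj, e⟩
      have := (E.ch_nodup t).getElem_inj_iff.1 (e.trans hc.symm)
      omega
    -- The new branch consists of `c` and of the branches at the children of `c`. The table of `c`
    -- covers the latter only, and the combination adds `c` itself.
    rw [List.take_add_one, List.getElem?_eq_getElem hi, hc, Option.toList_some,
      RTree.below_append_singleton, hbc, d58, d10]
    rw [b58, b64, b10, b65] at c3
    refine RTree.Covers.table hcm.1 hcm.2 (RTree.branches_below hch)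
      (RTree.branches_below fun x hx => (E.mem_ch c x).1 hx) hbc
      (hbc ▸ RTree.disjoint_below hch hcm hn) h.current htab c3 fun a ha b hb => ?_
    rw [P2.h57, a63]
    exact ⟨ha, hb⟩

theorem wp_loadNode {i : Fin N} (h : E.Tables (i + 1) s) (h53 : s.reg 53 = N - (i + 1))
    (hQ : ∀ s', Frame loadNode.regs loadNode.arrs s s' → s'.reg 54 = E.nth i →
      s'.reg 55 = E.bgp (E.nth i) + 1 → s'.reg 56 = (E.D.bag (E.nth i)).length →
      s'.reg 75 = E.chp (E.nth i) + 1 → s'.reg 74 = (E.ch (E.nth i)).length →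
      s'.reg 58 = s.reg 52 → Q s') :
    loadNode.wp E.M E.R E.L Q s := by
  obtain ⟨f1, f2, f3, f4, f5, f6, f7, f8, f9, f10⟩ := E.M_facts
  have hl := E.chp_lt (E.nth i)
  have e : N - 1 - (N - (i + 1)) = (i : ℕ) := by omega
  suffices h' : loadNode.wp E.M E.R E.L (fun s' => s'.reg 54 = E.nth i ∧
      s'.reg 55 = E.bgp (E.nth i) + 1 ∧ s'.reg 56 = (E.D.bag (E.nth i)).length ∧
      s'.reg 75 = E.chp (E.nth i) + 1 ∧ s'.reg 74 = (E.ch (E.nth i)).length ∧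
      s'.reg 58 = s.reg 52) s from
    h'.frame.mono fun s' ⟨F, q1, q2, q3, q4, q5, q6⟩ => hQ s' F q1 q2 q3 q4 q5 q6
  simp only [loadNode, wp_seq, wp_assign]
  simp [h.hN, h53, e, h.nth, h.bgp, h.chp, h.inp, E.inp_bgp, E.inp_chp]
  refine ⟨?_, ?_, ?_⟩ <;> omega

/-- A node uses at most three tables, the initial one and one for each of at most two children;
hence `3 * R` cells. The assumed room of `5 * R` covers the addresses computed on the way. -/
theorem wp_processNode {i : Fin N} (h : E.Tables (i + 1) s) (h53 : s.reg 53 = N - (i + 1))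
    (h52 : s.reg 52 + 5 * E.R < E.M)
    (hQ : ∀ s', Frame processNode.regs processNode.arrs s s' → E.Tables i s' →
      s'.reg 52 ≤ s.reg 52 + 3 * E.R → Q s') :
    processNode.wp E.M E.R E.L Q s := by
  suffices h' : processNode.wp E.M E.R E.L (fun s' => E.Tables i s' ∧
      s'.reg 52 ≤ s.reg 52 + 3 * E.R) s from
    h'.frame.mono fun s' ⟨F, q1, q2⟩ => hQ s' F q1 q2
  have hR := E.le_R
  have hp := E.pow_le_R (E.nth i)
  have hch := E.length_ch (E.nth i)
  simp only [processNode, wp_seq]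
  refine wp_loadNode h h53 fun s1 F1 a54 a55 a56 a75 a74 a58 => ?_
  refine wp_power (by decide) (by decide) a56 fun s2 F2 a57 => ?_
  have F02 := F1.trans F2
  have T2 := h.frame F02 (by decide) (by decide)
  have b52 : s2.reg 52 = s.reg 52 := F02.reg 52 (by decide)
  have b58 : s2.reg 58 = s.reg 52 := (F2.reg 58 (by decide)).trans a58
  rw [wp_assign]
  refine ⟨by simp; omega, ?_⟩
  have F3 : Frame [52] [] s2 (s2.set 52 ((reg 52 +ₑ reg 57).eval s2)) :=
    ⟨fun x hx => by simp at hx; simp [hx], fun _ _ => rfl⟩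
  have c52 : (s2.set 52 ((reg 52 +ₑ reg 57).eval s2)).reg 52 = s.reg 52 + s2.reg 57 := by simp [b52]
  generalize s2.set 52 ((reg 52 +ₑ reg 57).eval s2) = s3 at *
  have F03 := F02.trans F3
  have c57 : s3.reg 57 = s2.reg 57 := F3.reg 57 (by decide)
  have c58 : s3.reg 58 = s.reg 52 := (F3.reg 58 (by decide)).trans b58
  have c10 : s3.arr 10 = s.arr 10 := F03.arr 10 (by decide)
  refine wp_initTable (t := E.nth i) ?_ ?_ ?_ (by rw [c57, a57]) (by omega) (fun x hx => ?_)
    fun s4 F4 d1 d2 => ?_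
  · rw [F03.arr 0 (by decide), h.inp]
  · rw [F3.reg 55 (by decide), F2.reg 55 (by decide), a55]
  · rw [F3.reg 56 (by decide), F2.reg 56 (by decide), a56]
  · rw [c10]; exact h.zero x (by omega)
  have F04 := F03.trans F4
  have F14 := (F2.trans F3).trans F4
  have d52 : s4.reg 52 = s.reg 52 + s2.reg 57 := (F4.reg 52 (by decide)).trans c52
  have d57 : s4.reg 57 = s2.reg 57 := (F4.reg 57 (by decide)).trans c57
  have d58 : s4.reg 58 = s.reg 52 := (F4.reg 58 (by decide)).trans c58
  have d74 : s4.reg 74 = (E.ch (E.nth i)).length := (F14.reg 74 (by decide)).trans a74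
  rw [c58] at d1 d2
  rw [c57, c10] at d1
  have N4 : E.Node (i + 1) (E.nth i) ((E.ch (E.nth i)).take 0) s4 := by
    refine ⟨h.extend F04 (by decide) (by decide) (by omega) (fun x hx => d1 x (by omega))
      (fun x hx => ?_) (fun x => ?_), ?_, ?_, ?_, d57.trans a57, ?_, by omega, ?_⟩
    · rw [d1 x (by omega), h.zero x (by omega)]
    · by_cases hx : x < s.reg 52 ∨ s.reg 52 + s2.reg 57 ≤ x
      · rw [d1 x hx]; exact h.entry_le x
      · have := d2.entry_le (a := x - s.reg 52) (by omega)
        rwa [show s.reg 52 + (x - s.reg 52) = x by omega] at this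
    · rw [F14.reg 54 (by decide), a54]
    · rw [F14.reg 55 (by decide), a55]
    · rw [F14.reg 56 (by decide), a56]
    · rw [F14.reg 75 (by decide), a75]
    · rw [d58]
      convert d2 using 1
      simp [RTree.below]
  refine Cmd.wp_forUp (fun j s' => E.Node (i + 1) (E.nth i) ((E.ch (E.nth i)).take j) s' ∧
    s'.reg 52 = s.reg 52 + (j + 1) * s2.reg 57) ?_ (by decide) ?_ ?_ ?_
  · rw [d74]; simp; omega
  · have F5 : Frame [59] [] s4 (s4.set 59 0) :=
      ⟨fun x hx => by simp at hx; simp [hx], fun _ _ => rfl⟩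
    refine ⟨⟨N4.toTables.frame F5 (by decide) (by decide), ?_, ?_, ?_, ?_, ?_, ?_, ?_⟩, ?_⟩
    · simpa using N4.h54
    · simpa using N4.h55
    · simpa using N4.h56
    · simpa using N4.h57
    · simpa using N4.h75
    · simpa using N4.h58
    · simpa using N4.current
    · simp [d52]
  · intro j hj s5 F5 h59 ⟨N5, e52⟩
    rw [d74] at hj
    have hmem : (E.ch (E.nth i))[j] ∈ E.ch (E.nth i) := List.getElem_mem hj
    obtain ⟨hr, hpar⟩ := (E.mem_ch _ _).1 hmem
    have hidx := E.idx_par hr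
    rw [hpar, idx_nth] at hidx
    have hj2 : (j + 1) * s2.reg 57 ≤ 2 * s2.reg 57 := Nat.mul_le_mul_right _ (by omega)
    refine wp_processChild hj rfl N5 h59 (by omega) hidx fun s6 F6 N6 g52 => ?_
    have F7 : Frame [59] [] s6 (s6.set 59 (j + 1)) :=
      ⟨fun x hx => by simp at hx; simp [hx], fun _ _ => rfl⟩
    refine ⟨⟨N6.toTables.frame F7 (by decide) (by decide), ?_, ?_, ?_, ?_, ?_, ?_, ?_⟩, ?_⟩
    · simpa using N6.h54
    · simpa using N6.h55
    · simpa using N6.h56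
    · simpa using N6.h57
    · simpa using N6.h75
    · simpa using N6.h58
    · simpa using N6.current
    · have e57 : s5.reg 57 = s2.reg 57 := (F5.reg 57 (by decide)).trans d57
      simp [g52, e52, e57]
      ring
  · intro s5 F5 _ ⟨N5, e52⟩
    rw [d74] at N5 e52
    rw [List.take_length] at N5
    have hj2 : ((E.ch (E.nth i)).length + 1) * s2.reg 57 ≤ 3 * s2.reg 57 :=
      Nat.mul_le_mul_right _ (by omega)
    rw [wp_store]
    refine ⟨⟨trivial, trivial⟩, ?_⟩
    simp only [Expr.eval, N5.h54]
    have h57 := N5.h57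
    have h58 := N5.h58
    have F6 : Frame [] [9] s5 (s5.put 9 (E.nth i) (s5.reg 58)) :=
      ⟨fun _ _ => rfl, fun j hj => by simp at hj; simp [hj]⟩
    refine ⟨⟨N5.toReady.frame F6 (by decide) (by decide), fun j hj => ?_, fun j hj => ?_, ?_, ?_⟩, ?_⟩
    · by_cases hji : j = i
      · subst hji
        simpa using N5.current
      · have : (E.nth j : ℕ) ≠ E.nth i := fun e => hji (E.nth_injective (Fin.ext e))
        have hne : (j : ℕ) ≠ i := fun e => hji (Fin.ext e)
        simpa [Function.update_of_ne this] using N5.table j (by omega)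
    · by_cases hji : j = i
      · subst hji
        simpa [← h57] using h58
      · have : (E.nth j : ℕ) ≠ E.nth i := fun e => hji (E.nth_injective (Fin.ext e))
        have hne : (j : ℕ) ≠ i := fun e => hji (Fin.ext e)
        simpa [Function.update_of_ne this] using N5.le j (by omega)
    · simpa using N5.zero
    · simpa using N5.entry_le
    · simp only [VState.put_reg]
      omega

/-- The algorithm decides whether `k` vertices can be deleted such that no chair is left. -/
theorem wp_solve (h0 : s.arr 0 = E.inp) (hz : ∀ j ≠ 0, ∀ i, s.arr j i = 0) {p : Prop}
    (hp : p ↔ ∃ S : Finset (Fin n), S.card ≤ E.k ∧ ¬ HasChair (E.G.induce ((S : Set (Fin n))ᶜ))) :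
    solve.wp E.M E.R E.L (fun s' => (p → s'.reg 0 = 1) ∧ (¬ p → s'.reg 0 = 0)) s := by
  obtain ⟨f1, f2, f3, f4, f5, f6, f7, f8, f9, f10⟩ := E.M_facts
  simp only [solve, wp_seq]
  refine wp_preprocess h0 (hz 6 (by decide)) fun s1 F1 R1 => ?_
  rw [wp_assign]
  refine ⟨by simp; omega, ?_⟩
  have F2 : Frame [52] [] s1 (s1.set 52 0) :=
    ⟨fun x hx => by simp at hx; simp [hx], fun _ _ => rfl⟩
  have R2 := R1.frame F2 (by decide) (by decide)
  have b52 : (s1.set 52 0).reg 52 = 0 := by simp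
  simp only [Expr.eval]
  generalize s1.set 52 0 = s2 at *
  have F02 := F1.trans F2
  have b10 : s2.arr 10 = s.arr 10 := F02.arr 10 (by decide)
  -- All tables together occupy at most `3 * R * N = 3 * L` cells, so every address stays below `M`.
  refine Cmd.wp_forUp (fun h s' => E.Tables (N - h) s' ∧ s'.reg 52 ≤ h * (3 * E.R)) ?_ (by decide)
    ?_ ?_ ?_
  · simpa [R2.hN] using f7
  · have F3 : Frame [53] [] s2 (s2.set 53 0) :=
      ⟨fun x hx => by simp at hx; simp [hx], fun _ _ => rfl⟩
    refine ⟨⟨R2.frame F3 (by decide) (by decide), fun i hi => by omega, fun i hi => by omega,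
      fun x _ => ?_, fun x => ?_⟩, ?_⟩
    · simp [b10, hz 10]
    · simp [b10, hz 10]
    · simp [b52]
  · intro h hh s3 F3 h53 ⟨T3, c52⟩
    rw [R2.hN] at hh
    have hb : h * (3 * E.R) ≤ N * (3 * E.R) := Nat.mul_le_mul_right _ hh.le
    have hb' : N * (3 * E.R) = 3 * E.L := by rw [L]; ring
    have hi : N - h = N - (h + 1) + 1 := by omega
    rw [hi] at T3
    refine wp_processNode (i := ⟨N - (h + 1), by omega⟩) T3 (h53.trans (by simp; omega)) (by omega)
      fun s4 F4 T4 d52 => ?_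
    have F5 : Frame [53] [] s4 (s4.set 53 (h + 1)) :=
      ⟨fun x hx => by simp at hx; simp [hx], fun _ _ => rfl⟩
    refine ⟨T4.frame F5 (by decide) (by decide), ?_⟩
    simp
    rw [add_mul]
    omega
  · intro s3 F3 _ ⟨T3, _⟩
    rw [R2.hN, Nat.sub_self] at T3
    have ht := RTree.Table.root (E.mem_ch E.D.root) (by
      simpa only [nth_idx] using T3.table (E.idx E.D.root) (Nat.zero_le _))
    rw [← exists_not_hasChair_iff, ← hp] at ht
    refine wp_ite_iff (p := p) (by simpa [Expr.eval, T3.hroot] using ht) trivial (fun h => ?_)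
      (fun h => ?_)
    · rw [wp_assign]
      exact ⟨by simp; omega, fun _ => by simp, fun h' => absurd h h'⟩
    · rw [wp_assign]
      exact ⟨by simp; omega, fun h' => absurd h' h, fun _ => by simp⟩

end Enc

/-! ### The program -/

/-- The input, in the cells of array `0`, is copied to every `16`-th cell behind it. Register `5`
holds the length of the input afterwards. -/
def relocate : Cmd :=
  assign 2 (arr 0 (lit 3)) ;; assign 5 (lit 5 +ₑ lit 2 *ₑ arr 0 (lit 1)) ;;
  forUp true 6 2 (
    assign 5 (reg 5 +ₑ lit 1 +ₑ arr 0 (reg 5)) ;; assign 5 (reg 5 +ₑ lit 1 +ₑ arr 0 (reg 5))) ;;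
  forUp true 6 5 (store 0 (reg 5 +ₑ lit 16 *ₑ reg 6) (arr 0 (reg 6)))

/-- The program for the two problems. -/
def program : RamProgram :=
  .seq (relocate.compile 1) (.seq (.arith .add 1 10 1) (solve.compile 16))

/-! ### Running time and size of words -/

/-- The nesting depth of the loops of one kind. -/
def Cmd.depth (l : Bool) : Cmd → ℕ
  | .skip => 0
  | .assign _ _ => 0
  | .store _ _ _ => 0
  | .seq c c' => max (c.depth l) (c'.depth l)
  | .ite _ c c' => max (c.depth l) (c'.depth l)
  | .forUp l' _ _ c => c.depth l + if l' = l then 1 else 0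

/-- The cost is a polynomial in `R` and `L` with nonnegative coefficients, of degrees at most the
nesting depths of the two kinds of loops. Its value at `R = L = 1` is the sum of the coefficients.
-/
theorem Cmd.cost_le {R L : ℕ} (hR : 0 < R) (hL : 0 < L) (c : Cmd) {d e : ℕ}
    (hd : c.depth false ≤ d) (he : c.depth true ≤ e) :
    c.cost R L ≤ c.cost 1 1 * (R ^ d * L ^ e) := by
  have one : ∀ d e, 1 ≤ R ^ d * L ^ e := fun d e => Nat.mul_pos (pow_pos hR _) (pow_pos hL _)
  induction c generalizing d e with
  | skip => simpa [cost] using one d e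
  | assign x a => exact Nat.le_mul_of_pos_right _ (one d e)
  | store j a b => exact Nat.le_mul_of_pos_right _ (one d e)
  | seq c c' ih ih' =>
    simp only [depth, max_le_iff] at hd he
    simp only [cost, add_mul]
    exact Nat.add_le_add (ih hd.1 he.1) (ih' hd.2 he.2)
  | ite a c c' ih ih' =>
    simp only [depth, max_le_iff] at hd he
    simp only [cost]
    rw [add_mul, add_mul]
    exact Nat.add_le_add (Nat.add_le_add (Nat.le_mul_of_pos_right _ (one d e)) (ih hd.1 he.1))
      (ih' hd.2 he.2)
  | forUp l x y c ih =>
    simp only [cost, ite_self, one_mul]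
    rw [add_mul]
    refine Nat.add_le_add (Nat.le_mul_of_pos_right _ (one d e)) ?_
    cases l with
    | false =>
      simp only [depth, if_true, Bool.false_eq_true, if_false, add_zero] at hd he ⊢
      obtain ⟨d, rfl⟩ := Nat.exists_eq_succ_of_ne_zero (show d ≠ 0 by omega)
      calc R * (c.cost R L + 12) ≤ R * ((c.cost 1 1 + 12) * (R ^ d * L ^ e)) := by
            rw [add_mul]
            exact Nat.mul_le_mul_left _ (Nat.add_le_add (ih (by omega) he)
              (Nat.le_mul_of_pos_right _ (one d e)))
        _ = _ := by rw [Nat.succ_eq_add_one, pow_succ]; ring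
    | true =>
      simp only [depth, if_true, Bool.true_eq_false, if_false, add_zero] at hd he ⊢
      obtain ⟨e, rfl⟩ := Nat.exists_eq_succ_of_ne_zero (show e ≠ 0 by omega)
      calc L * (c.cost R L + 12) ≤ L * ((c.cost 1 1 + 12) * (R ^ d * L ^ e)) := by
            rw [add_mul]
            exact Nat.mul_le_mul_left _ (Nat.add_le_add (ih hd (by omega))
              (Nat.le_mul_of_pos_right _ (one d e)))
        _ = _ := by rw [Nat.succ_eq_add_one, pow_succ]; ring

namespace Enc

variable {n N : ℕ} {E : Enc n N} {s : VState} {Q : VState → Prop}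

/-- The copy starts at the end of the input, so it never overwrites a cell that is still to be read.
The cells in between were `0` from the beginning and become the other arrays. -/
theorem wp_relocate (h0 : s.arr 0 = E.inp) :
    relocate.wp E.M E.R E.L (fun s' => s'.reg 5 = E.input.length ∧
      (∀ i, s'.arr 0 (E.input.length + 16 * i) = E.inp i) ∧
      ∀ x, E.input.length ≤ x → ¬ 16 ∣ x - E.input.length → s'.arr 0 x = 0) s := by
  obtain ⟨f1, f2, f3, f4, f5, f6, f7, f8, f9, f10⟩ := E.M_facts
  obtain ⟨-, i1, -, i3, -⟩ := E.inp_header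
  have hL := E.prefixLength_le_L N le_rfl
  have hz : ∀ i, E.input.length ≤ i → E.inp i = 0 := fun i hi => List.getD_eq_default _ _ hi
  simp only [relocate, wp_seq, wp_assign]
  simp [h0, i1, i3]
  refine ⟨by omega, by omega, ?_⟩
  refine Cmd.wp_forUp (fun t s' => s'.reg 5 = E.prefixLength t) (by simpa using f7) (by decide)
    (by simp [prefixLength]) ?_ ?_
  · intro t ht s1 F1 _ h5
    simp at ht
    have a0 : s1.arr 0 = E.inp := by rw [F1.arr 0 (by decide)]; simpa using h0
    have hc := E.chp_lt ⟨t, ht⟩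
    have e1 := E.inp_chp ⟨t, ht⟩
    have e2 := E.inp_bgp ⟨t, ht⟩
    have e3 := E.prefixLength_succ ⟨t, ht⟩
    have e4 : E.prefixLength t = E.chp ⟨t, ht⟩ := rfl
    have e5 : E.chp ⟨t, ht⟩ + 1 + (E.ch ⟨t, ht⟩).length = E.bgp ⟨t, ht⟩ := rfl
    rw [e4] at h5
    simp [wp_seq, h5, a0, e1, e5, e2, e3]
    omega
  · intro s1 F1 _ h5
    have a0 : s1.arr 0 = E.inp := by rw [F1.arr 0 (by decide)]; simpa using h0
    have h5' : s1.reg 5 = E.input.length := by simpa [E.input_length] using h5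
    rw [← E.input_length] at hL
    refine Cmd.wp_forUp (fun i s' => ∀ x, s'.arr 0 x =
      if E.input.length ≤ x ∧ 16 ∣ x - E.input.length ∧ (x - E.input.length) / 16 < i then
        E.inp ((x - E.input.length) / 16) else E.inp x) (by simpa [h5'] using hL) (by decide)
      (by simp [a0]) ?_ ?_
    · intro i hi s2 F2 h6 h
      have b5 : s2.reg 5 = E.input.length := (F2.reg 5 (by decide)).trans h5'
      have hv : s2.arr 0 i = E.inp i := by rw [h, if_neg (by omega)]
      rw [wp_store]
      refine ⟨⟨by simp [b5, h6]; omega, trivial⟩, fun x => ?_⟩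
      simp only [Expr.eval, ArithOp.eval, b5, h6, hv, VState.set_arr, VState.put_arr, reduceIte,
        Function.update_apply]
      by_cases hx : x = E.input.length + 16 * i
      · subst hx
        rw [if_pos rfl, if_pos (by omega)]
        congr 1
        omega
      · rw [if_neg hx, h]
        exact if_congr (by omega) rfl rfl
    · intro s2 F2 _ h
      refine ⟨(F2.reg 5 (by decide)).trans h5', fun i => ?_, fun x hx hd => ?_⟩
      · rw [h, h5']
        split
        · congr 1; omega
        · rw [hz i (by omega), hz _ (by omega)]
      · rw [h, if_neg (by tauto), hz x hx]

/-- With one array and base `0`, the memory is array `0` itself. After `relocate`, one addition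
brings the length of the input from machine register `10`, which is register `5` of the language,
into the base register `1`. From then on the same memory represents sixteen interleaved arrays. The
largest address is below `18 * M`: `16 * M` for the arrays, the rest for the base. -/
theorem decidesIn (E : Enc n N) {p : Prop}
    (hp : p ↔ ∃ S : Finset (Fin n), S.card ≤ E.k ∧ ¬ HasChair (E.G.induce ((S : Set (Fin n))ᶜ))) :
    program.DecidesIn (18 * E.M) (relocate.cost E.R E.L + (1 + solve.cost E.R E.L)) E.input p := by
  obtain ⟨f1, f2, f3, f4, f5, f6, f7, f8, f9, f10⟩ := E.M_facts
  have hL := E.prefixLength_le_L N le_rfl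
  rw [← E.input_length] at hL
  set s0 : VState := ⟨fun _ => 0, fun _ => E.inp⟩ with hs0
  obtain ⟨hsafe, h5, hc, hz⟩ := wp_relocate (E := E) (s := s0) rfl
  obtain ⟨σ1, t1, x1, ht1, S1, B1⟩ := relocate.exec_compile (B := 18 * E.M) (M := E.M) (st := 1)
    (b := 0) (by norm_num) (by omega) (by omega) s0
    ⟨fun x => by simp [hs0]; omega, fun j i => E.inp_lt i⟩ hsafe (by decide)
    (RamState.start E.input) ⟨fun _ => rfl, rfl, fun j hj i => by
      obtain rfl : j = 0 := by omega
      simp [RamState.start, hs0, inp]⟩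
  set s1 := relocate.run s0
  -- The state as seen with sixteen arrays: the input in array `0` and zeros elsewhere.
  set s2 : VState := ⟨s1.reg, fun j => if j = 0 then E.inp else fun _ => 0⟩ with hs2
  have hr : σ1.reg 10 + σ1.reg 1 = E.input.length := by
    rw [S1.base, S1.reg 5, h5, add_zero]
  have hmem : ∀ x, σ1.mem x = s1.arr 0 x := fun x => by simpa using S1.arr 0 (by norm_num) x
  have S2 : Sim 16 E.input.length s2
      (σ1.setReg 1 (ArithOp.add.eval (σ1.reg 10) (σ1.reg 1))) := by
    refine ⟨fun x => ?_, ?_, fun j hj i => ?_⟩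
    · simp only [RamState.setReg]
      rw [Function.update_of_ne (by omega), S1.reg]
    · simpa [RamState.setReg] using hr
    · simp only [RamState.setReg, hmem, hs2]
      split
      · next h => subst h; exact hc i
      · exact hz _ (by omega) (by omega)
  have B2 : s2.Below E.M := by
    refine ⟨B1.reg, fun j i => ?_⟩
    simp only [hs2]
    split
    · exact E.inp_lt i
    · change 0 < E.M
      omega
  obtain ⟨hsafe2, h1, h2⟩ := wp_solve (E := E) (s := s2) (by simp [hs2])
    (fun j hj i => by simp [hs2, hj]) hp
  obtain ⟨σ3, t3, x3, ht3, S3, -⟩ := solve.exec_compile (B := 18 * E.M) (st := 16) (by norm_num)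
    (by omega) (by omega) s2 B2 hsafe2 (by decide) _ S2
  have h0 : σ3.reg 0 = (solve.run s2).reg 0 := S3.reg 0
  refine ⟨σ3, _, .seq x1 (.seq (.arith ?_) x3), by omega, fun h => h0.trans (h1 h),
    fun h => h0.trans (h2 h)⟩
  rw [ArithOp.eval, hr]
  omega

/-- The constant in the bound for the running time. -/
def factor : ℕ := relocate.cost 1 1 + 1 + solve.cost 1 1

set_option maxRecDepth 10000 in
theorem cost_le (E : Enc n N) :
    relocate.cost E.R E.L + (1 + solve.cost E.R E.L) ≤ factor * (E.R ^ 8 * N) := by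
  have hR : 0 < E.R := by have := E.le_R; omega
  have hL : 0 < E.L := by have := E.N_le_L; have := E.pos_N; omega
  -- In `solve`, the seven nested loops bounded by `R` run over the children, the two states, the
  -- three vertices of a clique and a bucket. The one loop bounded by `L` runs over the nodes, and
  -- `L = N * R` supplies the eighth factor `R`. The same degrees are ample for `relocate`.
  have h1 := relocate.cost_le hR hL (d := 7) (e := 1) (by decide) (by decide)
  have h2 := solve.cost_le hR hL (d := 7) (e := 1) (by decide) (by decide)
  have e : E.R ^ 7 * E.L ^ 1 = E.R ^ 8 * N := by rw [L]; ring
  rw [e] at h1 h2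
  have h3 : 1 ≤ E.R ^ 8 * N := Nat.mul_pos (pow_pos hR _) E.pos_N
  rw [factor, add_mul, add_mul]
  omega

end Enc

/-- Both problems are solved by the program, as soon as their question is that for the chair as a
subgraph. -/
theorem decidesIn_program {Q : ∀ {n : ℕ}, SimpleGraph (Fin n) → ℕ → Prop}
    (hQ : ∀ {n : ℕ} (G : SimpleGraph (Fin n)) (k : ℕ), Q G k ↔
      ∃ S : Finset (Fin n), S.card ≤ k ∧ ¬ HasChair (G.induce ((S : Set (Fin n))ᶜ))) :
    ∃ C, ∀ (n N : ℕ) (G : SimpleGraph (Fin n)) (k : ℕ) (D : NiceTreeDecomposition G (Fin N))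
      (input : List ℕ), IsEncoding G k D input →
      program.DecidesIn (C * 2 ^ (C * D.width) * (N + k)) (C * 2 ^ (C * D.width) * N)
        input (Q G k) := by
  -- `R ^ 8 = 2 ^ (112 * (w + 1))`, since `16384 = 2 ^ 14` and `8 * 14 = 112`; and `1152 = 18 * 64`
  -- comes from the bound `18 * M` for the words.
  refine ⟨(Enc.factor + 1152) * 2 ^ 112, fun n N G k D input h => ?_⟩
  obtain ⟨E, rfl, rfl, hw, rfl⟩ := h.exists_enc
  have hc : 112 ≤ (Enc.factor + 1152) * 2 ^ 112 := by
    generalize Enc.factor = a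
    omega
  have hR : E.R ^ 8 ≤ 2 ^ 112 * 2 ^ ((Enc.factor + 1152) * 2 ^ 112 * D.width) := by
    have e : E.R ^ 8 = 2 ^ (112 + 112 * D.width) := by
      rw [Enc.R, hw, show 16384 = 2 ^ 14 by norm_num, ← pow_mul, ← pow_mul]
      congr 1
      ring
    rw [e, pow_add]
    exact Nat.mul_le_mul_left _ (Nat.pow_le_pow_right (by norm_num) (Nat.mul_le_mul_right _ hc))
  generalize 2 ^ ((Enc.factor + 1152) * 2 ^ 112 * D.width) = X at hR ⊢
  refine (E.decidesIn (hQ E.G E.k)).mono ?_ (E.cost_le.trans ?_) Iff.rfl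
  · have h1 : E.R * E.R ≤ E.R ^ 8 := by
      rw [← pow_two]
      exact Nat.pow_le_pow_right (by have := E.le_R; omega) (by norm_num)
    have h2 : 1 ≤ E.R * E.R := by have := E.le_R; nlinarith
    calc 18 * E.M = 1152 * (N * (E.R * E.R) + E.k) := by rw [Enc.M]; ring
      _ ≤ 1152 * (E.R * E.R * (N + E.k)) := by
        refine Nat.mul_le_mul_left _ ?_
        rw [mul_add, mul_comm N]
        exact Nat.add_le_add_left (Nat.le_mul_of_pos_left _ h2) _
      _ ≤ (Enc.factor + 1152) * (2 ^ 112 * X * (N + E.k)) :=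
        Nat.mul_le_mul (by omega) (Nat.mul_le_mul_right _ (h1.trans hR))
      _ = _ := by ring
  · calc Enc.factor * (E.R ^ 8 * N) ≤ (Enc.factor + 1152) * (2 ^ 112 * X * N) :=
        Nat.mul_le_mul (by omega) (Nat.mul_le_mul_right _ hR)
      _ = _ := by ring

/-- For the second bound, the factor `w + 1` from the number of nodes is at most `2 ^ w` and is
absorbed by raising the constant in the exponent from `C` to at least `C + 1`. -/
theorem solvable {Q : ∀ {n : ℕ}, SimpleGraph (Fin n) → ℕ → Prop}
    (hQ : ∀ {n : ℕ} (G : SimpleGraph (Fin n)) (k : ℕ), Q G k ↔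
      ∃ S : Finset (Fin n), S.card ≤ k ∧ ¬ HasChair (G.induce ((S : Set (Fin n))ᶜ))) :
    SolvableGivenNiceTreeDecomposition Q := by
  obtain ⟨C, hC⟩ := decidesIn_program hQ
  refine ⟨program, ⟨C, hC⟩, fun c => ⟨(C + 1) * (c + 1), fun n N G k D input h hN => ?_⟩⟩
  have hX : 2 ^ (C * D.width) * (D.width + 1) ≤ 2 ^ ((C + 1) * (c + 1) * D.width) := by
    have h1 : D.width + 1 ≤ 2 ^ D.width := Nat.lt_two_pow_self
    refine (Nat.mul_le_mul_left _ h1).trans ?_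
    rw [← pow_add]
    refine Nat.pow_le_pow_right (by norm_num) ?_
    have h2 : (C + 1) * D.width * 1 ≤ (C + 1) * D.width * (c + 1) :=
      Nat.mul_le_mul_left _ (by omega)
    calc _ = (C + 1) * D.width * 1 := by ring
      _ ≤ _ := h2
      _ = _ := by ring
  generalize 2 ^ ((C + 1) * (c + 1) * D.width) = X at hX ⊢
  have hY : 2 ^ (C * D.width) ≤ X := le_trans (Nat.le_mul_of_pos_right _ (by omega)) hX
  have hT : C * 2 ^ (C * D.width) * N ≤ C * (c + 1) * X * n := by
    calc C * 2 ^ (C * D.width) * N ≤ C * 2 ^ (C * D.width) * ((c + 1) * (D.width + 1) * n) :=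
        Nat.mul_le_mul_left _ (hN.trans (Nat.mul_le_mul_right _ (Nat.mul_le_mul_right _ (by omega))))
      _ = C * (c + 1) * (2 ^ (C * D.width) * (D.width + 1)) * n := by ring
      _ ≤ _ := Nat.mul_le_mul_right _ (Nat.mul_le_mul_left _ hX)
  have hC1 : C * (c + 1) ≤ (C + 1) * (c + 1) := Nat.mul_le_mul_right _ (by omega)
  have hC2 : C ≤ C * (c + 1) := Nat.le_mul_of_pos_right _ (by omega)
  refine (hC n N G k D input h).mono ?_ (hT.trans ?_) Iff.rfl
  · rw [mul_add, mul_add]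
    refine Nat.add_le_add (hT.trans ?_) (Nat.mul_le_mul_right _ (Nat.mul_le_mul (by omega) hY))
    exact Nat.mul_le_mul_right _ (Nat.mul_le_mul_right _ hC1)
  · exact Nat.mul_le_mul_right _ (Nat.mul_le_mul_right _ hC1)

end SingleExp

theorem mainTheorem6 :
    SingleExp.SolvableGivenNiceTreeDecomposition
        (fun G k => SingleExp.MDeletion SingleExp.chair G k) ∧
      SingleExp.SolvableGivenNiceTreeDecomposition
        (fun G k => SingleExp.TMDeletion SingleExp.chair G k) := by
  refine ⟨SingleExp.solvable fun G k => ?_, SingleExp.solvable fun G k => ?_⟩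
  · simp only [SingleExp.MDeletion, SingleExp.isMinor_chair_iff]
  · simp only [SingleExp.TMDeletion, SingleExp.isTopologicalMinor_chair_iff]
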